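/- Let $\Lambda_{q,t}$ be the ring of symmetric functions over $\mathbb C(q,t)$, i.e. the polynomial ring $\mathbb C(q,t)[p_1,p_2,\dots]$ in the power sums, and let $P_\mu=P_\mu(x;q,t)$ be the Macdonald polynomials: the family, indexed by all partitions, such that $P_\lambda=m_\lambda+\sum_{\mu<\lambda}c_{\lambda\mu}m_\mu$ for the dominance order, with $c_{\lambda\mu}\in\mathbb C(q,t)$, and $(P_\lambda,P_\mu)_{q,t}=0$ for $\lambda\ne\mu$, where $(p_\lambda,p_\mu)_{q,t}=\delta_{\lambda\mu}z_\lambda\prod_i\frac{1-q^{\lambda_i}}{1-t^{\lambda_i}}$. Let $A:\Lambda_{q,t}\to\Lambda_{q,t}$ be a $\mathbb C(q,t)$-linear operator with $AP_\mu=a_\mu P_\mu$ for all partitions $\mu$, where $a_\mu\in\mathbb C(q,t)$. Suppose that $A$ is vertex realizable of weight $r\ge1$ with kernel $K_A$. This means that $K_A(z_r,\dots,z_1)$ is a formal Laurent series with coefficients in $\mathbb C(q,t)$ which, for every $M$, has only finitely many terms $z_1^{e_1}\cdots z_r^{e_r}$ with all $e_\alpha\ge -M$ (as is the case for every element of $\mathbb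 C(q,t)((z_1^{-1}))\cdots((z_r^{-1}))$), and that $$A=\Bigl[K_A(z_r,\dots,z_1)\exp\Bigl(\sum_{n\ge1}\tfrac{1-t^{-n}}{n}\,p_n\sum_{\alpha=1}^r z_\alpha^n\Bigr)\exp\Bigl(-\sum_{n\ge1}\tfrac{1-q^n}{n}\sum_{\alpha=1}^r z_\alpha^{-n}\cdot n\tfrac{\partial}{\partial p_n}\Bigr)\Bigr]\Big|_{z_r^0z_{r-1}^0\cdots z_1^0},$$ where $|_{z_r^0\cdots z_1^0}$ is the iterated constant term (first in $z_r$, then in $z_{r-1}$, and so on). Let $L$ be an extension field of $\mathbb C(q,t)$ and let $u,v\in L$ with $u\neq0$ (for example independent variables, $L=\mathbb C(q,t,u,v)$). For a box $s=(i,j)$ of $\mu$ put $a(s)=\mu_i-j$, $l(s)=\mu^t_j-i$, $a'(s)=j-1$, $l'(s)=i-1$. Define the power series in $Q$ $$\langle A\rangle_{u,v}=\sum_\mu(-uQ)^{|\mu|}\prod_{s\in\mu}\frac{q^{a'(s)}-v\,t^{l'(s)}}{1-t^{l(s)}q^{a(s)+1}}\cdot a_\mu\cdot\prod_{s\in\mu}\frac{t^{-l'(s)}-u^{-1}q^{-a'(s)}}{1-q^{-a(s)}t^{-(l(s)+1)}}\in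 L[[Q]],$$ let $\langle 1\rangle_{u,v}$ be the same series with all $a_\mu$ replaced by $1$, and let $\langle A\rangle'_{u,v}=\langle A\rangle_{u,v}/\langle1\rangle_{u,v}$. Then, in $L[[Q]]$, $$\langle A\rangle'_{u,v}=\Bigl[K_A(z_r,\dots,z_1)\exp\Bigl(\sum_{n\ge1}\tfrac{(-1)^n}{n}(u^n-1)\sum_{\alpha=1}^r z_\alpha^nQ^n\Bigr)\exp\Bigl(\sum_{n\ge1}\tfrac{(-1)^n}{n}(1-v^n)\sum_{\alpha=1}^r z_\alpha^{-n}\Bigr)\Bigr]\Big|_{z_r^0z_{r-1}^0\cdots z_1^0}.$$ -/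

import Mathlib

noncomputable section

namespace MacVertex

open MvPolynomial

/-! ### The coefficient field and the ring of symmetric functions -/

/-- The field `ℂ(q,t)` of rational functions in two independent variables. -/
abbrev Fqt : Type := FractionRing (MvPolynomial (Fin 2) ℂ)

/-- The variable `q` of `ℂ(q,t)`. -/
def q : Fqt := algebraMap (MvPolynomial (Fin 2) ℂ) Fqt (X 0)

/-- The variable `t` of `ℂ(q,t)`. -/
def t : Fqt := algebraMap (MvPolynomial (Fin 2) ℂ) Fqt (X 1)

/-- The ring `Λ_{q,t}` of symmetric functions over `ℂ(q,t)` (the bosonic Fock space), as the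
polynomial ring in the power sums; the variable `X n` is the power sum `p_n`, `n ≥ 1`. -/
abbrev Lam : Type := MvPolynomial ℕ+ Fqt

/-- The symmetric function `f`, written in the variables `x_1, …, x_N` (all further variables are
set to zero): `p_n ↦ x_1^n + ⋯ + x_N^n`. -/
def toVars (N : ℕ) : Lam →ₐ[Fqt] MvPolynomial (Fin N) Fqt :=
  aeval fun n : ℕ+ => psum (Fin N) Fqt (n : ℕ)

/-! ### Partitions -/

/-- Partitions of arbitrary size. -/
abbrev Ptn : Type := Σ n : ℕ, n.Partition

/-- The parts `μ_1 ≥ μ_2 ≥ ⋯ ≥ μ_l > 0` of a partition, in decreasing order. -/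
def rows {n : ℕ} (μ : n.Partition) : List ℕ := μ.parts.sort (· ≥ ·)

/-- The dominance order: `μ ≤ lam` if and only if `μ_1 + ⋯ + μ_k ≤ lam_1 + ⋯ + lam_k` for
all `k`. -/
def DomLE {n : ℕ} (μ lam : n.Partition) : Prop :=
  ∀ k : ℕ, ((rows μ).take k).sum ≤ ((rows lam).take k).sum

/-- The Young diagram of a partition; the box in row `i` and column `j` (counted from `1`) is the
cell `(i - 1, j - 1)`. -/
def diagram {n : ℕ} (μ : n.Partition) : YoungDiagram :=
  YoungDiagram.ofRowLens (rows μ) (Multiset.pairwise_sort μ.parts (· ≥ ·)).sortedGE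

/-- The arm length `a(s) = μ_i - j`. -/
def arm {n : ℕ} (μ : n.Partition) (s : ℕ × ℕ) : ℕ := (diagram μ).rowLen s.1 - (s.2 + 1)

/-- The leg length `l(s) = μ^t_j - i`. -/
def leg {n : ℕ} (μ : n.Partition) (s : ℕ × ℕ) : ℕ := (diagram μ).colLen s.2 - (s.1 + 1)

/-- The co-arm length `a'(s) = j - 1`. -/
def coarm (s : ℕ × ℕ) : ℕ := s.2

/-- The co-leg length `l'(s) = i - 1`. -/
def coleg (s : ℕ × ℕ) : ℕ := s.1

/-! ### Macdonald polynomials -/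

/-- The scalar product `(p_λ, p_μ)_{q,t} = δ_{λμ} z_λ ∏_i (1 - q^{λ_i}) / (1 - t^{λ_i})`. The
exponent `m n` of `p_n` in a monomial is the multiplicity of the part `n`, and
`z_λ = ∏_n n^{m n} (m n)!`. -/
def scalarQT (f g : Lam) : Fqt :=
  ∑ m ∈ f.support, f.coeff m * g.coeff m *
    m.prod fun n k =>
      (k.factorial : Fqt) * (((n : ℕ) : Fqt) * ((1 - q ^ (n : ℕ)) / (1 - t ^ (n : ℕ)))) ^ k

/-- The defining properties of the Macdonald polynomials:
(i) `P_λ = m_λ + ∑_{μ < λ} c_{λμ} m_μ` for the dominance order, and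
(ii) `(P_λ, P_μ)_{q,t} = 0` for `λ ≠ μ`. -/
structure IsMacdonaldFamily (P : Ptn → Lam) : Prop where
  triangular : ∀ (n : ℕ) (lam : n.Partition), ∃ c : n.Partition → Fqt,
    c lam = 1 ∧ (∀ μ, c μ ≠ 0 → DomLE μ lam) ∧
      ∀ N : ℕ, toVars N (P ⟨n, lam⟩) = ∑ μ : n.Partition, c μ • msymm (Fin N) Fqt μ
  orthogonal : ∀ lam μ : Ptn, lam ≠ μ → scalarQT (P lam) (P μ) = 0

/-- The Macdonald polynomials `P_μ(x;q,t)`: the family with the properties (i) and (ii). -/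
def macdonaldP : Ptn → Lam := Classical.epsilon IsMacdonaldFamily

/-! ### Formal Laurent series in `z_1, …, z_r`

A two-sided formal Laurent series is given by its coefficients; the index `i : Fin r` belongs to
the variable `z_{i+1}`. -/

/-- Formal Laurent series in `z_1, …, z_r` with coefficients in `R`, infinite in all directions. -/
abbrev Laurent (r : ℕ) (R : Type*) : Type _ := (Fin r → ℤ) → R

/-- A power series in `z_1, …, z_r` as a Laurent series. -/
def ofPos {r : ℕ} {R : Type*} [Semiring R] (G : MvPowerSeries (Fin r) R) : Laurent r R := fun e =>
  if ∀ i, 0 ≤ e i then MvPowerSeries.coeff (Finsupp.equivFunOnFinite.symm fun i => (e i).toNat) G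
  else 0

/-- A power series in `z_1⁻¹, …, z_r⁻¹` as a Laurent series. -/
def ofNeg {r : ℕ} {R : Type*} [Semiring R] (G : MvPowerSeries (Fin r) R) : Laurent r R :=
  fun e => ofPos G (-e)

/-- Product of Laurent series with coefficients in a power series ring `L[[x_i : i ∈ σ]]`. Each
coefficient, with respect to the `z` and to the `x`, is the sum of the products of coefficients;
the product is defined where these sums are finite. -/
def mulL {r : ℕ} {σ L : Type*} [CommRing L] (G H : Laurent r (MvPowerSeries σ L)) :
    Laurent r (MvPowerSeries σ L) :=
  fun e m => ∑ᶠ d : Fin r → ℤ, MvPowerSeries.coeff m (G d * H (e - d))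

/-- The iterated constant term `[F]|_{z_r^0 z_{r-1}^0 ⋯ z_1^0}`: first the constant term
in `z_r`, then in `z_{r-1}`, and so on. -/
def iterCT {R : Type*} : (r : ℕ) → Laurent r R → R
  | 0, F => F ![]
  | r + 1, F => iterCT r fun e => F (Fin.snoc (α := fun _ => ℤ) e 0)

/-- The series `∑_{n ≥ 1} c_n ∑_α z_α^n`. -/
def powerSums (r : ℕ) {R : Type*} [Semiring R] (c : ℕ+ → R) : MvPowerSeries (Fin r) R := fun m =>
  ∑ α : Fin r, if h : 0 < m α ∧ m = Finsupp.single α (m α) then c ⟨m α, h.1⟩ else 0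

/-- The exponential `∑_k G^k / k!` of a power series without constant term. -/
def expS {r : ℕ} {R : Type*} [CommRing R] [Algebra ℚ R] (G : MvPowerSeries (Fin r) R) :
    MvPowerSeries (Fin r) R :=
  (PowerSeries.exp ℚ).subst G

/-! ### Vertex operators -/

/-- `exp (∑_{n ≥ 1} (1 - t^{-n})/n · p_n ∑_α z_α^n)`. -/
def creation (r : ℕ) : MvPowerSeries (Fin r) (MvPowerSeries ℕ+ Fqt) :=
  expS (powerSums r fun n : ℕ+ =>
    MvPowerSeries.monomial (Finsupp.single n 1) ((1 - (t ^ (n : ℕ))⁻¹) / ((n : ℕ) : Fqt)))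

/-- The derivation `-∑_{n ≥ 1} (1 - q^n)/n · ∑_α w_α^n · n ∂/∂p_n` of the polynomial ring in the
`w_α` (with `w_α = z_α⁻¹`) and the `p_n`. -/
def annihilationD (r : ℕ) :
    Derivation Fqt (MvPolynomial (Fin r ⊕ ℕ+) Fqt) (MvPolynomial (Fin r ⊕ ℕ+) Fqt) :=
  mkDerivation Fqt (Sum.elim (fun _ => 0) fun n : ℕ+ =>
    -(C ((1 - q ^ (n : ℕ)) / ((n : ℕ) : Fqt) * ((n : ℕ) : Fqt)) *
      ∑ α : Fin r, X (Sum.inl α) ^ (n : ℕ)))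

/-- `exp (-∑_{n ≥ 1} (1 - q^n)/n · ∑_α w_α^n · n ∂/∂p_n) f`, a polynomial in `w_α = z_α⁻¹` with
coefficients in `Λ_{q,t}`. The exponential series is a finite sum, since every application of the
derivation lowers the degree in the `p_n`. -/
def annihilate (r : ℕ) (f : Lam) : MvPolynomial (Fin r) Lam :=
  sumAlgEquiv Fqt (Fin r) ℕ+
    (∑ᶠ k : ℕ, (k.factorial : Fqt)⁻¹ • (annihilationD r)^[k] (rename Sum.inr f))

/-- The vertex operator
`exp (∑ (1 - t^{-n})/n p_n ∑_α z_α^n) · exp (-∑ (1 - q^n)/n ∑_α z_α^{-n} · n ∂/∂p_n)`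
applied to `f`, as a Laurent series in the `z_α`; its coefficients are regarded as elements of the
completion of `Λ_{q,t}`, the power series ring in the `p_n`. -/
def vertexAct (r : ℕ) (f : Lam) : Laurent r (MvPowerSeries ℕ+ Fqt) :=
  mulL (ofPos (creation r)) fun e =>
    ((ofNeg (annihilate r f : MvPowerSeries (Fin r) Lam) e : Lam) : MvPowerSeries ℕ+ Fqt)

/-- A Laurent series with coefficients in `ℂ(q,t)`, as one with coefficients in `L[[x_i]]`. -/
def scal {r : ℕ} (σ L : Type*) [Field L] [Algebra Fqt L] (K : Laurent r Fqt) :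
    Laurent r (MvPowerSeries σ L) :=
  fun e => MvPowerSeries.C (algebraMap Fqt L (K e))

/-- The operator `A` on `Λ_{q,t}`, with the Macdonald polynomials `P_μ` as eigenvectors for the
eigenvalues `a μ`, is vertex realizable of weight `r ≥ 1` with kernel `K`. -/
structure IsVertexRealizable (A : Lam →ₗ[Fqt] Lam) (a : Ptn → Fqt) (r : ℕ)
    (K : Laurent r Fqt) : Prop where
  one_le : 1 ≤ r
  eigen : ∀ μ : Ptn, A (macdonaldP μ) = a μ • macdonaldP μ
  /-- The kernel may be multiplied with power series in the `z_α⁻¹`: in every range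
  `e_1, …, e_r ≥ -M` of exponents it has only finitely many terms. All iterated Laurent series,
  i.e. all elements of `ℂ(q,t)((z_1⁻¹))((z_2⁻¹))⋯((z_r⁻¹))`, have this property. -/
  laurent : ∀ M : ℤ, {e : Fin r → ℤ | K e ≠ 0 ∧ ∀ i, -M ≤ e i}.Finite
  realize : ∀ f : Lam, ((A f : Lam) : MvPowerSeries ℕ+ Fqt) =
    iterCT r (mulL (scal ℕ+ Fqt K) (vertexAct r f))

/-! ### The `(u,v)`-bracket -/

/-- `∏_{s ∈ μ} (q^{a'(s)} - v t^{l'(s)}) / (1 - t^{l(s)} q^{a(s)+1})`. -/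
def vWeight {L : Type*} [Field L] [Algebra Fqt L] (v : L) {n : ℕ} (μ : n.Partition) : L :=
  let q : L := algebraMap Fqt L q
  let t : L := algebraMap Fqt L t
  ∏ s ∈ (diagram μ).cells,
    (q ^ coarm s - v * t ^ coleg s) / (1 - t ^ leg μ s * q ^ (arm μ s + 1))

/-- `∏_{s ∈ μ} (t^{-l'(s)} - u^{-1} q^{-a'(s)}) / (1 - q^{-a(s)} t^{-(l(s)+1)})`. -/
def uWeight {L : Type*} [Field L] [Algebra Fqt L] (u : L) {n : ℕ} (μ : n.Partition) : L :=
  let q : L := algebraMap Fqt L q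
  let t : L := algebraMap Fqt L t
  ∏ s ∈ (diagram μ).cells,
    ((t ^ coleg s)⁻¹ - u⁻¹ * (q ^ coarm s)⁻¹) / (1 - (q ^ arm μ s)⁻¹ * (t ^ (leg μ s + 1))⁻¹)

/-- The `(u,v)`-bracket of the operator with eigenvalues `a μ`, a power series in `Q`. -/
def bracket {L : Type*} [Field L] [Algebra Fqt L] (u v : L) (a : Ptn → Fqt) : PowerSeries L :=
  PowerSeries.mk fun n => ∑ μ : n.Partition,
    (-u) ^ n * vWeight v μ * algebraMap Fqt L (a ⟨n, μ⟩) * uWeight u μ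

/-- The normalized bracket `⟨A⟩' = ⟨A⟩ / ⟨1⟩`; the power series `⟨1⟩` has constant term `1`. -/
def normBracket {L : Type*} [Field L] [Algebra Fqt L] (u v : L) (a : Ptn → Fqt) : PowerSeries L :=
  bracket u v a * (bracket u v fun _ => 1)⁻¹

/-- `exp (∑_{n ≥ 1} (-1)^n/n · (u^n - 1) ∑_α z_α^n Q^n)`. -/
def uExp (r : ℕ) {L : Type*} [Field L] [CharZero L] (u : L) :
    MvPowerSeries (Fin r) (PowerSeries L) :=
  expS (powerSums r fun n : ℕ+ =>
    PowerSeries.monomial (n : ℕ) ((-1) ^ (n : ℕ) / ((n : ℕ) : L) * (u ^ (n : ℕ) - 1)))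

/-- `exp (∑_{n ≥ 1} (-1)^n/n · (1 - v^n) ∑_α w_α^n)`, where `w_α = z_α⁻¹`. -/
def vExp (r : ℕ) {L : Type*} [Field L] [CharZero L] (v : L) :
    MvPowerSeries (Fin r) (PowerSeries L) :=
  expS (powerSums r fun n : ℕ+ =>
    PowerSeries.C ((-1) ^ (n : ℕ) / ((n : ℕ) : L) * (1 - v ^ (n : ℕ))))

end MacVertex

end

noncomputable section

set_option linter.unusedSectionVars false

namespace MacFock
open MvPolynomial

/-! ### Exponential generating sequences -/

section ExpCoeff
variable {S S' : Type*} [CommRing S] [Algebra ℚ S] [CommRing S'] [Algebra ℚ S']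

/-! The bracket is a matrix coefficient of `A`. Let ε be the evaluation p_n ↦ (-t)^n (1 - u^n)/(1 -
t^n). By the product formulas for specialized Macdonald polynomials, the u-product over boxes, with
its factor (-u)^n, is ε(P_μ) (`evxy_macP_eq_uWeight`), and the v-product is the value of
P_μ/⟨P_μ,P_μ⟩ at p_n ↦ ((-v)^n - (-1)^n)/(1 - t^n) (`evxy_div_macNorm`). So the coefficient of Q^n
in the bracket is ε(A ξ_n), where ξ_n is the sum over |μ| = n of the v-weighted P_μ. By the Cauchy
identity (`hs_cK_eq_sum`, `sum_vWeight_smul`) ξ_n is the degree n part of a pure exponential exp(∑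
c_k p_k).

On an exponential a vertex operator acts explicitly. Its annihilation half is a translation of the
power sums (`annihilate_eq`), which multiplies the exponential by the v-exponential in the z_α⁻¹
(`sum_vWeight_mul_coeff_translate`); the evaluation ε turns its creation half into the u-exponential
(`evU_creationCoeff`). The factor left over is the bracket of the identity, which the normalization
removes. Degrees need care: the kernel is not assumed homogeneous, and Q records only the degree in
the z_α. The constant term is therefore split into parts of degree i in the z_α and j in the z_α⁻¹.
Since `A` preserves degree, the parts with i ≠ j vanish (`constPart_eq_zero`), and the diagonal
parts give a convolution with the bracket of the identity (`coeff_bracket_eq_sum`).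

The rest is Macdonald theory built on the Fock space. Let E_k be the modes `mac q t k` of the
one-variable vertex operator, and F_k those with inverted parameters. By partial fractions, E_0
becomes Macdonald's q-difference operator in N variables (`discD_mul_tv_mac`). Hence it is
triangular for the dominance order, with distinct eigenvalues in each degree when q and t are
generic (`exists_macdonald`). It is also self-adjoint (`form_mac_comm`), so its eigenvectors `macP`
are orthogonal, and they coincide with `macdonaldP` by uniqueness (`macdonaldP_eq`).

The specialization formula `evxy_macP` comes from relations between modes: [E_0, F_1] is a multiple
of p_1, and commuting with p_1 raises the index of a mode. These force p_1 P_μ to involve only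
partitions with one box added (`exists_pieri`) and determine three moments of the content of that
box (`exists_pieri_moments`). A functional on symmetric functions is determined by its behaviour
under p_1 and E_1 (`functional_eq_zero`), and both sides of `evxy_macP` behave alike. The remaining
constants are computed recursively: the values of P_μ by removing first columns (`macC_eq`), and
those of the dual polynomials by removing first rows (`macC_div_macNorm`). -/

/-- The coefficients of `exp (∑_{k ≥ 1} g_k z^k)`. -/
def expCoeff (g : ℕ+ → S) : ℕ → S
  | 0 => 1
  | n + 1 => (((n : ℚ) + 1)⁻¹) •
      ∑ k : Fin (n + 1), ((k : ℕ) + 1 : S) * g (k : ℕ).succPNat * expCoeff g (n - k)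

theorem expCoeff_zero (g : ℕ+ → S) : expCoeff g 0 = 1 := by rw [expCoeff]

theorem expCoeff_succ (g : ℕ+ → S) (n : ℕ) :
    ((n : S) + 1) * expCoeff g (n + 1) =
      ∑ k ∈ Finset.range (n + 1), ((k : S) + 1) * g k.succPNat * expCoeff g (n - k) := by
  rw [expCoeff, Finset.sum_range
    (fun k => ((k : S) + 1) * g k.succPNat * expCoeff g (n - k)), mul_smul_comm,
    ← smul_mul_assoc]
  have h : ((n : S) + 1) = algebraMap ℚ S ((n : ℚ) + 1) := by simp
  have h' : ((n : ℚ) + 1) ≠ 0 := by positivity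
  rw [h, Algebra.smul_def, ← map_mul, inv_mul_cancel₀ h', map_one, one_mul]

theorem natCast_succ_mul_cancel {n : ℕ} {a b : S} (h : ((n : S) + 1) * a = ((n : S) + 1) * b) :
    a = b := by
  have h1 : ((n : S) + 1) = algebraMap ℚ S ((n : ℚ) + 1) := by simp
  have h' : ((n : ℚ) + 1) ≠ 0 := by positivity
  have := congrArg (fun x => algebraMap ℚ S (((n : ℚ) + 1)⁻¹) * x) h
  simpa only [h1, ← mul_assoc, ← map_mul, inv_mul_cancel₀ h', map_one, one_mul] using this

/-- The recursion is the equation E' = g' E read coefficientwise; over a ℚ-algebra it has one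
solution with constant term 1. The identities between exponentials below are proved through this
uniqueness rather than by manipulating exponential series. -/
theorem expCoeff_unique (g : ℕ+ → S) (e : ℕ → S) (h0 : e 0 = 1)
    (h : ∀ n : ℕ, ((n : S) + 1) * e (n + 1) =
      ∑ k ∈ Finset.range (n + 1), ((k : S) + 1) * g k.succPNat * e (n - k)) (n : ℕ) :
    e n = expCoeff g n := by
  induction n using Nat.strong_induction_on with
  | _ n ih =>
    cases n with
    | zero => rw [h0, expCoeff_zero]
    | succ n =>
      apply natCast_succ_mul_cancel (n := n)
      rw [h, expCoeff_succ]
      refine Finset.sum_congr rfl fun k hk => ?_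
      rw [ih (n - k) (by omega)]

theorem map_expCoeff {G : Type*} [FunLike G S S'] [RingHomClass G S S'] (φ : G) (g : ℕ+ → S)
    (n : ℕ) : φ (expCoeff g n) = expCoeff (fun k => φ (g k)) n := by
  apply expCoeff_unique _ (fun n => φ (expCoeff g n)) (by simp [expCoeff_zero])
  intro n
  have := congrArg φ (expCoeff_succ g n)
  simpa using this

/-- The power series `exp (∑_{k ≥ 1} g_k z^k)`. -/
def expPS (g : ℕ+ → S) : PowerSeries S := PowerSeries.mk (expCoeff g)

/-- The derivative of `∑_{k ≥ 1} g_k z^k`. -/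
def derivPS (g : ℕ+ → S) : PowerSeries S := PowerSeries.mk fun k => ((k : S) + 1) * g k.succPNat

theorem derivative_expPS (g : ℕ+ → S) :
    PowerSeries.derivative S (expPS g) = derivPS g * expPS g := by
  ext n
  rw [PowerSeries.coeff_derivative, PowerSeries.coeff_mul, expPS, PowerSeries.coeff_mk, mul_comm,
    expCoeff_succ, Finset.Nat.sum_antidiagonal_eq_sum_range_succ_mk]
  simp [derivPS]

theorem expPS_unique (g : ℕ+ → S) (e : PowerSeries S) (h0 : PowerSeries.coeff 0 e = 1)
    (h : PowerSeries.derivative S e = derivPS g * e) : e = expPS g := by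
  ext n
  rw [expPS, PowerSeries.coeff_mk]
  refine expCoeff_unique g (fun n => PowerSeries.coeff n e) h0 (fun n => ?_) n
  have := congrArg (PowerSeries.coeff n) h
  rw [PowerSeries.coeff_derivative, PowerSeries.coeff_mul,
    Finset.Nat.sum_antidiagonal_eq_sum_range_succ_mk] at this
  rw [mul_comm, this]
  simp [derivPS]

/-- The logarithmic derivative of a product is the sum of the logarithmic derivatives, so both sides
solve the same differential equation. -/
theorem expPS_add (g g' : ℕ+ → S) : expPS (fun k => g k + g' k) = expPS g * expPS g' := by
  symm
  apply expPS_unique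
  · simp [expPS, expCoeff_zero]
  · have : derivPS (fun k => g k + g' k) = derivPS g + derivPS g' := by
      ext; simp [derivPS, mul_add]
    rw [Derivation.leibniz, derivative_expPS, derivative_expPS, this, smul_eq_mul, smul_eq_mul]
    ring

theorem expPS_zero : expPS (fun _ => (0 : S)) = 1 := by
  symm
  apply expPS_unique
  · simp
  · have : derivPS (fun _ => (0 : S)) = 0 := by ext; simp [derivPS]
    rw [this, PowerSeries.derivative_one, zero_mul]

theorem expPS_sum {ι : Type*} (s : Finset ι) (g : ι → ℕ+ → S) :
    expPS (fun k => ∑ i ∈ s, g i k) = ∏ i ∈ s, expPS (g i) := by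
  classical
  induction s using Finset.induction_on with
  | empty => simp [expPS_zero]
  | insert a s ha ih =>
    rw [Finset.prod_insert ha, ← ih, ← expPS_add]
    simp [Finset.sum_insert ha]

theorem expCoeff_add (g g' : ℕ+ → S) (n : ℕ) : expCoeff (fun k => g k + g' k) n =
    ∑ ij ∈ Finset.HasAntidiagonal.antidiagonal n, expCoeff g ij.1 * expCoeff g' ij.2 := by
  have := congrArg (PowerSeries.coeff n) (expPS_add g g')
  simpa [expPS, PowerSeries.coeff_mul] using this

theorem expCoeff_scale (c : S) (g : ℕ+ → S) (n : ℕ) :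
    expCoeff (fun k => c ^ (k : ℕ) * g k) n = c ^ n * expCoeff g n := by
  symm
  apply expCoeff_unique _ (fun n => c ^ n * expCoeff g n) (by simp [expCoeff_zero])
  intro n
  have := congrArg (fun x => c ^ (n + 1) * x) (expCoeff_succ g n)
  calc _ = c ^ (n + 1) * (((n : S) + 1) * expCoeff g (n + 1)) := by ring
    _ = _ := by
      rw [this, Finset.mul_sum]
      refine Finset.sum_congr rfl fun k hk => ?_
      have hk' : n + 1 = (k + 1) + (n - k) := by have := Finset.mem_range.1 hk; omega
      conv_lhs => rw [hk', pow_add]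
      simp only [Nat.succPNat_coe, Nat.succ_eq_add_one]
      ring

end ExpCoeff

/-! ### Geometric series as exponentials of logarithms -/

section Geometric
variable {K S : Type*} [Field K] [CharZero K] [CommRing S] [Algebra ℚ S] [Algebra K S]

theorem derivPS_geom (x : S) :
    derivPS (fun k : ℕ+ => algebraMap K S ((k : ℕ) : K)⁻¹ * x ^ (k : ℕ)) =
      PowerSeries.mk fun k => x ^ (k + 1) := by
  ext k
  simp only [derivPS, PowerSeries.coeff_mk, Nat.succPNat_coe, Nat.succ_eq_add_one]
  have h : ((k : S) + 1) = algebraMap K S ((k + 1 : ℕ) : K) := by simp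
  rw [h, ← mul_assoc, ← map_mul, mul_inv_cancel₀ (Nat.cast_ne_zero.2 k.succ_ne_zero), map_one,
    one_mul]

/-- This is exp(-log(1 - xz)) = 1/(1 - xz). Keeping `K` and `S` separate lets it serve both fields
and polynomial rings over them. -/
theorem expPS_geom (x : S) :
    expPS (fun k : ℕ+ => algebraMap K S ((k : ℕ) : K)⁻¹ * x ^ (k : ℕ)) =
      PowerSeries.mk fun k => x ^ k := by
  symm
  apply expPS_unique
  · simp
  · rw [derivPS_geom]
    ext n
    rw [PowerSeries.coeff_derivative, PowerSeries.coeff_mul]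
    simp only [PowerSeries.coeff_mk]
    rw [Finset.sum_congr rfl (g := fun _ => x ^ (n + 1))]
    · simp [mul_comm]
    · intro ij hij
      rw [← pow_add]
      congr 1
      have := Finset.HasAntidiagonal.mem_antidiagonal.1 hij
      omega

theorem expPS_geom_mul (x : S) :
    expPS (fun k : ℕ+ => algebraMap K S ((k : ℕ) : K)⁻¹ * x ^ (k : ℕ)) *
      (1 - PowerSeries.C x * PowerSeries.X) = 1 := by
  rw [expPS_geom, mul_sub, mul_one, ← mul_assoc]
  ext n
  cases n with
  | zero => simp
  | succ n =>
    rw [map_sub, PowerSeries.coeff_succ_mul_X, PowerSeries.coeff_mul_C]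
    simp [PowerSeries.coeff_one, pow_succ]

theorem expPS_neg_geom (x : S) :
    expPS (fun k : ℕ+ => -(algebraMap K S ((k : ℕ) : K)⁻¹ * x ^ (k : ℕ))) =
      1 - PowerSeries.C x * PowerSeries.X := by
  have h1 := expPS_geom_mul (K := K) x
  have h2 : expPS (fun k : ℕ+ => -(algebraMap K S ((k : ℕ) : K)⁻¹ * x ^ (k : ℕ))) *
      expPS (fun k : ℕ+ => algebraMap K S ((k : ℕ) : K)⁻¹ * x ^ (k : ℕ)) = 1 := by
    rw [← expPS_add]; simp [expPS_zero]
  calc _ = expPS (fun k : ℕ+ => -(algebraMap K S ((k : ℕ) : K)⁻¹ * x ^ (k : ℕ))) * 1 := by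
        rw [mul_one]
    _ = _ := by conv_lhs => rw [← h1, ← mul_assoc, h2, one_mul]

end Geometric

end MacFock

namespace MacFock
open MvPolynomial

/-! ### Translations of the power sums -/

section Translation
variable {F : Type*} [Field F]

/-- The translation `p_n ↦ p_n + d_n w^n`. -/
def tau (d : ℕ+ → F) : MvPolynomial ℕ+ F →ₐ[F] Polynomial (MvPolynomial ℕ+ F) :=
  aeval fun n => Polynomial.C (X n) + Polynomial.C (C (d n)) * Polynomial.X ^ (n : ℕ)

/-- The coefficient of `w^m` in the translation, zero for negative `m`. -/
def tz (d : ℕ+ → F) : ℤ → MvPolynomial ℕ+ F →ₗ[F] MvPolynomial ℕ+ F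
  | Int.ofNat m => (Polynomial.lcoeff (MvPolynomial ℕ+ F) m).restrictScalars F ∘ₗ (tau d).toLinearMap
  | Int.negSucc _ => 0

theorem tz_natCast (d : ℕ+ → F) (m : ℕ) (f : MvPolynomial ℕ+ F) :
    tz d m f = (tau d f).coeff m := rfl

theorem tz_of_neg (d : ℕ+ → F) {m : ℤ} (hm : m < 0) (f : MvPolynomial ℕ+ F) :
    tz d m f = 0 := by
  cases m with
  | ofNat m => exact absurd hm (by simp)
  | negSucc m => rfl

theorem tau_X (d : ℕ+ → F) (n : ℕ+) :
    tau d (X n) = Polynomial.C (X n) + Polynomial.C (C (d n)) * Polynomial.X ^ (n : ℕ) := by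
  simp [tau]

theorem tau_C (d : ℕ+ → F) (a : F) : tau d (C a) = Polynomial.C (C a) := by
  rw [← MvPolynomial.algebraMap_eq, AlgHom.commutes]; rfl

theorem tz_C (d : ℕ+ → F) (m : ℤ) (a : F) : tz d m (C a) = if m = 0 then C a else 0 := by
  cases m with
  | ofNat m =>
    change tz d (m : ℤ) (C a) = _
    rw [tz_natCast, tau_C, Polynomial.coeff_C]
    simp
  | negSucc m => rw [if_neg (by simp)]; rfl

/-- Indexing the coefficients by ℤ, with zeros at negative indices, makes this rule valid without
comparing m and j. -/
theorem tz_X_mul (d : ℕ+ → F) (m : ℤ) (j : ℕ+) (f : MvPolynomial ℕ+ F) :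
    tz d m (X j * f) = X j * tz d m f + C (d j) * tz d (m - (j : ℕ)) f := by
  rcases lt_or_ge m 0 with hm | hm
  · rw [tz_of_neg d hm, tz_of_neg d hm, tz_of_neg d (by omega)]; simp
  · lift m to ℕ using hm
    rw [tz_natCast, tz_natCast, map_mul, tau_X, add_mul, Polynomial.coeff_add, mul_assoc,
      Polynomial.coeff_C_mul, Polynomial.coeff_C_mul]
    congr 2
    rw [Polynomial.coeff_X_pow_mul']
    split_ifs with h
    · rw [← Nat.cast_sub h, tz_natCast]
    · rw [tz_of_neg]; omega

theorem tz_zero (d : ℕ+ → F) (f : MvPolynomial ℕ+ F) : tz d 0 f = f := by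
  induction f using MvPolynomial.induction_on with
  | C a => simp [tz_C]
  | add f g hf hg => rw [map_add, hf, hg]
  | mul_X f j hf =>
    rw [mul_comm, tz_X_mul, hf, tz_of_neg]
    · simp
    · have := j.pos; omega

theorem tz_pderiv (d : ℕ+ → F) (j : ℕ+) (f : MvPolynomial ℕ+ F) (m : ℤ) :
    tz d m (pderiv j f) = pderiv j (tz d m f) := by
  classical
  induction f using MvPolynomial.induction_on generalizing m with
  | C a => rw [tz_C]; split_ifs <;> simp
  | add f g hf hg => simp only [map_add, hf, hg]
  | mul_X f i hf =>
    rw [mul_comm, tz_X_mul, map_add, pderiv_mul, pderiv_mul, pderiv_mul, pderiv_C, zero_mul,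
      zero_add, map_add, tz_X_mul, hf, hf, pderiv_X]
    by_cases hij : j = i
    · subst hij; simp [add_assoc]
    · simp [Ne.symm hij]

/-- The translation is exp(∑ d_k w^k ∂/∂p_k), and applying w d/dw brings down ∑ k d_k w^k ∂/∂p_k.
Any M ≥ m may be used, because the terms with k + 1 > m have negative index and vanish. This
recursion in m drives the proofs of commutativity, of adjointness, and of `eq_zero_of_kap`. -/
theorem natCast_mul_tz (d : ℕ+ → F) (M : ℕ) (f : MvPolynomial ℕ+ F) (m : ℤ) (hm : m ≤ M) :
    (m : MvPolynomial ℕ+ F) * tz d m f =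
      ∑ k ∈ Finset.range M, C (((k : F) + 1) * d k.succPNat) *
        tz d (m - (k + 1)) (pderiv k.succPNat f) := by
  classical
  induction f using MvPolynomial.induction_on generalizing m with
  | C a =>
    rw [tz_C, Finset.sum_eq_zero]
    · split_ifs with h <;> simp [h]
    · simp
  | add f g hf hg => simp only [map_add, mul_add, hf m hm, hg m hm, Finset.sum_add_distrib]
  | mul_X f j hf =>
    have hd : ∀ k : ℕ, tz d (m - (k + 1)) (pderiv k.succPNat (X j * f)) =
        (if k.succPNat = j then tz d (m - (k + 1)) f else 0) +
        X j * tz d (m - (k + 1)) (pderiv k.succPNat f) +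
        C (d j) * tz d (m - (j : ℕ) - (k + 1)) (pderiv k.succPNat f) := by
      intro k
      rw [pderiv_mul, map_add, tz_X_mul, pderiv_X, add_assoc]
      congr 1
      · split_ifs with h
        · subst h; simp
        · simp [Ne.symm h]
      · rw [sub_right_comm]
    rw [mul_comm f, tz_X_mul, Finset.sum_congr rfl fun k _ => by rw [hd k]]
    simp only [mul_add, Finset.sum_add_distrib]
    have h1 : ∑ k ∈ Finset.range M, C (((k : F) + 1) * d k.succPNat) *
        (X j * tz d (m - (k + 1)) (pderiv k.succPNat f)) =
        X j * ((m : MvPolynomial ℕ+ F) * tz d m f) := by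
      rw [hf m hm, Finset.mul_sum]
      exact Finset.sum_congr rfl fun k _ => by ring
    have h2 : ∑ k ∈ Finset.range M, C (((k : F) + 1) * d k.succPNat) *
        (C (d j) * tz d (m - (j : ℕ) - (k + 1)) (pderiv k.succPNat f)) =
        C (d j) * (((m - (j : ℕ) : ℤ) : MvPolynomial ℕ+ F) * tz d (m - (j : ℕ)) f) := by
      rw [hf (m - (j : ℕ)) (by omega), Finset.mul_sum]
      exact Finset.sum_congr rfl fun k _ => by ring
    have h3 : ∑ k ∈ Finset.range M, C (((k : F) + 1) * d k.succPNat) *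
        (if k.succPNat = j then tz d (m - (k + 1)) f else 0) =
        ((j : ℕ) : MvPolynomial ℕ+ F) * C (d j) * tz d (m - (j : ℕ)) f := by
      obtain ⟨j', rfl⟩ : ∃ j' : ℕ, j = j'.succPNat := ⟨j.natPred, by simp⟩
      by_cases hj : j' < M
      · rw [Finset.sum_eq_single_of_mem j' (Finset.mem_range.2 hj)]
        · simp
        · intro k _ hk
          rw [if_neg (fun h => hk (Nat.succPNat_injective h)), mul_zero]
      · rw [tz_of_neg d (m := m - _) (by simp; omega), mul_zero]
        refine Finset.sum_eq_zero fun k hk => ?_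
        have := Finset.mem_range.1 hk
        rw [if_neg (fun h => by have := Nat.succPNat_injective h; omega), mul_zero]
    rw [h1, h2, h3]
    push_cast
    ring

variable [CharZero F]

/-- The recursion `natCast_mul_tz` lowers a, and translation coefficients commute with derivatives;
characteristic zero permits division by a. -/
theorem tz_comm (d d' : ℕ+ → F) (a b : ℤ) (f : MvPolynomial ℕ+ F) :
    tz d a (tz d' b f) = tz d' b (tz d a f) := by
  rcases lt_or_ge a 0 with ha | ha
  · rw [tz_of_neg d ha, tz_of_neg d ha, map_zero]
  · lift a to ℕ using ha
    induction a using Nat.strong_induction_on generalizing f with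
    | _ a ih =>
      rcases Nat.eq_zero_or_pos a with rfl | hpos
      · simp [tz_zero]
      · have h1 := natCast_mul_tz d a (tz d' b f) a le_rfl
        have h2 := congrArg (tz d' b) (natCast_mul_tz d a f a le_rfl)
        have h3 : ((a : ℤ) : MvPolynomial ℕ+ F) * tz d' b (tz d a f) =
            tz d' b (((a : ℤ) : MvPolynomial ℕ+ F) * tz d a f) := by
          have : ((a : ℤ) : MvPolynomial ℕ+ F) = C (a : F) := by simp
          rw [this, ← smul_eq_C_mul, ← smul_eq_C_mul, map_smul]
        have ha0 : ((a : ℤ) : MvPolynomial ℕ+ F) ≠ 0 := by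
          simpa using hpos.ne'
        apply mul_left_cancel₀ ha0
        rw [h1, h3, h2, map_sum]
        refine Finset.sum_congr rfl fun k hk => ?_
        have hk' := Finset.mem_range.1 hk
        rw [← smul_eq_C_mul, ← smul_eq_C_mul, map_smul]
        congr 1
        have : (a : ℤ) - (k + 1) = ((a - (k + 1) : ℕ) : ℤ) := by omega
        rw [this, ← tz_pderiv, ih _ (by omega)]

end Translation

/-! ### The grading -/

section Grading
variable {F : Type*} [Field F]

/-- Homogeneity of a symmetric function, `p_k` having degree `k`. -/
abbrev IsHom (f : MvPolynomial ℕ+ F) (n : ℤ) : Prop :=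
  IsWeightedHomogeneous (fun k : ℕ+ => ((k : ℕ) : ℤ)) f n

theorem weight_nonneg (s : ℕ+ →₀ ℕ) : 0 ≤ Finsupp.weight (fun k : ℕ+ => ((k : ℕ) : ℤ)) s := by
  rw [Finsupp.weight_apply]
  exact Finsupp.sum_nonneg fun i _ => by positivity

theorem IsHom.eq_zero_of_neg {f : MvPolynomial ℕ+ F} {n : ℤ} (h : IsHom f n) (hn : n < 0) :
    f = 0 := by
  ext s
  by_contra hs
  have := h hs
  have := weight_nonneg s
  omega

theorem isHom_X (j : ℕ+) : IsHom (X j : MvPolynomial ℕ+ F) (j : ℕ) :=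
  isWeightedHomogeneous_X _ _ _

theorem isHom_C (a : F) : IsHom (C a) 0 := isWeightedHomogeneous_C _ _

theorem isHom_smul {f : MvPolynomial ℕ+ F} {n : ℤ} (a : F) (h : IsHom f n) : IsHom (a • f) n := by
  rw [smul_eq_C_mul]; exact h.C_mul a

theorem IsHom.eq_C {f : MvPolynomial ℕ+ F} (h : IsHom f 0) : f = C (coeff 0 f) := by
  ext s
  rw [coeff_C]
  split_ifs with hs
  · rw [hs]
  · by_contra hc
    have h1 := h hc
    rw [Finsupp.weight_apply, Finsupp.sum] at h1
    have h2 := (Finset.sum_eq_zero_iff_of_nonneg (fun i _ => by positivity)).1 h1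
    apply hs
    ext i
    by_contra hi
    have h3 := h2 i (Finsupp.mem_support_iff.2 (fun h => hi h.symm))
    simp at h3
    exact hi h3.symm

theorem IsHom.tz {d : ℕ+ → F} {f : MvPolynomial ℕ+ F} {n : ℤ} (h : IsHom f n) (m : ℤ) :
    IsHom (tz d m f) (n - m) := by
  have key : ∀ (s : ℕ+ →₀ ℕ) (a : F), ∃ n : ℤ, IsHom (monomial s a) n ∧
      ∀ m : ℤ, IsHom (MacFock.tz d m (monomial s a)) (n - m) := by
    intro s a
    refine MvPolynomial.induction_on_monomial (motive := fun f => ∃ n : ℤ, IsHom f n ∧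
      ∀ m : ℤ, IsHom (MacFock.tz d m f) (n - m)) ?_ ?_ s a
    · intro a
      refine ⟨0, isHom_C a, fun m => ?_⟩
      rw [tz_C]
      split_ifs with hm
      · subst hm; simpa using isHom_C a
      · exact isWeightedHomogeneous_zero _ _ _
    · intro f j hf
      obtain ⟨n, h1, h2⟩ := hf
      refine ⟨n + (j : ℕ), h1.mul (isHom_X j), fun m => ?_⟩
      rw [mul_comm, tz_X_mul]
      refine IsWeightedHomogeneous.add ?_ ?_
      · have := (isHom_X j).mul (h2 m)
        rwa [show ((j : ℕ) : ℤ) + (n - m) = n + (j : ℕ) - m by ring] at this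
      · have := (h2 (m - (j : ℕ))).C_mul (d j)
        rwa [show n - (m - ((j : ℕ) : ℤ)) = n + (j : ℕ) - m by ring] at this
  rw [f.as_sum, map_sum]
  refine IsWeightedHomogeneous.sum _ _ _ fun s hs => ?_
  obtain ⟨n', h1, h2⟩ := key s (coeff s f)
  have hne : monomial s (coeff s f) ≠ 0 := by
    simpa [monomial_eq_zero] using hs
  have h3 : IsHom (monomial s (coeff s f)) n :=
    isWeightedHomogeneous_monomial _ _ _ (h (mem_support_iff.1 hs))
  -- The degree produced by `key` is identified with n, since a nonzero homogeneous polynomial has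
  -- only one degree.
  rw [h3.inj_right hne h1]
  exact h2 m

theorem IsHom.pderiv {f : MvPolynomial ℕ+ F} {n : ℤ} (h : IsHom f n) (j : ℕ+) :
    IsHom (MvPolynomial.pderiv j f) (n - (j : ℕ)) := by
  intro s hs
  rw [coeff_pderiv] at hs
  have := h (left_ne_zero_of_mul hs)
  rw [map_add, Finsupp.weight_single] at this
  simp at this
  omega

/-- Euler's identity for homogeneous symmetric functions. -/
theorem IsHom.euler {f : MvPolynomial ℕ+ F} {n : ℕ} (h : IsHom f n) :
    ∑ k ∈ Finset.range n, C ((k : F) + 1) * X k.succPNat * MvPolynomial.pderiv k.succPNat f =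
      C (n : F) * f := by
  classical
  have key : ∀ s : ℕ+ →₀ ℕ, Finsupp.weight (fun k : ℕ+ => ((k : ℕ) : ℤ)) s = n →
      ∑ k ∈ Finset.range n, C ((k : F) + 1) * X k.succPNat *
        MvPolynomial.pderiv k.succPNat (monomial s (1 : F)) = C (n : F) * monomial s 1 := by
    intro s hs
    have h1 : ∀ k : ℕ, C ((k : F) + 1) * X k.succPNat *
        MvPolynomial.pderiv k.succPNat (monomial s (1 : F)) =
        C (((k : F) + 1) * s k.succPNat) * monomial s 1 := by
      intro k
      rw [mul_assoc, X_mul_pderiv_monomial, C_mul, mul_assoc, nsmul_eq_mul]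
      simp
    simp only [h1]
    rw [← Finset.sum_mul, ← map_sum]
    congr 2
    have h2 : (n : ℤ) = ∑ k ∈ Finset.range n, ((k : ℤ) + 1) * s k.succPNat := by
      rw [← hs, Finsupp.weight_apply, Finsupp.sum_of_support_subset (s := (Finset.range n).map
        ⟨Nat.succPNat, Nat.succPNat_injective⟩)]
      · rw [Finset.sum_map]
        exact Finset.sum_congr rfl fun k _ => by simp [mul_comm]
      · intro i hi
        rw [Finset.mem_map]
        refine ⟨i.natPred, ?_, by simp⟩
        rw [Finset.mem_range]
        have h3 : ((i : ℕ) : ℤ) ≤ n := by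
          rw [← hs, Finsupp.weight_apply, Finsupp.sum]
          calc ((i : ℕ) : ℤ) ≤ s i • ((i : ℕ) : ℤ) := by
                rw [nsmul_eq_mul]
                have : (1 : ℤ) ≤ s i := by
                  have := Finsupp.mem_support_iff.1 hi; omega
                nlinarith [i.pos]
            _ ≤ _ := Finset.single_le_sum (f := fun i => s i • ((i : ℕ) : ℤ))
                (fun i _ => by positivity) hi
        have := PNat.natPred_add_one i
        omega
      · simp
    have := congrArg (Int.cast : ℤ → F) h2
    push_cast at this
    exact this.symm
  rw [f.as_sum]
  simp only [map_sum, Finset.mul_sum]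
  rw [Finset.sum_comm]
  refine Finset.sum_congr rfl fun s hs => ?_
  have h1 := key s (h (mem_support_iff.1 hs))
  have h2 : monomial s (coeff s f) = coeff s f • monomial s (1 : F) := by
    rw [smul_monomial, smul_eq_mul, mul_one]
  rw [h2, mul_smul_comm, ← h1, Finset.smul_sum]
  refine Finset.sum_congr rfl fun k _ => ?_
  rw [Derivation.map_smul, mul_smul_comm]

end Grading

end MacFock

namespace MacFock
open MvPolynomial

/-! ### The scalar product -/

section Form
variable {F : Type*} [Field F]

/-- The norm of a monomial in the power sums, when `p_n` has norm `b n`. -/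
def zb (b : ℕ+ → F) (s : ℕ+ →₀ ℕ) : F := s.prod fun n k => (k.factorial : F) * b n ^ k

/-- The scalar product on symmetric functions with orthogonal basis the monomials in the
power sums, and norms `zb b`. -/
def form (b : ℕ+ → F) : MvPolynomial ℕ+ F →ₗ[F] MvPolynomial ℕ+ F →ₗ[F] F :=
  (basisMonomials ℕ+ F).constr F fun s => zb b s • lcoeff F s

theorem form_monomial (b : ℕ+ → F) (s : ℕ+ →₀ ℕ) (a : F) (g : MvPolynomial ℕ+ F) :
    form b (monomial s a) g = a * zb b s * coeff s g := by
  have : monomial s a = a • basisMonomials ℕ+ F s := by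
    rw [coe_basisMonomials, smul_monomial, smul_eq_mul, mul_one]
  rw [this, map_smul, form, Module.Basis.constr_basis]
  simp [mul_assoc]

theorem form_eq_sum (b : ℕ+ → F) (f g : MvPolynomial ℕ+ F) :
    form b f g = ∑ s ∈ f.support, coeff s f * coeff s g * zb b s := by
  conv_lhs => rw [f.as_sum, map_sum, LinearMap.sum_apply]
  exact Finset.sum_congr rfl fun s _ => by rw [form_monomial]; ring

theorem form_comm (b : ℕ+ → F) (f g : MvPolynomial ℕ+ F) : form b f g = form b g f := by
  classical
  rw [form_eq_sum, form_eq_sum, Finset.sum_subset (Finset.subset_union_left (s₂ := g.support)),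
    Finset.sum_subset (Finset.subset_union_right (s₁ := f.support) (s₂ := g.support))]
  · exact Finset.sum_congr rfl fun s _ => by ring
  · intro s _ hs; rw [notMem_support_iff.1 hs]; ring
  · intro s _ hs; rw [notMem_support_iff.1 hs]; ring

theorem zb_ne_zero [CharZero F] {b : ℕ+ → F} (hb : ∀ n, b n ≠ 0) (s : ℕ+ →₀ ℕ) : zb b s ≠ 0 :=
  Finset.prod_ne_zero_iff.2 fun n _ =>
    mul_ne_zero (Nat.cast_ne_zero.2 (Nat.factorial_ne_zero _)) (pow_ne_zero _ (hb n))

theorem eq_of_form_monomial [CharZero F] {b : ℕ+ → F} (hb : ∀ n, b n ≠ 0)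
    {f g : MvPolynomial ℕ+ F}
    (h : ∀ s, form b (monomial s 1) f = form b (monomial s 1) g) : f = g := by
  ext s
  have := h s
  rw [form_monomial, form_monomial, one_mul] at this
  exact mul_left_cancel₀ (zb_ne_zero hb s) this

theorem zb_add_single (b : ℕ+ → F) (s : ℕ+ →₀ ℕ) (j : ℕ+) :
    zb b (s + Finsupp.single j 1) = zb b s * (((s j : F) + 1) * b j) := by
  classical
  have h0 : ∀ n : ℕ+, ((Nat.factorial 0 : ℕ) : F) * b n ^ 0 = 1 := by simp
  have hs : (s + Finsupp.single j 1).support ⊆ insert j s.support := by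
    intro i hi
    by_cases hij : i = j
    · simp [hij]
    · rw [Finset.mem_insert, Finsupp.mem_support_iff]
      right
      rw [Finsupp.mem_support_iff] at hi
      simpa [Finsupp.single_apply, Ne.symm hij] using hi
  rw [zb, zb, Finsupp.prod_of_support_subset _ hs _ (fun i _ => h0 i),
    Finsupp.prod_of_support_subset _ (Finset.subset_insert j s.support) _ (fun i _ => h0 i),
    ← Finset.mul_prod_erase _ _ (Finset.mem_insert_self j _),
    ← Finset.mul_prod_erase _ _ (Finset.mem_insert_self j _),
    Finset.prod_congr rfl (g := fun i => ((s i).factorial : F) * b i ^ (s i))]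
  · simp only [Finsupp.add_apply, Finsupp.single_eq_same, Nat.factorial_succ, pow_succ]
    push_cast
    ring
  · intro i hi
    have := Finset.ne_of_mem_erase hi
    simp [this]

theorem form_X_mul (b : ℕ+ → F) (j : ℕ+) (f g : MvPolynomial ℕ+ F) :
    form b (X j * f) g = b j * form b f (pderiv j g) := by
  induction f using MvPolynomial.monomial_add_induction_on with
  | C a =>
    rw [show X j * C a = monomial (Finsupp.single j 1) a by rw [mul_comm, C_mul_X_eq_monomial],
      form_monomial, ← monomial_zero', form_monomial, coeff_pderiv]
    have := zb_add_single b 0 j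
    simp only [zero_add] at this
    rw [this]
    simp
    ring
  | monomial_add s a f _ _ ih =>
    rw [mul_add, map_add, map_add, LinearMap.add_apply, LinearMap.add_apply, ih, mul_add]
    congr 1
    rw [mul_comm, ← pow_one (X j : MvPolynomial ℕ+ F), ← monomial_add_single, form_monomial, form_monomial, coeff_pderiv,
      zb_add_single]
    ring

theorem form_eq_zero_of_isHom (b : ℕ+ → F) {f g : MvPolynomial ℕ+ F} {m n : ℤ} (hf : IsHom f m)
    (hg : IsHom g n) (hmn : m ≠ n) : form b f g = 0 := by
  rw [form_eq_sum]
  refine Finset.sum_eq_zero fun s hs => ?_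
  have h1 := hf (mem_support_iff.1 hs)
  have h2 : coeff s g = 0 := by
    by_contra h
    exact hmn (h1.symm.trans (hg h))
  rw [h2]; ring

end Form

/-! ### Vertex operators in one variable -/

section Vertex
variable {F : Type*} [Field F] [CharZero F]

/-- The coefficients of `exp (∑ c_k p_k z^k)`. -/
def hs (c : ℕ+ → F) : ℕ → MvPolynomial ℕ+ F := expCoeff fun k => C (c k) * X k

theorem hs_zero (c : ℕ+ → F) : hs c 0 = 1 := expCoeff_zero _

theorem hs_succ (c : ℕ+ → F) (n : ℕ) : C ((n : F) + 1) * hs c (n + 1) =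
    ∑ k ∈ Finset.range (n + 1), C (((k : F) + 1) * c k.succPNat) *
      (X k.succPNat * hs c (n - k)) := by
  have := expCoeff_succ (fun k => C (c k) * X k) n
  simp only [hs, map_add, map_natCast, map_one, map_mul]
  rw [this]
  exact Finset.sum_congr rfl fun k _ => by ring

theorem hs_one (c : ℕ+ → F) : hs c 1 = C (c 1) * X 1 := by
  have h := hs_succ c 0
  have h1 : Nat.succPNat 0 = 1 := rfl
  simpa [hs_zero, h1] using h

theorem isHom_hs (c : ℕ+ → F) (n : ℕ) : IsHom (hs c n) n := by
  induction n using Nat.strong_induction_on with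
  | _ n ih =>
    cases n with
    | zero => rw [hs_zero]; exact isWeightedHomogeneous_one _ _
    | succ n =>
      have h0 : ((n : F) + 1) ≠ 0 := by exact_mod_cast n.succ_ne_zero
      have : hs c (n + 1) = ((n : F) + 1)⁻¹ • (C ((n : F) + 1) * hs c (n + 1)) := by
        rw [← smul_eq_C_mul, smul_smul, inv_mul_cancel₀ h0, one_smul]
      rw [this, hs_succ]
      refine isHom_smul _ (IsWeightedHomogeneous.sum _ _ _ fun k hk => ?_)
      have hk' := Finset.mem_range.1 hk
      have := ((isHom_X (F := F) k.succPNat).mul (ih (n - k) (by omega))).C_mul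
        (((k : F) + 1) * c k.succPNat)
      convert this using 1
      simp
      omega

/-- The adjoint of p_k is b_k ∂/∂p_k, so the adjoint of multiplication by exp(∑ c_k p_k z^k) is the
translation by c_k b_k z^k. The proof matches the recursions `hs_succ` and `natCast_mul_tz`. -/
theorem form_hs_mul {b c d : ℕ+ → F} (h : ∀ k, c k * b k = d k) (n : ℕ) (f g : MvPolynomial ℕ+ F) :
    form b (hs c n * f) g = form b f (tz d n g) := by
  induction n using Nat.strong_induction_on generalizing g with
  | _ n ih =>
    cases n with
    | zero => rw [hs_zero, one_mul, Nat.cast_zero, tz_zero]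
    | succ n =>
      have h0 : ((n : F) + 1) ≠ 0 := by exact_mod_cast n.succ_ne_zero
      apply mul_left_cancel₀ h0
      have h1 := natCast_mul_tz d (n + 1) g ((n + 1 : ℕ) : ℤ) le_rfl
      rw [← smul_eq_mul, ← LinearMap.smul_apply, ← map_smul, smul_eq_C_mul, ← mul_assoc, hs_succ,
        Finset.sum_mul, map_sum, LinearMap.sum_apply, ← smul_eq_mul, ← map_smul, smul_eq_C_mul]
      have h2 : C ((n : F) + 1) = (((n + 1 : ℕ) : ℤ) : MvPolynomial ℕ+ F) := by simp
      rw [h2, h1, map_sum]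
      refine Finset.sum_congr rfl fun k hk => ?_
      have hk' := Finset.mem_range.1 hk
      rw [mul_assoc, ← smul_eq_C_mul, map_smul, LinearMap.smul_apply, mul_assoc, form_X_mul,
        ih _ (by omega), ← smul_eq_C_mul, map_smul, smul_eq_mul, smul_eq_mul, ← h]
      have : ((n - k : ℕ) : ℤ) = ((n + 1 : ℕ) : ℤ) - (k + 1) := by omega
      rw [this]
      ring

/-- The contraction of a polynomial in `w` with a sequence: `w^m ↦ h_{m+k}`. -/
def contract (h : ℕ → MvPolynomial ℕ+ F) (k : ℕ) :
    Polynomial (MvPolynomial ℕ+ F) →ₗ[MvPolynomial ℕ+ F] MvPolynomial ℕ+ F :=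
  Polynomial.lsum fun m => LinearMap.toSpanSingleton _ _ (h (m + k))

theorem contract_C_mul_X_pow_mul (h : ℕ → MvPolynomial ℕ+ F) (k j : ℕ) (a : MvPolynomial ℕ+ F)
    (p : Polynomial (MvPolynomial ℕ+ F)) :
    contract h k (Polynomial.C a * Polynomial.X ^ j * p) = a * contract h (k + j) p := by
  rw [mul_assoc, ← Polynomial.smul_eq_C_mul, map_smul, smul_eq_mul]
  congr 1
  induction p using Polynomial.induction_on' with
  | add p q hp hq => rw [mul_add, map_add, map_add, hp, hq]
  | monomial m b =>
    rw [Polynomial.X_pow_mul_monomial]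
    simp only [contract, Polynomial.lsum_apply, LinearMap.toSpanSingleton_apply, zero_smul,
      Polynomial.sum_monomial_index]
    rw [add_right_comm, add_assoc]

/-- The coefficient of `z^k` of the vertex operator
`exp (∑ c_n p_n z^n) exp (∑ d_n z^{-n} ∂/∂p_n)`. -/
def V (c d : ℕ+ → F) (k : ℕ) : MvPolynomial ℕ+ F →ₗ[F] MvPolynomial ℕ+ F :=
  (contract (hs c) k).restrictScalars F ∘ₗ (tau d).toLinearMap

theorem V_apply (c d : ℕ+ → F) (k : ℕ) (f : MvPolynomial ℕ+ F) :
    V c d k f = contract (hs c) k (tau d f) := rfl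

theorem V_eq_sum (c d : ℕ+ → F) (k : ℕ) (f : MvPolynomial ℕ+ F) {M : ℕ}
    (hM : (tau d f).natDegree < M) :
    V c d k f = ∑ m ∈ Finset.range M, hs c (m + k) * tz d m f := by
  rw [V_apply, contract, Polynomial.lsum_apply, Polynomial.sum_over_range' _ _ M hM]
  · exact Finset.sum_congr rfl fun m _ => by
      rw [LinearMap.toSpanSingleton_apply, smul_eq_mul, mul_comm, tz_natCast]
  · simp

theorem natDegree_tau_lt (d : ℕ+ → F) {f : MvPolynomial ℕ+ F} {n : ℕ} (hf : IsHom f n) :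
    (tau d f).natDegree < n + 1 := by
  rw [Nat.lt_succ_iff, Polynomial.natDegree_le_iff_coeff_eq_zero]
  intro m hm
  rw [← tz_natCast]
  exact (hf.tz m).eq_zero_of_neg (by omega)

theorem V_eq_sum_of_isHom (c d : ℕ+ → F) (k : ℕ) {f : MvPolynomial ℕ+ F} {n : ℕ}
    (hf : IsHom f n) : V c d k f = ∑ m ∈ Finset.range (n + 1), hs c (m + k) * tz d m f :=
  V_eq_sum c d k f (natDegree_tau_lt d hf)

theorem IsHom.V {c d : ℕ+ → F} {f : MvPolynomial ℕ+ F} {n : ℕ} (hf : IsHom f n) (k : ℕ) :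
    IsHom (V c d k f) ((n + k : ℕ) : ℤ) := by
  rw [V_eq_sum_of_isHom _ _ _ hf]
  refine IsWeightedHomogeneous.sum _ _ _ fun m _ => ?_
  have := (isHom_hs c (m + k)).mul (hf.tz (d := d) m)
  convert this using 1
  push_cast
  ring

theorem V_X_mul (c d : ℕ+ → F) (k : ℕ) (j : ℕ+) (f : MvPolynomial ℕ+ F) :
    V c d k (X j * f) = X j * V c d k f + C (d j) * V c d (k + j) f := by
  rw [V_apply, map_mul, tau_X, add_mul, map_add, contract_C_mul_X_pow_mul]
  congr 1
  have := contract_C_mul_X_pow_mul (hs c) k 0 (X j) (tau d f)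
  simpa [V_apply] using this

/-- The zero mode is ∑ h_m T_m with T_m the translation coefficients, and the adjoint of h_m is s^m
T_m. The pairing thus equals ∑ s^m ⟨T_m f, T_m g⟩, which is symmetric in f and g. -/
theorem form_V_comm {b c d : ℕ+ → F} {s : F} (h : ∀ k : ℕ+, c k * b k = s ^ (k : ℕ) * d k)
    (hs' : ∀ (m : ℕ) f, tz (fun k : ℕ+ => s ^ (k : ℕ) * d k) m f = s ^ m • tz d m f)
    (f g : MvPolynomial ℕ+ F) : form b (V c d 0 f) g = form b f (V c d 0 g) := by
  set M := max (tau d f).natDegree (tau d g).natDegree + 1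
  rw [V_eq_sum c d 0 f (M := M) (by omega), V_eq_sum c d 0 g (M := M) (by omega), map_sum, map_sum,
    LinearMap.sum_apply]
  refine Finset.sum_congr rfl fun m _ => ?_
  rw [add_zero, form_hs_mul h, hs', form_comm b f, form_hs_mul h, hs', map_smul, map_smul,
    form_comm]

/-- A translation multiplies exp(∑ c_k p_k z^k) by the scalar series exp(∑ c_k d_k (zw)^k). This
contraction factor is what normal ordering produces when vertex operators are multiplied. -/
theorem tau_hs (c d : ℕ+ → F) (l : ℕ) : tau d (hs c l) = ∑ s ∈ Finset.range (l + 1),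
    Polynomial.C (C (expCoeff (fun k => c k * d k) s) * hs c (l - s)) * Polynomial.X ^ s := by
  rw [hs, map_expCoeff (tau d)]
  have h1 : (fun k : ℕ+ => tau d (C (c k) * X k)) = fun k : ℕ+ =>
      Polynomial.X ^ (k : ℕ) * Polynomial.C (C (c k * d k)) + Polynomial.C (C (c k) * X k) := by
    funext k
    rw [map_mul, tau_C, tau_X, C_mul, Polynomial.C_mul, Polynomial.C_mul]
    ring
  rw [h1, expCoeff_add, Finset.Nat.sum_antidiagonal_eq_sum_range_succ_mk]
  refine Finset.sum_congr rfl fun s _ => ?_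
  rw [expCoeff_scale]
  simp only
  rw [← map_expCoeff (Polynomial.C : MvPolynomial ℕ+ F →+* _),
    ← map_expCoeff (Polynomial.C : MvPolynomial ℕ+ F →+* _),
    ← map_expCoeff (C : F →+* MvPolynomial ℕ+ F), Polynomial.C_mul]
  ring

theorem V_hs_mul (c d c' : ℕ+ → F) (j l : ℕ) (g : MvPolynomial ℕ+ F) :
    V c d j (hs c' l * g) = ∑ s ∈ Finset.range (l + 1),
      C (expCoeff (fun k => c' k * d k) s) * hs c' (l - s) * V c d (j + s) g := by
  rw [V_apply, map_mul, tau_hs, Finset.sum_mul, map_sum]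
  exact Finset.sum_congr rfl fun s _ => by rw [contract_C_mul_X_pow_mul, V_apply]

theorem tz_scale (s : F) (d : ℕ+ → F) (m : ℕ) (f : MvPolynomial ℕ+ F) :
    tz (fun k : ℕ+ => s ^ (k : ℕ) * d k) m f = s ^ m • tz d m f := by
  have h : ∀ m : ℤ, tz (fun k : ℕ+ => s ^ (k : ℕ) * d k) m f = s ^ m.toNat • tz d m f := by
    induction f using MvPolynomial.induction_on with
    | C a => intro m; rw [tz_C, tz_C]; split_ifs with h <;> simp [h]
    | add f g hf hg => intro m; rw [map_add, map_add, hf, hg, smul_add]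
    | mul_X f j hf =>
      intro m
      rw [mul_comm, tz_X_mul, tz_X_mul, hf, hf, smul_add, mul_smul_comm, mul_smul_comm]
      congr 1
      rcases lt_or_ge m (j : ℕ) with hm | hm
      · rw [tz_of_neg d (by omega)]; simp
      · have : m.toNat = (j : ℕ) + (m - (j : ℕ)).toNat := by omega
        rw [this, pow_add, smul_eq_C_mul, smul_eq_C_mul, C_mul, C_mul]
        ring
  simpa using h m

theorem tau_add (d d' : ℕ+ → F) (f : MvPolynomial ℕ+ F) :
    tau (fun k => d k + d' k) f =
      Polynomial.eval₂ (tau d : MvPolynomial ℕ+ F →+* _) Polynomial.X (tau d' f) := by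
  induction f using MvPolynomial.induction_on with
  | C a => simp
  | add f g hf hg => rw [map_add, map_add, Polynomial.eval₂_add, hf, hg]
  | mul_X f j hf =>
    rw [map_mul, map_mul, Polynomial.eval₂_mul, hf, tau_X, tau_X]
    congr 1
    simp only [Polynomial.eval₂_add, Polynomial.eval₂_mul, Polynomial.eval₂_C,
      Polynomial.eval₂_X_pow, RingHom.coe_coe, tau_X, tau_C, map_add]
    ring

theorem tz_add (d d' : ℕ+ → F) (m : ℕ) (f : MvPolynomial ℕ+ F) :
    tz (fun k => d k + d' k) m f =
      ∑ ab ∈ Finset.HasAntidiagonal.antidiagonal m, tz d ab.1 (tz d' ab.2 f) := by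
  rw [tz_natCast, tau_add, Polynomial.eval₂_eq_sum_range' _ (Nat.lt_succ_of_le
    (le_max_left (tau d' f).natDegree m)), Polynomial.finsetSum_coeff,
    ← Finset.Nat.sum_antidiagonal_swap, Finset.Nat.sum_antidiagonal_eq_sum_range_succ_mk]
  symm
  apply Finset.sum_subset_zero_on_sdiff (Finset.range_subset_range.2 (by omega))
  · intro b hb
    rw [Finset.mem_sdiff, Finset.mem_range, Finset.mem_range] at hb
    rw [Polynomial.coeff_mul_X_pow', if_neg (by omega)]
  · intro b hb
    have := Finset.mem_range.1 hb
    rw [Polynomial.coeff_mul_X_pow', if_pos (by omega)]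
    rfl

theorem tz_fun_zero (m : ℤ) (f : MvPolynomial ℕ+ F) :
    tz (fun _ => 0) m f = if m = 0 then f else 0 := by
  induction f using MvPolynomial.induction_on with
  | C a => rw [tz_C]
  | add f g hf hg => rw [map_add, hf, hg]; split_ifs <;> simp
  | mul_X f j hf => rw [mul_comm, tz_X_mul, hf]; split_ifs <;> simp

end Vertex

end MacFock

namespace MacFock
open MvPolynomial

/-! ### Commutation relations of vertex operators -/

section Commutator
variable {F : Type*} [Field F] [CharZero F]

theorem natDegree_tau_lt_of_le (d : ℕ+ → F) {f : MvPolynomial ℕ+ F} {m : ℤ} {n : ℕ}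
    (hf : IsHom f m) (hmn : m ≤ n) : (tau d f).natDegree < n + 1 := by
  rw [Nat.lt_succ_iff, Polynomial.natDegree_le_iff_coeff_eq_zero]
  intro k hk
  rw [← tz_natCast]
  exact (hf.tz k).eq_zero_of_neg (by omega)

theorem V_V_eq_sum (c d c' d' : ℕ+ → F) (j k : ℕ) {f : MvPolynomial ℕ+ F} {n : ℕ}
    (hf : IsHom f n) :
    V c d j (V c' d' k f) = ∑ b ∈ Finset.range (n + 1), ∑ a ∈ Finset.range (n + 1),
      (∑ s ∈ Finset.range (b + k + 1), C (expCoeff (fun k => c' k * d k) s) *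
        (hs c (a + j + s) * hs c' (b + k - s))) * tz d a (tz d' b f) := by
  rw [V_eq_sum_of_isHom c' d' k hf, map_sum]
  refine Finset.sum_congr rfl fun b _ => ?_
  rw [V_hs_mul]
  simp only [Finset.sum_mul]
  rw [Finset.sum_comm]
  refine Finset.sum_congr rfl fun s _ => ?_
  rw [V_eq_sum c d (j + s) _ (natDegree_tau_lt_of_le (n := n) d (hf.tz (d := d') b) (by omega)),
    Finset.mul_sum]
  refine Finset.sum_congr rfl fun a _ => ?_
  rw [add_assoc]
  ring

/-- The sequences r and r' play the role of expansions of one rational function in opposite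
directions. With i = a + s and i = a - s the two sums cover the indices on either side of a; in the
difference the two copies of T a cancel and a single unrestricted sum remains. -/
theorem sum_range_sub_sum_range_reflect {A : Type*} [CommRing A] (T φ r r' : ℕ → A) (a m : ℕ)
    (h1 : ∀ s, r s = (if s = 0 then 1 else 0) + φ (a + s))
    (h2 : ∀ s, s ≤ a → r' s = (if s = 0 then 1 else 0) - φ (a - s)) (ha : φ a = 0) :
    (∑ s ∈ Finset.range (m + 1), r s * T (a + s)) - ∑ s ∈ Finset.range (a + 1), r' s * T (a - s) =
      ∑ i ∈ Finset.range (a + m + 1), φ i * T i := by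
  have e1 : ∑ s ∈ Finset.range (m + 1), r s * T (a + s) =
      T a + ∑ s ∈ Finset.range (m + 1), φ (a + s) * T (a + s) := by
    rw [Finset.sum_range_succ' (fun s => r s * T (a + s)), Finset.sum_range_succ'
      (fun s => φ (a + s) * T (a + s)), h1 0]
    simp only [h1, Nat.add_eq_zero_iff, one_ne_zero, and_false, if_false, zero_add, if_true,
      add_zero]
    ring
  have e2 : ∑ s ∈ Finset.range (a + 1), r' s * T (a - s) =
      T a - ∑ i ∈ Finset.range a, φ i * T i := by
    rw [Finset.sum_range_succ', h2 0 (Nat.zero_le _), ← Finset.sum_range_reflect, Nat.sub_zero, ha]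
    simp only [if_true, sub_zero, one_mul]
    rw [add_comm, sub_eq_add_neg, ← Finset.sum_neg_distrib]
    congr 1
    refine Finset.sum_congr rfl fun s hs => ?_
    have := Finset.mem_range.1 hs
    rw [h2 (a - 1 - s + 1) (by omega), if_neg (by omega), show a - (a - 1 - s + 1) = s by omega]
    ring
  rw [e1, e2, add_assoc a m 1, Finset.sum_range_add (fun i => φ i * T i) a (m + 1)]
  ring

theorem sum_range_sum_range_eq_sum_antidiagonal {A : Type*} [AddCommMonoid A] (n : ℕ)
    (G : ℕ → ℕ → A) (hG : ∀ a b, n < a + b → G a b = 0) :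
    ∑ b ∈ Finset.range (n + 1), ∑ a ∈ Finset.range (n + 1), G a b =
      ∑ m ∈ Finset.range (n + 1), ∑ ab ∈ Finset.HasAntidiagonal.antidiagonal m, G ab.1 ab.2 := by
  rw [Finset.sum_comm, ← Finset.sum_product', Finset.sum_sigma']
  symm
  apply Finset.sum_bij_ne_zero (fun (x : (_ : ℕ) × ℕ × ℕ) _ _ => x.2)
  · rintro ⟨m, a, b⟩ h _
    simp only [Finset.mem_sigma, Finset.mem_range, Finset.HasAntidiagonal.mem_antidiagonal,
      Finset.mem_product] at h ⊢
    omega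
  · rintro ⟨m, a, b⟩ h _ ⟨m', a', b'⟩ h' _ heq
    simp only [Finset.mem_sigma, Finset.mem_range, Finset.HasAntidiagonal.mem_antidiagonal,
      Prod.mk.injEq] at h h' heq
    obtain ⟨rfl, rfl⟩ := heq
    obtain ⟨_, rfl⟩ := h
    obtain ⟨_, rfl⟩ := h'
    rfl
  · rintro ⟨a, b⟩ h hne
    refine ⟨⟨a + b, a, b⟩, ?_, hne, rfl⟩
    simp only [Finset.mem_sigma, Finset.mem_range, Finset.HasAntidiagonal.mem_antidiagonal,
      and_true]
    by_contra hab
    exact hne (hG a b (by omega))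
  · intros; rfl

theorem sum_range_hs_mul_hs (c c' : ℕ+ → F) (x : F) (n : ℕ) :
    ∑ i ∈ Finset.range (n + 1), C (x ^ i) * (hs c i * hs c' (n - i)) =
      hs (fun k => x ^ (k : ℕ) * c k + c' k) n := by
  have h : (fun k : ℕ+ => C (x ^ (k : ℕ) * c k + c' k) * X k) =
      fun k : ℕ+ => C x ^ (k : ℕ) * (C (c k) * X k) + C (c' k) * X k := by
    funext k; simp only [map_add, map_mul, map_pow]; ring
  rw [show hs (fun k => x ^ (k : ℕ) * c k + c' k) n = expCoeff _ n from rfl, h, expCoeff_add,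
    Finset.Nat.sum_antidiagonal_eq_sum_range_succ_mk]
  refine Finset.sum_congr rfl fun i _ => ?_
  rw [expCoeff_scale, map_pow, hs, hs, mul_assoc]

theorem hs_fun_zero (n : ℕ) : hs (fun _ : ℕ+ => (0 : F)) n = if n = 0 then 1 else 0 := by
  have h := congrArg (PowerSeries.coeff n) (expPS_zero (S := MvPolynomial ℕ+ F))
  simp only [expPS, PowerSeries.coeff_mk, PowerSeries.coeff_one] at h
  rw [← h, hs]
  simp

/-- Both products have the same normally ordered part; their contraction factors expand one rational
function with two simple poles in opposite regions, so the commutator is a sum of two residues. At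
the pole belonging to x the translations cancel (`hd`) and only a multiplication operator survives.
At the pole belonging to y the creation parts cancel (`hc`), and the residue is a scalar which is
present only for k = 0. -/
theorem V_comm {c d c' d' : ℕ+ → F} {α x y : F} (hx : x ≠ 0) (hy : y ≠ 0)
    (hr : ∀ s, expCoeff (fun k => c' k * d k) s = (if s = 0 then 1 else 0) + α * (x ^ s - y ^ s))
    (hr' : ∀ s, expCoeff (fun k => c k * d' k) s =
      (if s = 0 then 1 else 0) - α * (x⁻¹ ^ s - y⁻¹ ^ s))
    (hd : ∀ k : ℕ+, x⁻¹ ^ (k : ℕ) * d k + d' k = 0) (hc : ∀ k : ℕ+, y ^ (k : ℕ) * c k + c' k = 0)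
    {f : MvPolynomial ℕ+ F} {n : ℕ} (hf : IsHom f n) (k : ℕ) :
    V c d 0 (V c' d' k f) - V c' d' k (V c d 0 f) =
      C α * (hs (fun k => x ^ (k : ℕ) * c k + c' k) k - if k = 0 then 1 else 0) * f := by
  rw [V_V_eq_sum c d c' d' 0 k hf, V_V_eq_sum c' d' c d k 0 hf, Finset.sum_comm
    (f := fun b a => (∑ s ∈ Finset.range (b + 0 + 1), C (expCoeff (fun k => c k * d' k) s) *
        (hs c' (a + k + s) * hs c (b + 0 - s))) * tz d' a (tz d b f)), ← Finset.sum_sub_distrib]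
  have key : ∀ a b : ℕ,
      (∑ s ∈ Finset.range (b + k + 1), C (expCoeff (fun k => c' k * d k) s) *
        (hs c (a + 0 + s) * hs c' (b + k - s))) -
      (∑ s ∈ Finset.range (a + 0 + 1), C (expCoeff (fun k => c k * d' k) s) *
        (hs c' (b + k + s) * hs c (a + 0 - s))) =
      C (α * x⁻¹ ^ a) * hs (fun k => x ^ (k : ℕ) * c k + c' k) (a + b + k) -
      C (α * y⁻¹ ^ a) * (if a + b + k = 0 then 1 else 0) := by
    intro a b
    have h1 : hs (fun k => y ^ (k : ℕ) * c k + c' k) (a + b + k) =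
        if a + b + k = 0 then 1 else 0 := by
      rw [← hs_fun_zero]
      congr 1
      funext k; exact hc k
    -- The function φ collects both residues, shifted so that i = a is the normally ordered term;
    -- there the two contributions are α and -α and cancel.
    have := sum_range_sub_sum_range_reflect (fun i => hs c i * hs c' (a + (b + k) - i))
      (fun i => C (α * (x⁻¹ ^ a * x ^ i - y⁻¹ ^ a * y ^ i)))
      (fun s => C (expCoeff (fun k => c' k * d k) s))
      (fun s => C (expCoeff (fun k => c k * d' k) s)) a (b + k) ?_ ?_ ?_
    · simp only [add_zero]
      rw [← h1, ← sum_range_hs_mul_hs, ← sum_range_hs_mul_hs, Finset.mul_sum, Finset.mul_sum,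
        ← Finset.sum_sub_distrib, add_assoc a b k]
      have e1 : ∀ s, hs c (a + s) * hs c' (a + (b + k) - (a + s)) =
          hs c (a + s) * hs c' (b + k - s) := by
        intro s; rw [show a + (b + k) - (a + s) = b + k - s by omega]
      have e2 : ∀ s ∈ Finset.range (a + 1), C (expCoeff (fun k => c k * d' k) s) *
          (hs c (a - s) * hs c' (a + (b + k) - (a - s))) =
          C (expCoeff (fun k => c k * d' k) s) * (hs c' (b + k + s) * hs c (a - s)) := by
        intro s hs'
        have := Finset.mem_range.1 hs'
        rw [show a + (b + k) - (a - s) = b + k + s by omega]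
        ring
      simp only [e1] at this
      rw [Finset.sum_congr rfl e2] at this
      rw [this]
      refine Finset.sum_congr rfl fun i _ => ?_
      simp only [map_mul, map_sub, map_pow]
      ring
    · intro s
      simp only [hr]
      rw [pow_add, pow_add, inv_pow, inv_pow, ← mul_assoc, ← mul_assoc,
        inv_mul_cancel₀ (pow_ne_zero _ hx), inv_mul_cancel₀ (pow_ne_zero _ hy)]
      split_ifs <;> simp
    · intro s hs'
      simp only [hr']
      have e : ∀ z : F, z ≠ 0 → z⁻¹ ^ a * z ^ (a - s) = z⁻¹ ^ s := by
        intro z hz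
        have : z⁻¹ ^ a = z⁻¹ ^ s * z⁻¹ ^ (a - s) := by rw [← pow_add]; congr 1; omega
        rw [this, mul_assoc, ← mul_pow, inv_mul_cancel₀ hz, one_pow, mul_one]
      rw [e x hx, e y hy]
      split_ifs <;> simp
    · rw [← mul_pow, ← mul_pow, inv_mul_cancel₀ hx, inv_mul_cancel₀ hy]
      simp
  have step : ∀ b : ℕ, (∑ a ∈ Finset.range (n + 1),
      (∑ s ∈ Finset.range (b + k + 1), C (expCoeff (fun k => c' k * d k) s) *
        (hs c (a + 0 + s) * hs c' (b + k - s))) * tz d a (tz d' b f)) -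
      (∑ a ∈ Finset.range (n + 1),
      (∑ s ∈ Finset.range (a + 0 + 1), C (expCoeff (fun k => c k * d' k) s) *
        (hs c' (b + k + s) * hs c (a + 0 - s))) * tz d' b (tz d a f)) =
      ∑ a ∈ Finset.range (n + 1),
        (C (α * x⁻¹ ^ a) * hs (fun k => x ^ (k : ℕ) * c k + c' k) (a + b + k) -
        C (α * y⁻¹ ^ a) * (if a + b + k = 0 then 1 else 0)) * tz d a (tz d' b f) := by
    intro b
    rw [← Finset.sum_sub_distrib]
    refine Finset.sum_congr rfl fun a _ => ?_
    rw [tz_comm d' d, ← sub_mul, key]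
  rw [Finset.sum_congr rfl fun b _ => step b]
  rw [sum_range_sum_range_eq_sum_antidiagonal n (fun a b =>
    (C (α * x⁻¹ ^ a) * hs (fun k => x ^ (k : ℕ) * c k + c' k) (a + b + k) -
        C (α * y⁻¹ ^ a) * (if a + b + k = 0 then 1 else 0)) * tz d a (tz d' b f))]
  -- Composing the two translations, the first one rescaled by x⁻¹, gives the identity translation,
  -- so only the part with m = 0 survives.
  · have hcomp : ∀ m : ℕ, ∑ ab ∈ Finset.HasAntidiagonal.antidiagonal m,
        C (x⁻¹ ^ ab.1) * tz d ab.1 (tz d' ab.2 f) = if m = 0 then f else 0 := by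
      intro m
      have h1 := tz_add (fun k : ℕ+ => x⁻¹ ^ (k : ℕ) * d k) d' m f
      have h2 : (fun k : ℕ+ => x⁻¹ ^ (k : ℕ) * d k + d' k) = fun _ => 0 := funext hd
      rw [h2, tz_fun_zero] at h1
      simp only [tz_scale, smul_eq_C_mul] at h1
      rw [← h1]
      simp
    have hm : ∀ m : ℕ, ∑ ab ∈ Finset.HasAntidiagonal.antidiagonal m,
        (C (α * x⁻¹ ^ ab.1) * hs (fun k => x ^ (k : ℕ) * c k + c' k) (ab.1 + ab.2 + k) -
        C (α * y⁻¹ ^ ab.1) * (if ab.1 + ab.2 + k = 0 then 1 else 0)) *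
          tz d ab.1 (tz d' ab.2 f) =
        if m = 0 then C α * (hs (fun k => x ^ (k : ℕ) * c k + c' k) k -
          if k = 0 then 1 else 0) * f else 0 := by
      intro m
      by_cases h0 : m = 0
      · subst h0
        simp [tz_zero, mul_sub]
      · rw [if_neg h0]
        have := hcomp m
        rw [if_neg h0] at this
        refine Eq.trans ?_ ((congrArg (fun z => (C α : MvPolynomial ℕ+ F) *
          hs (fun k : ℕ+ => x ^ (k : ℕ) * c k + c' k) (m + k) * z) this).trans (mul_zero _))
        rw [Finset.mul_sum]
        refine Finset.sum_congr rfl fun ab hab => ?_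
        rw [Finset.HasAntidiagonal.mem_antidiagonal] at hab
        rw [hab, if_neg (by omega), C_mul]
        ring
    rw [Finset.sum_congr rfl fun m _ => hm m]
    simp
  · intro a b hab
    have : tz d a (tz d' b f) = 0 := ((hf.tz (d := d') b).tz (d := d) a).eq_zero_of_neg (by omega)
    rw [this, mul_zero]

end Commutator

end MacFock

namespace MacFock
open MvPolynomial

/-! ### The Macdonald operator on the Fock space -/

section Macdonald
variable {F : Type*} [Field F] [CharZero F]

/-- The creation coefficients `(1 - t^{-k}) / k`. -/
def cM (t : F) (k : ℕ+) : F := (1 - (t ^ (k : ℕ))⁻¹) / ((k : ℕ) : F)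

/-- The annihilation coefficients `-(1 - q^k)`. -/
def dM (q : F) (k : ℕ+) : F := -(1 - q ^ (k : ℕ))

/-- The norms of the power sums. -/
def bM (q t : F) (k : ℕ+) : F := ((k : ℕ) : F) * ((1 - q ^ (k : ℕ)) / (1 - t ^ (k : ℕ)))

/-- The modes of the vertex operator
`exp (∑ (1 - t^{-n})/n p_n z^n) exp (-∑ (1 - q^n) z^{-n} ∂/∂p_n)`; the zeroth one is the
Macdonald operator. -/
def mac (q t : F) (k : ℕ) : MvPolynomial ℕ+ F →ₗ[F] MvPolynomial ℕ+ F := V (cM t) (dM q) k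

/-- Commuting with p_1 raises the index of a mode by one, so the higher modes are generated by a low
one together with p_1. -/
theorem mac_X_one_mul (q t : F) (k : ℕ) (f : MvPolynomial ℕ+ F) :
    mac q t k (X 1 * f) = X 1 * mac q t k f - C (1 - q) * mac q t (k + 1) f := by
  rw [mac, V_X_mul]
  simp [dM, mac]
  ring

theorem IsHom.mac {q t : F} {f : MvPolynomial ℕ+ F} {n : ℕ} (hf : IsHom f n) (k : ℕ) :
    IsHom (mac q t k f) ((n + k : ℕ) : ℤ) := hf.V k

/-- The norms satisfy c_k b_k = t^{-k} d_k, which is the hypothesis of `form_V_comm` with s = t⁻¹.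
-/
theorem form_mac_comm {q t : F} (ht : t ≠ 0) (ht1 : ∀ k : ℕ+, t ^ (k : ℕ) ≠ 1)
    (f g : MvPolynomial ℕ+ F) :
    form (bM q t) (mac q t 0 f) g = form (bM q t) f (mac q t 0 g) := by
  refine form_V_comm (s := t⁻¹) (fun k => ?_) (fun m f => tz_scale _ _ _ _) f g
  have h1 : (1 - t ^ (k : ℕ)) ≠ 0 := sub_ne_zero.2 (ht1 k).symm
  have h2 : ((k : ℕ) : F) ≠ 0 := by simp
  have h3 : t ^ (k : ℕ) ≠ 0 := pow_ne_zero _ ht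
  simp only [cM, bM, dM, inv_pow]
  field_simp
  ring

theorem mk_pow_mul_one_sub (x : F) :
    (PowerSeries.mk fun k => x ^ k) * (1 - PowerSeries.C x * PowerSeries.X) = 1 := by
  have := expPS_geom_mul (K := F) (S := F) x
  rwa [expPS_geom] at this

/-- The coefficients of `(1 - z)(1 - qtz) / ((1 - qz)(1 - tz))`. -/
theorem expCoeff_contraction {q t : F} (hqt : q ≠ t) (s : ℕ) :
    expCoeff (fun k : ℕ+ => -((1 - q ^ (k : ℕ)) * (1 - t ^ (k : ℕ)) / ((k : ℕ) : F))) s =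
      (if s = 0 then 1 else 0) + (q - 1) * (1 - t) / (q - t) * (q ^ s - t ^ s) := by
  have hqt' : q - t ≠ 0 := sub_ne_zero.2 hqt
  have key : expPS (fun k : ℕ+ => -((1 - q ^ (k : ℕ)) * (1 - t ^ (k : ℕ)) / ((k : ℕ) : F))) =
      1 + PowerSeries.C ((q - 1) * (1 - t) / (q - t)) *
        ((PowerSeries.mk fun k => q ^ k) - PowerSeries.mk fun k => t ^ k) := by
    have h1 : (fun k : ℕ+ => -((1 - q ^ (k : ℕ)) * (1 - t ^ (k : ℕ)) / ((k : ℕ) : F))) =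
        fun k : ℕ+ => ((-(algebraMap F F ((k : ℕ) : F)⁻¹ * 1 ^ (k : ℕ)) +
          -(algebraMap F F ((k : ℕ) : F)⁻¹ * (q * t) ^ (k : ℕ))) +
          algebraMap F F ((k : ℕ) : F)⁻¹ * q ^ (k : ℕ)) +
          algebraMap F F ((k : ℕ) : F)⁻¹ * t ^ (k : ℕ) := by
      funext k
      simp only [Algebra.algebraMap_self, RingHom.id_apply, one_pow, mul_pow]
      field_simp
      ring
    rw [h1, expPS_add, expPS_add, expPS_add, expPS_neg_geom, expPS_neg_geom, expPS_geom,
      expPS_geom]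
    have hq := mk_pow_mul_one_sub q
    have ht := mk_pow_mul_one_sub t
    set Gq : PowerSeries F := PowerSeries.mk fun k => q ^ k
    set Gt : PowerSeries F := PowerSeries.mk fun k => t ^ k
    have hα : PowerSeries.C ((q - 1) * (1 - t) / (q - t)) *
        (PowerSeries.C q - PowerSeries.C t) =
        (PowerSeries.C q - 1) * (1 - PowerSeries.C t) := by
      rw [← map_sub, ← map_mul, div_mul_cancel₀ _ hqt', map_mul, map_sub, map_sub, map_one]
    rw [map_one, map_mul]
    set Cq : PowerSeries F := PowerSeries.C q
    set Ct : PowerSeries F := PowerSeries.C t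
    set Cα : PowerSeries F := PowerSeries.C ((q - 1) * (1 - t) / (q - t))
    linear_combination (Gt * (1 - Ct * PowerSeries.X)) * hq + ht + Cα * Gq * ht - Cα * Gt * hq -
      PowerSeries.X * Gq * Gt * hα
  have := congrArg (PowerSeries.coeff s) key
  rw [expPS, PowerSeries.coeff_mk] at this
  rw [this, map_add, PowerSeries.coeff_one, PowerSeries.coeff_C_mul, map_sub,
    PowerSeries.coeff_mk, PowerSeries.coeff_mk]

theorem mac_comm {q t : F} (hq : q ≠ 0) (ht : t ≠ 0) (hqt : q ≠ t) {f : MvPolynomial ℕ+ F} {n : ℕ}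
    (hf : IsHom f n) (k : ℕ) :
    mac q t 0 (mac q⁻¹ t⁻¹ k f) - mac q⁻¹ t⁻¹ k (mac q t 0 f) =
      C ((q - 1) * (1 - t) / (q - t)) *
        (hs (fun k => q ^ (k : ℕ) * cM t k + cM t⁻¹ k) k - if k = 0 then 1 else 0) * f := by
  have hqt' : q - t ≠ 0 := sub_ne_zero.2 hqt
  have hqi : q⁻¹ ≠ t⁻¹ := fun h => hqt (inv_injective h)
  refine V_comm hq ht ?_ ?_ ?_ ?_ hf k
  · intro s
    rw [← expCoeff_contraction hqt]
    congr 1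
    funext k
    simp only [cM, dM, inv_pow, inv_inv]
    ring
  · intro s
    have hα : -((q - 1) * (1 - t) / (q - t)) = (q⁻¹ - 1) * (1 - t⁻¹) / (q⁻¹ - t⁻¹) := by
      have h2 : t - q ≠ 0 := sub_ne_zero.2 hqt.symm
      have h1 : q⁻¹ - t⁻¹ = (t - q) / (q * t) := by field_simp
      rw [h1]
      field_simp
      ring
    rw [sub_eq_add_neg, ← neg_mul, hα, ← expCoeff_contraction hqi]
    congr 1
    funext k
    simp only [cM, dM, inv_pow]
    ring
  · intro k
    have h3 : q ^ (k : ℕ) ≠ 0 := pow_ne_zero _ hq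
    simp only [dM, inv_pow]
    field_simp
    ring
  · intro k
    have h3 : t ^ (k : ℕ) ≠ 0 := pow_ne_zero _ ht
    simp only [cM, inv_pow, inv_inv]
    field_simp
    ring

theorem mac_comm_zero {q t : F} (hq : q ≠ 0) (ht : t ≠ 0) (hqt : q ≠ t) {f : MvPolynomial ℕ+ F}
    {n : ℕ} (hf : IsHom f n) :
    mac q t 0 (mac q⁻¹ t⁻¹ 0 f) = mac q⁻¹ t⁻¹ 0 (mac q t 0 f) := by
  have := mac_comm hq ht hqt hf 0
  rw [hs_zero] at this
  simpa [sub_eq_zero] using this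

/-- In the first mode the surviving creation factor is proportional to p_1. This relation is the
source of the Pieri rule. -/
theorem mac_comm_one {q t : F} (hq : q ≠ 0) (ht : t ≠ 0) (hqt : q ≠ t) {f : MvPolynomial ℕ+ F}
    {n : ℕ} (hf : IsHom f n) :
    mac q t 0 (mac q⁻¹ t⁻¹ 1 f) - mac q⁻¹ t⁻¹ 1 (mac q t 0 f) =
      C ((1 - q) * (1 - t) ^ 2 / t) * (X 1 * f) := by
  have hqt' : q - t ≠ 0 := sub_ne_zero.2 hqt
  rw [mac_comm hq ht hqt hf 1, hs_one, if_neg one_ne_zero, sub_zero, ← mul_assoc, ← map_mul,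
    ← mul_assoc]
  congr 3
  simp [cM]
  field_simp
  ring

/-! ### Evaluations -/

variable {L : Type*} [Field L] [Algebra F L]

/-- The evaluation `p_k ↦ (x^k - y^k) / (1 - t^k)`. -/
def evxy (t : F) (x y : L) : MvPolynomial ℕ+ F →ₐ[F] L :=
  aeval fun k => (x ^ (k : ℕ) - y ^ (k : ℕ)) / algebraMap F L (1 - t ^ (k : ℕ))

/-- Under the evaluation the creation series becomes (1 - xz/t)/(1 - yz/t). Its coefficients form a
geometric progression, except for the correction by the numerator in degree one. -/
theorem evxy_hs_succ [CharZero L] {t : F} (ht : t ≠ 0) (ht1 : ∀ k : ℕ+, t ^ (k : ℕ) ≠ 1) (x y : L)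
    (n : ℕ) : evxy t x y (hs (cM t) (n + 1)) = y / algebraMap F L t * evxy t x y (hs (cM t) n) -
      if n = 0 then x / algebraMap F L t else 0 := by
  have h1 : ∀ n, evxy t x y (hs (cM t) n) = PowerSeries.coeff n (expPS
      fun k : ℕ+ => -(algebraMap L L ((k : ℕ) : L)⁻¹ * (x / algebraMap F L t) ^ (k : ℕ)) +
        algebraMap L L ((k : ℕ) : L)⁻¹ * (y / algebraMap F L t) ^ (k : ℕ)) := by
    intro n
    rw [hs, map_expCoeff (evxy t x y), expPS, PowerSeries.coeff_mk]
    congr 1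
    funext k
    have e1 : algebraMap F L (1 - t ^ (k : ℕ)) ≠ 0 := by
      rw [Ne, FaithfulSMul.algebraMap_eq_zero_iff, sub_eq_zero]
      exact (ht1 k).symm
    have e2 : ((k : ℕ) : L) ≠ 0 := by simp
    have e3 : algebraMap F L t ^ (k : ℕ) ≠ 0 := by
      rw [← map_pow, Ne, FaithfulSMul.algebraMap_eq_zero_iff]
      exact pow_ne_zero _ ht
    have e4 : evxy t x y (X k) =
        (x ^ (k : ℕ) - y ^ (k : ℕ)) / algebraMap F L (1 - t ^ (k : ℕ)) := by simp [evxy]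
    rw [map_mul, e4, ← MvPolynomial.algebraMap_eq, AlgHom.commutes, cM]
    simp only [Algebra.algebraMap_self, div_pow, map_sub, map_one, map_pow,
      map_div₀, map_inv₀, map_natCast] at e1 ⊢
    field_simp
    ring
  rw [h1, h1, expPS_add, expPS_neg_geom]
  have h2 := expPS_geom_mul (K := L) (y / algebraMap F L t)
  set G := expPS fun k : ℕ+ => algebraMap L L ((k : ℕ) : L)⁻¹ * (y / algebraMap F L t) ^ (k : ℕ)
  have h3 : (1 - PowerSeries.C (x / algebraMap F L t) * PowerSeries.X) * G *
      (1 - PowerSeries.C (y / algebraMap F L t) * PowerSeries.X) =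
      1 - PowerSeries.C (x / algebraMap F L t) * PowerSeries.X := by
    rw [mul_assoc, h2, mul_one]
  set Y := (1 - PowerSeries.C (x / algebraMap F L t) * PowerSeries.X) * G
  have h4 := congrArg (PowerSeries.coeff (n + 1)) h3
  rw [mul_sub, mul_one, map_sub, mul_comm (PowerSeries.C _) PowerSeries.X, ← mul_assoc,
    PowerSeries.coeff_mul_C, PowerSeries.coeff_succ_mul_X, map_sub, PowerSeries.coeff_one,
    if_neg (Nat.succ_ne_zero n), mul_comm (PowerSeries.C _) PowerSeries.X,
    PowerSeries.coeff_mul_C, PowerSeries.coeff_X] at h4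
  rw [sub_eq_iff_eq_add.1 h4]
  by_cases hn : n = 0
  · simp [hn]; ring
  · simp [hn]; ring

theorem evxy_mac_one [CharZero L] {q t : F} (ht : t ≠ 0) (ht1 : ∀ k : ℕ+, t ^ (k : ℕ) ≠ 1) (x y : L)
    (f : MvPolynomial ℕ+ F) : evxy t x y (mac q t 1 f) =
      y / algebraMap F L t * evxy t x y (mac q t 0 f) - x / algebraMap F L t * evxy t x y f := by
  have hM : (tau (dM q) f).natDegree < (tau (dM q) f).natDegree + 1 := Nat.lt_succ_self _
  rw [mac, mac, V_eq_sum _ _ _ _ hM, V_eq_sum _ _ _ _ hM, map_sum, map_sum, Finset.mul_sum]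
  have h : ∀ m, evxy t x y (hs (cM t) (m + 1) * tz (dM q) m f) =
      y / algebraMap F L t * evxy t x y (hs (cM t) (m + 0) * tz (dM q) m f) -
      if m = 0 then x / algebraMap F L t * evxy t x y f else 0 := by
    intro m
    rw [map_mul, evxy_hs_succ ht ht1, map_mul, add_zero]
    split_ifs with h0
    · subst h0; rw [Nat.cast_zero, tz_zero]; ring
    · ring
  rw [Finset.sum_congr rfl fun m _ => h m, Finset.sum_sub_distrib]
  simp

theorem evxy_X_one_mul {t : F} (x y : L) (f : MvPolynomial ℕ+ F) :
    evxy t x y (X 1 * f) = (x - y) / algebraMap F L (1 - t) * evxy t x y f := by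
  rw [map_mul]; simp [evxy]

theorem tz_one_mul (d : ℕ+ → F) (f g : MvPolynomial ℕ+ F) :
    tz d 1 (f * g) = f * tz d 1 g + tz d 1 f * g := by
  have h0 := fun f => tz_zero d f
  have e1 : ∀ f, tz d 1 f = (tau d f).coeff 1 := fun f => tz_natCast d 1 f
  have e0 : ∀ f, (tau d f).coeff 0 = f := fun f => h0 f
  rw [e1, e1, e1, map_mul, Polynomial.coeff_mul, Finset.Nat.sum_antidiagonal_eq_sum_range_succ_mk]
  simp [Finset.sum_range_succ, e0]

theorem tz_one_hs_succ (c d : ℕ+ → F) (l : ℕ) :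
    tz d 1 (hs c (l + 1)) = C (c 1 * d 1) * hs c l := by
  have e1 : ∀ f, tz d 1 f = (tau d f).coeff 1 := fun f => tz_natCast d 1 f
  have h1 : expCoeff (fun k => c k * d k) 1 = c 1 * d 1 := by
    have := expCoeff_succ (fun k => c k * d k) 0
    simpa [expCoeff_zero, show Nat.succPNat 0 = 1 from rfl] using this
  rw [e1, tau_hs, Polynomial.finsetSum_coeff, Finset.sum_eq_single_of_mem 1 (by simp)]
  · rw [Polynomial.coeff_C_mul, Polynomial.coeff_X_pow, if_pos rfl, mul_one, h1,
      Nat.add_sub_cancel]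
  · intro s _ hs'
    rw [Polynomial.coeff_C_mul, Polynomial.coeff_X_pow, if_neg (Ne.symm hs'), mul_zero]

theorem tz_one_mac_one (q t : F) (f : MvPolynomial ℕ+ F) :
    tz (dM q) 1 (mac q t 1 f) =
      mac q t 1 (tz (dM q) 1 f) + C (-(1 - q) * (1 - t⁻¹)) * mac q t 0 f := by
  set M := max (tau (dM q) f).natDegree (tau (dM q) (tz (dM q) 1 f)).natDegree + 1
  rw [mac, mac, V_eq_sum _ _ _ _ (M := M) (by omega), V_eq_sum _ _ _ _ (M := M) (by omega),
    V_eq_sum _ _ _ _ (M := M) (by omega), map_sum, Finset.mul_sum, ← Finset.sum_add_distrib]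
  refine Finset.sum_congr rfl fun m _ => ?_
  rw [tz_one_mul, tz_one_hs_succ, tz_comm, add_zero, mul_assoc]
  congr 3
  simp [cM, dM]
  ring

/-- At x = 1, y = 0 the evaluated creation series is 1 - z/t, so only the translation coefficients
of order 0 and 1 contribute to E_0; the one of order 1 is a derivation and is commuted past E_1. The
result supplies the second moment in the Pieri rule. -/
theorem evxy_mac_zero_mac_one {q t : F} (ht : t ≠ 0) (ht1 : ∀ k : ℕ+, t ^ (k : ℕ) ≠ 1)
    (f : MvPolynomial ℕ+ F) :
    evxy t (1 : F) 0 (mac q t 0 (mac q t 1 f)) =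
      -(1 - (1 - q) * (1 - t⁻¹)) / t * evxy t (1 : F) 0 (mac q t 0 f) := by
  have h0 : ∀ g, evxy t (1 : F) 0 (mac q t 0 g) =
      evxy t (1 : F) 0 g - t⁻¹ * evxy t (1 : F) 0 (tz (dM q) 1 g) := by
    intro g
    have hM : (tau (dM q) g).natDegree < (tau (dM q) g).natDegree + 2 := by omega
    rw [mac, V_eq_sum _ _ _ _ hM, Finset.sum_range_succ', Finset.sum_range_succ', map_add, map_add,
      map_sum, Finset.sum_eq_zero]
    · rw [hs_zero]
      have := evxy_hs_succ (L := F) ht ht1 1 0 0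
      simp only [zero_add, add_zero, map_mul, Nat.cast_zero, tz_zero, Nat.cast_one, map_one]
      rw [this]
      simp
      ring
    · intro m _
      rw [map_mul, show m + 1 + 1 + 0 = (m + 1) + 1 from rfl, evxy_hs_succ ht ht1]
      simp
  have h1 := fun g => evxy_mac_one (q := q) (L := F) ht ht1 1 0 g
  rw [h0, tz_one_mac_one, map_add, h1, h1, map_mul (evxy t (1 : F) 0) (C _),
    ← MvPolynomial.algebraMap_eq, AlgHom.commutes, h0 f]
  simp only [Algebra.algebraMap_self, RingHom.id_apply]
  field_simp
  ring

/-- By induction on the degree, χ vanishes on E_1 g, and commuting with p_1 extends this to every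
E_{k+1} g of degree n + 1. Such an element is h_{k+1} g plus products of higher h with elements of
smaller degree, so χ kills all h_{k+1} g. Newton's identities then give all p_{k+1} g, and Euler's
identity gives everything of degree n + 1. -/
theorem functional_eq_zero {q t : F} (hq1 : q ≠ 1) (ht1 : ∀ k : ℕ+, t ^ (k : ℕ) ≠ 1)
    (χ : MvPolynomial ℕ+ F →ₗ[F] L) (α β γ : L) (h1 : χ 1 = 0)
    (hX : ∀ (n : ℕ) f, IsHom f n → χ (X 1 * f) = α * χ f)
    (hE : ∀ (n : ℕ) f, IsHom f n → χ (mac q t 1 f) = β * χ (mac q t 0 f) + γ * χ f) (n : ℕ) :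
    ∀ f, IsHom f n → χ f = 0 := by
  have hC : ∀ a f, χ (C a * f) = a • χ f := fun a f => by rw [← smul_eq_C_mul, map_smul]
  induction n with
  | zero =>
    intro f hf
    have hf' : f = C (coeff 0 f) := IsHom.eq_C hf
    rw [hf', ← mul_one (C _), hC, h1, smul_zero]
  | succ n ih =>
    have hmac : ∀ k m : ℕ, m + k = n → ∀ g, IsHom g m → χ (mac q t (k + 1) g) = 0 := by
      intro k
      induction k with
      | zero =>
        intro m hm g hg
        obtain rfl : m = n := hm
        have := hg.mac (q := q) (t := t) 0
        rw [hE _ _ hg, ih _ hg, ih _ this]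
        simp
      | succ k ihk =>
        intro m hm g hg
        have e1 : IsHom (X 1 * g) ((m + 1 : ℕ) : ℤ) := by
          have := (isHom_X (F := F) 1).mul hg
          convert this using 1
          push_cast
          simp [add_comm]
        have e2 := ihk (m + 1) (by omega) _ e1
        have e3 : IsHom (mac q t (k + 1) g) (n : ℕ) := by
          rw [← hm]; exact hg.mac (k + 1)
        rw [mac_X_one_mul, map_sub, hX _ _ e3, ih _ e3, hC, mul_zero, zero_sub, neg_eq_zero] at e2
        exact (smul_eq_zero.1 e2).resolve_left (sub_ne_zero.2 hq1.symm)
    -- Induction on the degree m of g: the other terms of E_{k+1} g have the form h_{j+k+2} g' with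
    -- g' of degree m - (j+1).
    have hh : ∀ m k : ℕ, m + k = n → ∀ g, IsHom g m → χ (hs (cM t) (k + 1) * g) = 0 := by
      intro m
      induction m using Nat.strong_induction_on with
      | _ m ihm =>
        intro k hk g hg
        have e1 := hmac k m hk g hg
        rw [mac, V_eq_sum_of_isHom _ _ _ hg, Finset.sum_range_succ', map_add, map_sum,
          Finset.sum_eq_zero, zero_add, Nat.cast_zero, tz_zero, zero_add] at e1
        · exact e1
        · intro j hj
          have hj' := Finset.mem_range.1 hj
          have e2 : IsHom (tz (dM q) (j + 1 : ℕ) g) ((m - (j + 1) : ℕ) : ℤ) := by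
            have := hg.tz (d := dM q) (j + 1 : ℕ)
            convert this using 1
            omega
          have := ihm (m - (j + 1)) (by omega) (j + 1 + k) (by omega) _ e2
          exact this
    have hp : ∀ k m : ℕ, m + k = n → ∀ g, IsHom g m → χ (X k.succPNat * g) = 0 := by
      intro k
      induction k using Nat.strong_induction_on with
      | _ k ihk =>
        intro m hm g hg
        have e1 := hC ((k : F) + 1) (hs (cM t) (k + 1) * g)
        rw [hh m k hm g hg, smul_zero, ← mul_assoc, hs_succ, Finset.sum_mul, map_sum,
          Finset.sum_range_succ, Finset.sum_eq_zero, zero_add, Nat.sub_self, hs_zero, mul_one,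
          mul_assoc, hC] at e1
        · refine (smul_eq_zero.1 e1).resolve_left (mul_ne_zero ?_ ?_)
          · exact_mod_cast k.succ_ne_zero
          · rw [cM]
            refine div_ne_zero ?_ (Nat.cast_ne_zero.2 k.succPNat.ne_zero)
            rw [sub_ne_zero]
            intro h
            exact ht1 k.succPNat (by rw [← inv_inv (t ^ _), ← h, inv_one])
        · intro i hi
          have hi' := Finset.mem_range.1 hi
          have e2 : IsHom (hs (cM t) (k - i) * g) ((k - i + m : ℕ) : ℤ) := by
            have := (isHom_hs (cM t) (k - i)).mul hg
            convert this using 1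
            push_cast; rfl
          rw [mul_assoc, hC, mul_assoc, ihk i hi' _ (by omega) _ e2, smul_zero]
    intro f hf
    have e1 := congrArg χ hf.euler
    rw [hC, map_sum, Finset.sum_eq_zero] at e1
    · exact (smul_eq_zero.1 e1.symm).resolve_left (Nat.cast_ne_zero.2 n.succ_ne_zero)
    · intro k hk
      have hk' := Finset.mem_range.1 hk
      have e2 : IsHom (pderiv k.succPNat f) ((n - k : ℕ) : ℤ) := by
        have := hf.pderiv k.succPNat
        convert this using 1
        simp
        omega
      rw [mul_assoc, hC, hp k (n - k) (by omega) _ e2, smul_zero]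

end Macdonald

end MacFock

namespace MacFock
open MvPolynomial

/-! ### The Macdonald operator in finitely many variables -/

section PartialFractions
variable {K : Type*} [Field K] [CharZero K] {N : ℕ}

/-- The residues `∏_{j ≠ i} (x_i - s x_j) / (x_i - x_j)`. -/
def resB (s : K) (x : Fin N → K) (i : Fin N) : K :=
  ∏ j ∈ Finset.univ.erase i, (x i - s * x j) / (x i - x j)

/-- The difference of the two sides is a polynomial in y of degree at most N that vanishes at the N
+ 1 distinct points 0, x_1, …, x_N. -/
theorem partial_fractions_eval (s : K) {x : Fin N → K} (hx : Function.Injective x)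
    (hx0 : ∀ i, x i ≠ 0) (y : K) :
    s ^ N * ∏ i, (y - x i) +
      (1 - s) * ∑ i, resB s x i * (y * ∏ j ∈ Finset.univ.erase i, (y - x j)) =
    ∏ i, (y - s * x i) := by
  classical
  set D : Polynomial K := Polynomial.C (s ^ N) * ∏ i, (Polynomial.X - Polynomial.C (x i)) +
      Polynomial.C (1 - s) * (∑ i, Polynomial.C (resB s x i) *
        (Polynomial.X * ∏ j ∈ Finset.univ.erase i, (Polynomial.X - Polynomial.C (x j)))) -
      ∏ i, (Polynomial.X - Polynomial.C (s * x i)) with hD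
  have heval : ∀ y, D.eval y = s ^ N * ∏ i, (y - x i) +
      (1 - s) * ∑ i, resB s x i * (y * ∏ j ∈ Finset.univ.erase i, (y - x j)) -
      ∏ i, (y - s * x i) := by
    intro y
    simp [hD, Polynomial.eval_finsetSum, Polynomial.eval_prod]
  have hprod : ∀ (S : Finset (Fin N)) (z : Fin N → K),
      (∏ i ∈ S, (Polynomial.X - Polynomial.C (z i))).natDegree = S.card := by
    intro S z
    rw [Polynomial.natDegree_prod_of_monic _ _ fun i _ => Polynomial.monic_X_sub_C _]
    simp
  have hdeg : D.natDegree ≤ N := by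
    refine (Polynomial.natDegree_sub_le_of_le (Polynomial.natDegree_add_le_of_degree_le
      ?_ ?_) ?_).trans (max_self N).le
    · refine (Polynomial.natDegree_C_mul_le _ _).trans ?_
      rw [hprod]; simp
    · refine (Polynomial.natDegree_C_mul_le _ _).trans ?_
      refine Polynomial.natDegree_sum_le_of_forall_le _ _ fun i _ => ?_
      refine (Polynomial.natDegree_C_mul_le _ _).trans ?_
      refine Polynomial.natDegree_mul_le.trans ?_
      rw [hprod, Polynomial.natDegree_X, Finset.card_erase_of_mem (Finset.mem_univ i)]
      have : 0 < Fintype.card (Fin N) := Fintype.card_pos_iff.2 ⟨i⟩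
      simp at this ⊢
      omega
    · rw [hprod]; simp
  have hzero : D = 0 := by
    apply Polynomial.eq_zero_of_natDegree_lt_card_of_eval_eq_zero' D
      (insert 0 (Finset.univ.image x))
    · intro y hy
      rw [heval]
      rcases Finset.mem_insert.1 hy with rfl | hy
      · simp only [zero_mul, mul_zero, Finset.sum_const_zero, add_zero, zero_sub]
        have : ∏ i, -(s * x i) = s ^ N * ∏ i, -x i := by
          rw [Finset.prod_congr rfl (g := fun i => s * (-x i)) (fun i _ => by ring),
            Finset.prod_mul_distrib]
          simp
        rw [this, sub_self]
      · obtain ⟨i, _, rfl⟩ := Finset.mem_image.1 hy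
        rw [Finset.prod_eq_zero (Finset.mem_univ i) (sub_self _), mul_zero, zero_add,
          Finset.sum_eq_single_of_mem i (Finset.mem_univ i)]
        · rw [← Finset.mul_prod_erase Finset.univ (fun j => x i - s * x j) (Finset.mem_univ i),
            resB, Finset.prod_div_distrib]
          have : ∏ j ∈ Finset.univ.erase i, (x i - x j) ≠ 0 :=
            Finset.prod_ne_zero_iff.2 fun j hj =>
              sub_ne_zero.2 fun h => (Finset.ne_of_mem_erase hj) (hx h).symm
          field_simp
          ring
        · intro k _ hk
          rw [Finset.prod_eq_zero (i := i) (Finset.mem_erase.2 ⟨hk.symm, Finset.mem_univ i⟩)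
            (sub_self _)]
          ring
    · rw [Finset.card_insert_of_notMem, Finset.card_image_of_injective _ hx]
      · simp; omega
      · simpa using fun i => hx0 i
  have := heval y
  rw [hzero, Polynomial.eval_zero] at this
  exact (sub_eq_zero.1 this.symm)

/-- Substituting y = z⁻¹ in `partial_fractions_eval` gives the partial fractions of ∏ (1 - s x_i
z)/(1 - x_i z), whose terms are geometric series. For s = t⁻¹ this series is the creation half of
the vertex operator in N variables. -/
theorem partial_fractions (s : K) {x : Fin N → K} (hx : Function.Injective x)
    (hx0 : ∀ i, x i ≠ 0) {G : PowerSeries K}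
    (hG : G * ∏ i, (1 - PowerSeries.C (x i) * PowerSeries.X) =
      ∏ i, (1 - PowerSeries.C (s * x i) * PowerSeries.X)) (m : ℕ) :
    PowerSeries.coeff m G = (if m = 0 then s ^ N else 0) +
      (1 - s) * ∑ i, resB s x i * x i ^ m := by
  classical
  have hpoly : Polynomial.C (s ^ N) * ∏ i, (1 - Polynomial.C (x i) * Polynomial.X) +
      Polynomial.C (1 - s) * (∑ i, Polynomial.C (resB s x i) *
        (∏ j ∈ Finset.univ.erase i, (1 - Polynomial.C (x j) * Polynomial.X))) =
      ∏ i, (1 - Polynomial.C (s * x i) * Polynomial.X) := by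
    apply Polynomial.eq_of_infinite_eval_eq
    refine Set.Infinite.mono (s := {z : K | z ≠ 0}) ?_ ?_
    · intro z (hz : z ≠ 0)
      have h := partial_fractions_eval s hx hx0 z⁻¹
      have e1 : ∀ (S : Finset (Fin N)) (w : Fin N → K),
          ∏ j ∈ S, (1 - w j * z) = z ^ S.card * ∏ j ∈ S, (z⁻¹ - w j) := by
        intro S w
        rw [← Finset.prod_const, ← Finset.prod_mul_distrib]
        exact Finset.prod_congr rfl fun j _ => by field_simp
      simp only [Set.mem_ofPred_eq, Polynomial.eval_add, Polynomial.eval_mul, Polynomial.eval_C,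
        Polynomial.eval_prod, Polynomial.eval_sub, Polynomial.eval_one, Polynomial.eval_X,
        Polynomial.eval_finsetSum]
      rw [e1 Finset.univ, e1 Finset.univ, ← h]
      simp only [e1, Finset.card_univ, Fintype.card_fin]
      rw [mul_add, Finset.mul_sum, Finset.mul_sum, Finset.mul_sum]
      congr 1
      · ring
      · refine Finset.sum_congr rfl fun i _ => ?_
        rw [Finset.card_erase_of_mem (Finset.mem_univ i), Finset.card_univ, Fintype.card_fin]
        have : z ^ N = z ^ (N - 1) * z := by
          rw [← pow_succ]
          congr 1
          have : 0 < Fintype.card (Fin N) := Fintype.card_pos_iff.2 ⟨i⟩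
          simp at this
          omega
        rw [this]
        field_simp
    · exact (Set.finite_singleton (0 : K)).infinite_compl
  have hps := congrArg (Polynomial.coeToPowerSeries.ringHom : Polynomial K →+* PowerSeries K) hpoly
  simp only [map_add, map_mul, map_prod, map_sum, map_sub, map_one,
    Polynomial.coeToPowerSeries.ringHom_apply, Polynomial.coe_C, Polynomial.coe_X] at hps
  have hgeom : ∀ a : K, (PowerSeries.mk fun k => a ^ k) *
      (1 - PowerSeries.C a * PowerSeries.X) = 1 := fun a => mk_pow_mul_one_sub a
  have hclaim : G = PowerSeries.C (s ^ N) + PowerSeries.C (1 - s) *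
      ∑ i, PowerSeries.C (resB s x i) * PowerSeries.mk fun k => x i ^ k := by
    have hne : ∏ i, (1 - PowerSeries.C (x i) * PowerSeries.X) ≠ (0 : PowerSeries K) := by
      refine Finset.prod_ne_zero_iff.2 fun i _ h => ?_
      have := hgeom (x i)
      rw [h, mul_zero] at this
      exact zero_ne_one this
    apply mul_right_cancel₀ hne
    simp only [map_mul] at hG
    rw [hG, ← hps, add_mul, mul_assoc, Finset.sum_mul]
    congr 2
    · simp
    · refine Finset.sum_congr rfl fun i _ => ?_
      rw [← Finset.mul_prod_erase Finset.univ _ (Finset.mem_univ i), mul_assoc, ← mul_assoc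
        (PowerSeries.mk _), hgeom, one_mul]
  rw [hclaim, map_add, PowerSeries.coeff_C, PowerSeries.coeff_C_mul, map_sum]
  congr 3
  funext i
  rw [PowerSeries.coeff_C_mul, PowerSeries.coeff_mk]

end PartialFractions

end MacFock

namespace MacFock
open MvPolynomial

/-! ### The q-difference form of the operator and its dominant monomials -/

section Variables
variable {F : Type*} [Field F] [CharZero F] {N : ℕ}

/-- A symmetric function in the variables `x_1, …, x_N`. -/
def tv (N : ℕ) : MvPolynomial ℕ+ F →ₐ[F] MvPolynomial (Fin N) F :=
  aeval fun n : ℕ+ => psum (Fin N) F (n : ℕ)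

theorem tv_X (n : ℕ+) : tv N (X n : MvPolynomial ℕ+ F) = ∑ i, X i ^ (n : ℕ) := by
  simp [tv, psum]

/-- The scaling `x_i ↦ c x_i`. -/
def scaleVar (c : F) (i : Fin N) : MvPolynomial (Fin N) F →ₐ[F] MvPolynomial (Fin N) F :=
  aeval fun j => if j = i then C c * X j else X j

theorem coeff_scaleVar (c : F) (i : Fin N) (f : MvPolynomial (Fin N) F) (m : Fin N →₀ ℕ) :
    coeff m (scaleVar c i f) = c ^ m i * coeff m f := by
  classical
  induction f using MvPolynomial.induction_on' with
  | add f g hf hg => rw [map_add, coeff_add, coeff_add, hf, hg, mul_add]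
  | monomial u a =>
    have : scaleVar c i (monomial u a) = monomial u (c ^ u i * a) := by
      rw [scaleVar, aeval_monomial, Finsupp.prod_fintype _ _ (by simp), monomial_eq,
        Finsupp.prod_fintype _ _ (by simp), algebraMap_eq]
      have h : ∀ j, (if j = i then C c * X j else X j : MvPolynomial (Fin N) F) ^ u j =
          (if j = i then C c ^ u j else 1) * X j ^ u j := by
        intro j; split_ifs <;> simp [mul_pow]
      simp only [h]
      rw [Finset.prod_mul_distrib, Finset.prod_ite_eq' Finset.univ i, if_pos (Finset.mem_univ i),
        map_mul, map_pow]
      ring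
    rw [this, coeff_monomial, coeff_monomial]
    split_ifs with h
    · rw [h]
    · simp

/-- Setting w = x_i in the translation replaces p_n by p_n + (q^n - 1) x_i^n, which is the effect of
x_i ↦ q x_i. -/
theorem eval₂_tau_eq_scaleVar (q : F) (i : Fin N) (f : MvPolynomial ℕ+ F) :
    Polynomial.eval₂ (tv N : MvPolynomial ℕ+ F →ₐ[F] MvPolynomial (Fin N) F).toRingHom (X i) (tau (dM q) f) =
      scaleVar q i (tv N f) := by
  induction f using MvPolynomial.induction_on with
  | C a =>
    rw [tau_C, Polynomial.eval₂_C, AlgHom.toRingHom_eq_coe, RingHom.coe_coe, ← algebraMap_eq,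
      AlgHom.commutes, AlgHom.commutes, algebraMap_eq]
  | add f g hf hg => simp only [map_add, Polynomial.eval₂_add, hf, hg]
  | mul_X f j hf =>
    rw [map_mul, Polynomial.eval₂_mul, hf, map_mul, map_mul, tau_X, tv_X]
    congr 1
    simp only [Polynomial.eval₂_add, Polynomial.eval₂_mul, Polynomial.eval₂_C,
      Polynomial.eval₂_X_pow, AlgHom.toRingHom_eq_coe, RingHom.coe_coe, tv_X, map_sum, map_pow]
    have h1 : ∀ k, scaleVar q i (X k) = if k = i then C q * X k else X k := by
      intro k; simp [scaleVar]
    have h2 : tv N (C (dM q j)) = C (dM q j) := by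
      rw [← algebraMap_eq, AlgHom.commutes, algebraMap_eq]
    simp only [h1]
    rw [h2, ← Finset.add_sum_erase Finset.univ _ (Finset.mem_univ i),
      ← Finset.add_sum_erase Finset.univ (fun k => (if k = i then C q * X k else X k) ^ (j : ℕ))
      (Finset.mem_univ i), if_pos rfl, dM]
    rw [Finset.sum_congr rfl (g := fun k => (X k : MvPolynomial (Fin N) F) ^ (j : ℕ))
      (s₁ := Finset.univ.erase i) (f := fun k => (if k = i then C q * X k else X k) ^ (j : ℕ))]
    · simp only [map_neg, map_sub, map_one, map_pow]
      ring
    · intro k hk; rw [if_neg (Finset.ne_of_mem_erase hk)]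

theorem expPS_tv {t : F} :
    (PowerSeries.mk fun m => tv N (hs (cM t) m)) *
      ∏ i : Fin N, (1 - PowerSeries.C (X i) * PowerSeries.X) =
    ∏ i : Fin N, (1 - PowerSeries.C (C t⁻¹ * X i) * PowerSeries.X) := by
  have h1 : (PowerSeries.mk fun m => tv N (hs (cM t) m)) = expPS fun k : ℕ+ =>
      ∑ i : Fin N, (algebraMap F (MvPolynomial (Fin N) F) ((k : ℕ) : F)⁻¹ * X i ^ (k : ℕ) +
        -(algebraMap F (MvPolynomial (Fin N) F) ((k : ℕ) : F)⁻¹ * (C t⁻¹ * X i) ^ (k : ℕ))) := by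
    rw [expPS]
    congr 1
    funext m
    rw [hs, map_expCoeff (tv N)]
    congr 1
    funext k
    rw [map_mul, tv_X, ← algebraMap_eq, AlgHom.commutes, Finset.mul_sum]
    refine Finset.sum_congr rfl fun i _ => ?_
    rw [mul_pow, algebraMap_eq, ← map_pow, cM, div_eq_inv_mul, map_mul, map_sub,
      map_one, inv_pow]
    ring
  rw [h1, expPS_sum, ← Finset.prod_mul_distrib]
  refine Finset.prod_congr rfl fun i _ => ?_
  rw [expPS_add, expPS_neg_geom, mul_right_comm, expPS_geom_mul, one_mul]

/-- `∏_{j ≠ i} (x_i - s x_j)`. -/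
def facE (s : F) (i : Fin N) : MvPolynomial (Fin N) F :=
  ∏ j ∈ Finset.univ.erase i, (X i - C s * X j)

/-- `∏_k ∏_{j ≠ k} (x_k - x_j)`. -/
def discD (F : Type*) [Field F] (N : ℕ) : MvPolynomial (Fin N) F := ∏ k, facE 1 k

/-- `∏_{j ≠ i} (x_i - s x_j) ∏_{k ≠ i} ∏_{j ≠ k} (x_k - x_j)`. -/
def discDi (s : F) (i : Fin N) : MvPolynomial (Fin N) F :=
  facE s i * ∏ k ∈ Finset.univ.erase i, facE 1 k

theorem facE_one_ne_zero (i : Fin N) : facE (1 : F) i ≠ 0 := by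
  refine Finset.prod_ne_zero_iff.2 fun j hj h => ?_
  rw [map_one, one_mul, sub_eq_zero] at h
  exact Finset.ne_of_mem_erase hj (X_injective h).symm

/-- The constant term pairs the creation coefficients with powers of w. By `partial_fractions` these
coefficients are combinations of x_i^m, so the pairing evaluates the translated function at w = x_i.
Multiplying by all the differences x_k - x_j turns the identity into one between polynomials. -/
theorem map_discD_mul_tv_mac {K : Type*} [Field K] [CharZero K]
    (a : MvPolynomial (Fin N) F →+* K) (ha : Function.Injective a) (q t : F)
    (f : MvPolynomial ℕ+ F) :
    a (discD F N * tv N (mac q t 0 f)) = a (C (t⁻¹ ^ N) * (discD F N * tv N f) +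
      C (1 - t⁻¹) * ∑ i, discDi t⁻¹ i * scaleVar q i (tv N f)) := by
  classical
  set x : Fin N → K := fun i => a (X i)
  have hx : Function.Injective x := fun i j h => X_injective (ha h)
  have hx0 : ∀ i, x i ≠ 0 := fun i h => X_ne_zero i (ha (by rw [map_zero]; exact h))
  have hG := congrArg (PowerSeries.map a) (expPS_tv (N := N) (t := t))
  simp only [map_mul, map_prod, map_sub, map_one, PowerSeries.map_C, PowerSeries.map_X] at hG
  have hpf := partial_fractions (a (C t⁻¹)) hx hx0 (G := PowerSeries.map a
    (PowerSeries.mk fun m => tv N (hs (cM t) m))) (by simpa only [map_mul] using hG)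
  simp only [PowerSeries.coeff_map, PowerSeries.coeff_mk] at hpf
  set M := (tau (dM q) f).natDegree + 1 with hM
  have h1 : a (tv N (mac q t 0 f)) = a (C t⁻¹) ^ N * a (tv N f) +
      (1 - a (C t⁻¹)) * ∑ i, resB (a (C t⁻¹)) x i * a (scaleVar q i (tv N f)) := by
    rw [mac, V_eq_sum (cM t) (dM q) 0 f (M := M) (by omega)]
    simp only [map_sum, map_mul, add_zero, hpf, add_mul]
    rw [Finset.sum_add_distrib]
    congr 1
    · rw [Finset.sum_eq_single_of_mem 0 (by simp [hM])]
      · rw [if_pos rfl, Nat.cast_zero, tz_zero]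
      · intro m _ hm; rw [if_neg hm, zero_mul]
    · simp only [Finset.mul_sum, Finset.sum_mul]
      rw [Finset.sum_comm]
      refine Finset.sum_congr rfl fun i _ => ?_
      rw [← eval₂_tau_eq_scaleVar, Polynomial.eval₂_eq_sum_range' _ (n := M) (by omega), map_sum,
        Finset.mul_sum, Finset.mul_sum]
      refine Finset.sum_congr rfl fun m _ => ?_
      rw [map_mul, map_pow, tz_natCast]
      change _ = (1 - a (C t⁻¹)) * (resB (a (C t⁻¹)) x i *
        (a (tv N ((tau (dM q) f).coeff m)) * x i ^ m))
      ring
  have hD : ∀ i, a (discD F N) * resB (a (C t⁻¹)) x i = a (discDi t⁻¹ i) := by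
    intro i
    rw [discD, discDi, ← Finset.mul_prod_erase _ _ (Finset.mem_univ i), map_mul, map_mul]
    have e1 : resB (a (C t⁻¹)) x i = a (facE t⁻¹ i) / a (facE 1 i) := by
      rw [resB, Finset.prod_div_distrib, facE, facE, map_prod, map_prod]
      congr 1
      · exact Finset.prod_congr rfl fun j _ => by rw [map_sub, map_mul]
      · exact Finset.prod_congr rfl fun j _ => by rw [map_sub, map_mul, map_one, map_one, one_mul]
    have e2 : a (facE 1 i) ≠ 0 := fun h => facE_one_ne_zero i (ha (by rw [h, map_zero]))
    rw [e1, div_eq_mul_inv]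
    calc _ = (a (facE 1 i) * (a (facE 1 i))⁻¹) * (a (facE t⁻¹ i) *
          a (∏ x ∈ Finset.univ.erase i, facE 1 x)) := by ring
      _ = _ := by rw [mul_inv_cancel₀ e2, one_mul]
  rw [map_mul, h1]
  simp only [map_add, map_mul, map_sum, map_pow, map_sub, map_one, ← hD]
  rw [mul_add, Finset.mul_sum, Finset.mul_sum, Finset.mul_sum]
  congr 1
  · ring
  · exact Finset.sum_congr rfl fun i _ => by ring

theorem discD_mul_tv_mac (q t : F) (f : MvPolynomial ℕ+ F) :
    discD F N * tv N (mac q t 0 f) = C (t⁻¹ ^ N) * (discD F N * tv N f) +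
      C (1 - t⁻¹) * ∑ i, discDi t⁻¹ i * scaleVar q i (tv N f) := by
  have ha := IsFractionRing.injective (MvPolynomial (Fin N) F)
    (FractionRing (MvPolynomial (Fin N) F))
  have : CharZero (FractionRing (MvPolynomial (Fin N) F)) := charZero_of_injective_algebraMap ha
  exact ha (map_discD_mul_tv_mac _ ha q t f)

/-! ### Leading monomials for the dominance order -/

/-- The sum of the first `k` exponents. -/
def pre (k : ℕ) (m : Fin N →₀ ℕ) : ℕ := ∑ i with i.val < k, m i

theorem pre_add (k : ℕ) (m m' : Fin N →₀ ℕ) : pre k (m + m') = pre k m + pre k m' := by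
  simp [pre, Finset.sum_add_distrib]

theorem pre_succ (m : Fin N →₀ ℕ) (i : Fin N) : pre (i.val + 1) m = pre i.val m + m i := by
  have : Finset.univ.filter (fun j : Fin N => j.val < i.val + 1) =
      insert i (Finset.univ.filter (fun j : Fin N => j.val < i.val)) := by
    ext j
    simp only [Finset.mem_filter, Finset.mem_univ, true_and, Finset.mem_insert, Fin.ext_iff]
    omega
  rw [pre, this, Finset.sum_insert (by simp), pre, add_comm]

theorem eq_of_pre_eq {m m' : Fin N →₀ ℕ} (h : ∀ k, pre k m = pre k m') : m = m' := by
  ext i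
  have h1 := h (i.val + 1)
  rw [pre_succ, pre_succ, h i.val] at h1
  omega

/-- All monomials of `f` have their partial sums of exponents bounded by `β`. -/
def PreBdd (β : ℕ → ℕ) (f : MvPolynomial (Fin N) F) : Prop :=
  ∀ m, coeff m f ≠ 0 → ∀ k, pre k m ≤ β k

theorem PreBdd.add {β : ℕ → ℕ} {f g : MvPolynomial (Fin N) F} (hf : PreBdd β f)
    (hg : PreBdd β g) : PreBdd β (f + g) := by
  intro m hm
  rw [coeff_add] at hm
  by_cases h : coeff m f = 0
  · exact hg m (by simpa [h] using hm)
  · exact hf m h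

theorem PreBdd.sum {ι : Type*} {s : Finset ι} {β : ℕ → ℕ} {f : ι → MvPolynomial (Fin N) F}
    (hf : ∀ i ∈ s, PreBdd β (f i)) : PreBdd β (∑ i ∈ s, f i) := by
  intro m hm
  rw [coeff_sum] at hm
  obtain ⟨i, hi, h⟩ := Finset.exists_ne_zero_of_sum_ne_zero hm
  exact hf i hi m h

theorem PreBdd.mul {β β' : ℕ → ℕ} {f g : MvPolynomial (Fin N) F} (hf : PreBdd β f)
    (hg : PreBdd β' g) : PreBdd (fun k => β k + β' k) (f * g) := by
  intro m hm k
  rw [coeff_mul] at hm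
  obtain ⟨⟨m1, m2⟩, hi, h⟩ := Finset.exists_ne_zero_of_sum_ne_zero hm
  rw [Finset.HasAntidiagonal.mem_antidiagonal] at hi
  simp only at hi h
  rw [← hi, pre_add]
  exact add_le_add (hf m1 (left_ne_zero_of_mul h) k) (hg m2 (right_ne_zero_of_mul h) k)

theorem PreBdd.C_mul {β : ℕ → ℕ} {f : MvPolynomial (Fin N) F} (hf : PreBdd β f) (a : F) :
    PreBdd β (C a * f) := by
  intro m hm
  rw [coeff_C_mul] at hm
  exact hf m (right_ne_zero_of_mul hm)

theorem PreBdd.scaleVar {β : ℕ → ℕ} {f : MvPolynomial (Fin N) F} (hf : PreBdd β f) (c : F)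
    (i : Fin N) : PreBdd β (scaleVar c i f) := by
  intro m hm
  rw [coeff_scaleVar] at hm
  exact hf m (right_ne_zero_of_mul hm)

/-- When two exponents add up to α + α', the bounds on their partial sums must both be attained, so
the decomposition is unique. -/
theorem coeff_add_mul_of_preBdd {α α' : Fin N →₀ ℕ} {f g : MvPolynomial (Fin N) F}
    (hf : PreBdd (fun k => pre k α) f) (hg : PreBdd (fun k => pre k α') g) :
    coeff (α + α') (f * g) = coeff α f * coeff α' g := by
  rw [coeff_mul, Finset.sum_eq_single_of_mem (α, α') (by simp)]
  rintro ⟨m1, m2⟩ hm hne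
  rw [Finset.HasAntidiagonal.mem_antidiagonal] at hm
  simp only at hm ⊢
  by_contra h
  apply hne
  have h1 : ∀ k, pre k m1 ≤ pre k α := hf m1 (left_ne_zero_of_mul h)
  have h2 : ∀ k, pre k m2 ≤ pre k α' := hg m2 (right_ne_zero_of_mul h)
  have h3 : ∀ k, pre k m1 + pre k m2 = pre k α + pre k α' := by
    intro k; rw [← pre_add, ← pre_add, hm]
  rw [Prod.mk.injEq]
  constructor
  · exact eq_of_pre_eq fun k => by have := h1 k; have := h2 k; have := h3 k; omega
  · exact eq_of_pre_eq fun k => by have := h1 k; have := h2 k; have := h3 k; omega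

/-- `x^α` is the dominant monomial of `f`, with coefficient `c`. -/
def Lead (f : MvPolynomial (Fin N) F) (α : Fin N →₀ ℕ) (c : F) : Prop :=
  PreBdd (fun k => pre k α) f ∧ coeff α f = c

theorem Lead.mul {f g : MvPolynomial (Fin N) F} {α α' : Fin N →₀ ℕ} {c c' : F} (hf : Lead f α c)
    (hg : Lead g α' c') : Lead (f * g) (α + α') (c * c') := by
  refine ⟨?_, by rw [coeff_add_mul_of_preBdd hf.1 hg.1, hf.2, hg.2]⟩
  have := hf.1.mul hg.1
  simpa only [pre_add] using this

theorem lead_one : Lead (1 : MvPolynomial (Fin N) F) 0 1 := by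
  refine ⟨fun m hm k => ?_, by simp⟩
  rw [coeff_one] at hm
  have : 0 = m := by by_contra h; simp [h] at hm
  rw [← this]

theorem Lead.prod {ι : Type*} (s : Finset ι) {f : ι → MvPolynomial (Fin N) F}
    {α : ι → Fin N →₀ ℕ} {c : ι → F} (h : ∀ i ∈ s, Lead (f i) (α i) (c i)) :
    Lead (∏ i ∈ s, f i) (∑ i ∈ s, α i) (∏ i ∈ s, c i) := by
  classical
  induction s using Finset.induction_on with
  | empty => simpa using lead_one
  | insert a s ha ih =>
    rw [Finset.prod_insert ha, Finset.sum_insert ha, Finset.prod_insert ha]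
    exact (h a (Finset.mem_insert_self _ _)).mul
      (ih fun i hi => h i (Finset.mem_insert_of_mem hi))

theorem pre_single (k : ℕ) (i : Fin N) :
    pre k (Finsupp.single i 1) = if i.val < k then 1 else 0 := by
  classical
  rw [pre]
  simp [Finsupp.single_apply, Finset.sum_ite_eq]

theorem lead_linear (s : F) {i j : Fin N} (hij : j ≠ i) :
    Lead (X i - C s * X j : MvPolynomial (Fin N) F) (Finsupp.single (min i j) 1)
      (if i < j then 1 else -s) := by
  classical
  have hc : ∀ m, coeff m (X i - C s * X j : MvPolynomial (Fin N) F) =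
      (if Finsupp.single i 1 = m then 1 else 0) - s * if Finsupp.single j 1 = m then 1 else 0 := by
    intro m
    rw [coeff_sub, coeff_C_mul, coeff_X, coeff_X]
  constructor
  · intro m hm k
    rw [hc] at hm
    simp only
    have hor : Finsupp.single i 1 = m ∨ Finsupp.single j 1 = m := by
      by_contra h
      push Not at h
      simp [h.1, h.2] at hm
    rcases hor with rfl | rfl
    · rw [pre_single, pre_single]
      split_ifs with h1 h2 <;> first | rfl | omega | skip
      exact absurd (lt_of_le_of_lt (Fin.le_def.1 (min_le_left i j)) h1) h2
    · rw [pre_single, pre_single]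
      split_ifs with h1 h2 <;> first | rfl | omega | skip
      exact absurd (lt_of_le_of_lt (Fin.le_def.1 (min_le_right i j)) h1) h2
  · rw [hc]
    have hs : ∀ a b : Fin N, (Finsupp.single a 1 : Fin N →₀ ℕ) = Finsupp.single b 1 ↔ a = b := by
      intro a b
      exact Finsupp.single_left_inj one_ne_zero
    simp only [hs]
    rcases lt_or_gt_of_ne hij with h | h
    · rw [min_eq_right h.le, if_neg (Ne.symm hij), if_pos rfl, if_neg (not_lt.2 h.le)]; ring
    · rw [min_eq_left h.le, if_pos rfl, if_neg hij, if_pos h]; ring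

theorem lead_facE (s : F) (i : Fin N) :
    Lead (facE s i) (∑ j ∈ Finset.univ.erase i, Finsupp.single (min i j) 1)
      (∏ j ∈ Finset.univ.erase i, if i < j then 1 else -s) :=
  Lead.prod _ fun _ hj => lead_linear s (Finset.ne_of_mem_erase hj)

theorem prod_ite_lt (s : F) (i : Fin N) :
    (∏ j ∈ Finset.univ.erase i, if i < j then 1 else -s) =
      s ^ i.val * ∏ j ∈ Finset.univ.erase i, if i < j then (1 : F) else -1 := by
  have h : ∀ j : Fin N, (if i < j then 1 else -s) =
      (if i < j then 1 else s) * if i < j then (1 : F) else -1 := by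
    intro j; split_ifs <;> ring
  rw [Finset.prod_congr rfl fun j _ => h j, Finset.prod_mul_distrib]
  congr 1
  rw [Finset.prod_ite, Finset.prod_const_one, one_mul, Finset.prod_const]
  congr 1
  rw [show (Finset.univ.erase i).filter (fun j => ¬ i < j) = Finset.Iio i by
    ext j
    simp only [Finset.mem_filter, Finset.mem_erase, Finset.mem_univ, Finset.mem_Iio]
    constructor
    · rintro ⟨⟨h1, _⟩, h2⟩; exact lt_of_le_of_ne (not_lt.1 h2) h1
    · intro h; exact ⟨⟨h.ne, trivial⟩, not_lt.2 h.le⟩, Fin.card_Iio]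

/-- In each factor x_i - s x_j the variable with the smaller index dominates, whatever s is, so all
these products share one dominant monomial. The parameter enters its coefficient once for each j <
i, which accounts for the power of s. -/
theorem exists_lead_discD : ∃ (α : Fin N →₀ ℕ) (c : F), c ≠ 0 ∧ Lead (discD F N) α c ∧
    ∀ s i, Lead (discDi s i) α (s ^ i.val * c) := by
  have h1 : ∀ k : Fin N, (∏ j ∈ Finset.univ.erase k, if k < j then (1 : F) else -1) ≠ 0 := by
    intro k
    refine Finset.prod_ne_zero_iff.2 fun j _ => ?_
    split_ifs <;> simp
  refine ⟨_, ∏ k, ∏ j ∈ Finset.univ.erase k, if k < j then (1 : F) else -1,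
    Finset.prod_ne_zero_iff.2 fun k _ => h1 k, Lead.prod _ fun k _ => lead_facE 1 k, ?_⟩
  intro s i
  have h2 := (lead_facE s i).mul (Lead.prod (Finset.univ.erase i) fun k _ => lead_facE 1 k)
  rw [prod_ite_lt, Finset.add_sum_erase Finset.univ
    (fun i : Fin N => ∑ j ∈ Finset.univ.erase i, Finsupp.single (min i j) 1) (Finset.mem_univ i),
    mul_assoc, Finset.mul_prod_erase Finset.univ
    (fun i : Fin N => ∏ j ∈ Finset.univ.erase i, if i < j then (1 : F) else -1)
    (Finset.mem_univ i)] at h2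
  exact h2

/-- The scaling of the first `k` variables by a parameter. -/
def scalePre (k : ℕ) : MvPolynomial (Fin N) F →ₐ[F] Polynomial (MvPolynomial (Fin N) F) :=
  aeval fun i => Polynomial.C (X i) * if i.val < k then Polynomial.X else 1

theorem coeff_coeff_scalePre (k d : ℕ) (f : MvPolynomial (Fin N) F) (m : Fin N →₀ ℕ) :
    coeff m ((scalePre k f).coeff d) = if pre k m = d then coeff m f else 0 := by
  classical
  induction f using MvPolynomial.induction_on' with
  | add f g hf hg =>
    rw [map_add, Polynomial.coeff_add, coeff_add, coeff_add, hf, hg]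
    split_ifs <;> simp
  | monomial u a =>
    have : scalePre k (monomial u a) = Polynomial.C (monomial u a) * Polynomial.X ^ pre k u := by
      rw [scalePre, aeval_monomial, Finsupp.prod_fintype _ _ (by simp), monomial_eq,
        Finsupp.prod_fintype _ _ (by simp), Polynomial.C_mul, map_prod]
      simp only [mul_pow, Finset.prod_mul_distrib, Polynomial.C_pow]
      have h1 : ∏ i : Fin N, (if i.val < k then (Polynomial.X : Polynomial (MvPolynomial (Fin N) F))
          else 1) ^ u i = Polynomial.X ^ pre k u := by
        rw [pre, ← Finset.prod_pow_eq_pow_sum, Finset.prod_filter]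
        exact Finset.prod_congr rfl fun i _ => by split_ifs <;> simp
      rw [h1, mul_assoc]
      rfl
    rw [this, Polynomial.coeff_C_mul, Polynomial.coeff_X_pow, mul_ite, mul_one, mul_zero]
    by_cases hm : m = u
    · subst hm
      by_cases h : pre k m = d
      · simp [h]
      · simp [h, Ne.symm h]
    · have : coeff m (monomial u a) = 0 := by rw [coeff_monomial, if_neg (Ne.symm hm)]
      split_ifs <;> simp [this]

/-- Marking the first k variables by a parameter turns the k-th partial sum into a degree in one
variable over a domain, where degrees of products add. This permits cancelling the common
denominator of the q-difference operator. -/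
theorem PreBdd.of_mul_left {f g : MvPolynomial (Fin N) F} {α : Fin N →₀ ℕ} {c : F} {β : ℕ → ℕ}
    (hf : Lead f α c) (hc : c ≠ 0) (h : PreBdd (fun k => pre k α + β k) (f * g)) :
    PreBdd β g := by
  have hdeg : ∀ (k d : ℕ) (p : MvPolynomial (Fin N) F), (∀ m, coeff m p ≠ 0 → pre k m ≤ d) →
      (scalePre k p).natDegree ≤ d := by
    intro k d p hp
    rw [Polynomial.natDegree_le_iff_coeff_eq_zero]
    intro e he
    ext m
    rw [coeff_coeff_scalePre, coeff_zero]
    split_ifs with hm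
    · by_contra h0
      have := hp m h0
      omega
    · rfl
  have hle : ∀ (k : ℕ) (p : MvPolynomial (Fin N) F) (m : Fin N →₀ ℕ), coeff m p ≠ 0 →
      pre k m ≤ (scalePre k p).natDegree := by
    intro k p m hm
    apply Polynomial.le_natDegree_of_ne_zero
    intro h0
    have := coeff_coeff_scalePre k (pre k m) p m
    rw [h0, if_pos rfl, coeff_zero] at this
    exact hm this.symm
  intro m hm k
  have hf0 : scalePre k f ≠ 0 := by
    intro h0
    have := coeff_coeff_scalePre k (pre k α) f α
    rw [h0, if_pos rfl, hf.2, Polynomial.coeff_zero, coeff_zero] at this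
    exact hc this.symm
  have hg0 : scalePre k g ≠ 0 := by
    intro h0
    have := coeff_coeff_scalePre k (pre k m) g m
    rw [h0, if_pos rfl, Polynomial.coeff_zero, coeff_zero] at this
    exact hm this.symm
  have h1 := hdeg k (pre k α + β k) _ fun m' hm' => h m' hm' k
  rw [map_mul, Polynomial.natDegree_mul hf0 hg0] at h1
  have h2 := hle k f α (by rw [hf.2]; exact hc)
  have h3 := hle k g m hm
  omega

theorem PreBdd.tv_mac {q t : F} {β : ℕ → ℕ} {f : MvPolynomial ℕ+ F} (hf : PreBdd β (tv N f)) :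
    PreBdd β (tv N (mac q t 0 f)) := by
  obtain ⟨α, c, hc, h1, h2⟩ := exists_lead_discD (F := F) (N := N)
  refine PreBdd.of_mul_left h1 hc ?_
  rw [discD_mul_tv_mac]
  refine ((h1.1.mul hf).C_mul _).add ((PreBdd.sum fun i _ => ?_).C_mul _)
  exact (h2 _ i).1.mul (hf.scaleVar q i)

theorem coeff_tv_mac {q t : F} {α : Fin N →₀ ℕ} {f : MvPolynomial ℕ+ F}
    (hf : PreBdd (fun k => pre k α) (tv N f)) :
    coeff α (tv N (mac q t 0 f)) =
      (t⁻¹ ^ N + (1 - t⁻¹) * ∑ i : Fin N, t⁻¹ ^ i.val * q ^ α i) * coeff α (tv N f) := by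
  obtain ⟨δ, c, hc, h1, h2⟩ := exists_lead_discD (F := F) (N := N)
  have h3 := congrArg (coeff (δ + α)) (discD_mul_tv_mac (N := N) q t f)
  rw [coeff_add_mul_of_preBdd h1.1 hf.tv_mac, coeff_add, coeff_C_mul, coeff_C_mul, coeff_sum,
    coeff_add_mul_of_preBdd h1.1 hf, h1.2] at h3
  simp only [coeff_add_mul_of_preBdd (h2 _ _).1 (hf.scaleVar q _), (h2 _ _).2,
    coeff_scaleVar] at h3
  apply mul_left_cancel₀ hc
  rw [h3, add_mul, mul_add, mul_assoc (1 - t⁻¹), Finset.sum_mul, Finset.mul_sum, Finset.mul_sum,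
    Finset.mul_sum]
  congr 1
  · ring
  · exact Finset.sum_congr rfl fun i _ => by ring

end Variables

end MacFock

namespace MacFock
open MvPolynomial

/-! ### Monomial coefficients of symmetric functions -/

section Expansion
variable {F : Type*} [Field F] [CharZero F]

/-- The coefficient of `x_1^{l_1} x_2^{l_2} ⋯` in a symmetric function. -/
def kap : List ℕ → MvPolynomial ℕ+ F →ₗ[F] F
  | [] => lcoeff F 0
  | m :: l => kap l ∘ₗ tz (fun _ => 1) m

theorem kap_nil (f : MvPolynomial ℕ+ F) : kap [] f = coeff 0 f := rfl

theorem kap_cons (m : ℕ) (l : List ℕ) (f : MvPolynomial ℕ+ F) :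
    kap (m :: l) f = kap l (tz (fun _ => 1) m f) := rfl

theorem kap_perm {l l' : List ℕ} (h : l.Perm l') (f : MvPolynomial ℕ+ F) :
    kap l f = kap l' f := by
  induction h generalizing f with
  | nil => rfl
  | cons m _ ih => rw [kap_cons, kap_cons, ih]
  | swap m m' l => rw [kap_cons, kap_cons, kap_cons, kap_cons, tz_comm]
  | trans _ _ ih ih' => rw [ih, ih']

theorem kap_filter (l : List ℕ) (f : MvPolynomial ℕ+ F) :
    kap (l.filter (· ≠ 0)) f = kap l f := by
  induction l generalizing f with
  | nil => rfl
  | cons m l ih =>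
    by_cases hm : m = 0
    · subst hm
      rw [List.filter_cons_of_neg (by simp), ih, kap_cons, Nat.cast_zero, tz_zero]
    · rw [List.filter_cons_of_pos (by simp [hm]), kap_cons, kap_cons, ih]

theorem kap_eq_zero {f : MvPolynomial ℕ+ F} {n : ℤ} (hf : IsHom f n) {l : List ℕ}
    (hl : (l.sum : ℤ) ≠ n) : kap l f = 0 := by
  induction l generalizing f n with
  | nil =>
    rw [kap_nil]
    by_contra h
    have := hf h
    simp at this hl
    exact hl this.symm.symm
  | cons m l ih =>
    rw [kap_cons]
    refine ih (hf.tz m) ?_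
    rw [List.sum_cons, Nat.cast_add] at hl
    omega

/-- Adjoining a variable x adds x^n to p_n. Extracting a power of one variable is therefore a
translation coefficient with all d_n = 1, which is the reason for the form of `kap`. -/
theorem finSuccEquiv_tv (N : ℕ) (f : MvPolynomial ℕ+ F) :
    finSuccEquiv F N (tv (N + 1) f) =
      Polynomial.map (tv N : MvPolynomial ℕ+ F →ₐ[F] MvPolynomial (Fin N) F).toRingHom
        (tau (fun _ => 1) f) := by
  induction f using MvPolynomial.induction_on with
  | C a =>
    rw [tau_C, Polynomial.map_C, AlgHom.toRingHom_eq_coe, RingHom.coe_coe, ← algebraMap_eq,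
      AlgHom.commutes, AlgHom.commutes, AlgEquiv.commutes]
    rfl
  | add f g hf hg => simp only [map_add, Polynomial.map_add, hf, hg]
  | mul_X f j hf =>
    rw [map_mul, map_mul, hf, map_mul, Polynomial.map_mul, tau_X, tv_X, Fin.sum_univ_succ]
    congr 1
    simp only [map_add, map_pow, map_sum, finSuccEquiv_X_zero, finSuccEquiv_X_succ,
      Polynomial.map_add, Polynomial.map_C, Polynomial.map_pow,
      Polynomial.map_X, AlgHom.toRingHom_eq_coe, RingHom.coe_coe, tv_X, map_one, one_mul]
    rw [add_comm]

theorem coeff_tv (N : ℕ) (α : Fin N →₀ ℕ) (f : MvPolynomial ℕ+ F) :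
    coeff α (tv N f) = kap (List.ofFn α) f := by
  induction N generalizing f with
  | zero =>
    rw [List.ofFn_zero, kap_nil, Subsingleton.elim α 0]
    induction f using MvPolynomial.induction_on with
    | C a =>
      rw [← algebraMap_eq, AlgHom.commutes, algebraMap_eq, algebraMap_eq, coeff_C, coeff_C,
        if_pos rfl, if_pos rfl]
    | add f g hf hg => rw [map_add, coeff_add, coeff_add, hf, hg]
    | mul_X f j hf =>
      rw [map_mul, tv_X, coeff_mul_X']
      simp
  | succ N ih =>
    have h := finSuccEquiv_coeff_coeff α.tail (tv (N + 1) f) (α 0)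
    rw [Finsupp.cons_tail] at h
    rw [← h, finSuccEquiv_tv, Polynomial.coeff_map, AlgHom.toRingHom_eq_coe, RingHom.coe_coe, ih,
      List.ofFn_succ, kap_cons, tz_natCast]
    rfl

/-- A symmetric function is determined by its coefficients. -/
theorem eq_zero_of_kap {f : MvPolynomial ℕ+ F} (h : ∀ l, kap l f = 0) : f = 0 := by
  -- Vanishing passes to derivatives: in `natCast_mul_tz` with index k + 1 the last summand is
  -- ∂f/∂p_{k+1} up to a nonzero scalar, and the earlier ones involve derivatives already treated.
  have hd : ∀ f : MvPolynomial ℕ+ F, (∀ l, kap l f = 0) → ∀ k : ℕ, ∀ l,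
      kap l (pderiv k.succPNat f) = 0 := by
    intro f h k
    induction k using Nat.strong_induction_on with
    | _ k ihk =>
      intro l
      have h1 := natCast_mul_tz (fun _ => (1 : F)) (k + 1) f ((k + 1 : ℕ) : ℤ) le_rfl
      rw [Finset.sum_range_succ] at h1
      have h2 := congrArg (kap l) h1
      have e : (((k + 1 : ℕ) : ℤ) : MvPolynomial ℕ+ F) = C ((k : F) + 1) := by simp
      rw [e, ← smul_eq_C_mul, map_smul, ← kap_cons, h, smul_zero, map_add, map_sum,
        Finset.sum_eq_zero, zero_add, mul_one, ← smul_eq_C_mul, map_smul,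
        show ((k + 1 : ℕ) : ℤ) - (k + 1) = 0 by push_cast; ring, tz_zero] at h2
      · exact (smul_eq_zero.1 h2.symm).resolve_left (Nat.cast_add_one_ne_zero k)
      · intro j hj
        rw [Finset.mem_range] at hj
        rw [← smul_eq_C_mul, map_smul,
          show ((k + 1 : ℕ) : ℤ) - (j + 1) = ((k - j : ℕ) : ℤ) by omega, ← kap_cons, ihk j hj,
          smul_zero]
  have key : ∀ (n : ℕ) (s : ℕ+ →₀ ℕ), s.degree = n → ∀ f : MvPolynomial ℕ+ F,
      (∀ l, kap l f = 0) → coeff s f = 0 := by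
    intro n
    induction n with
    | zero =>
      intro s hs f hf
      rw [Finsupp.degree_eq_zero_iff] at hs
      rw [hs, ← kap_nil, hf]
    | succ n ih =>
      intro s hs f hf
      obtain ⟨k, hk⟩ : ∃ k, s k ≠ 0 := by
        by_contra h0
        push Not at h0
        rw [show s = 0 from Finsupp.ext h0, map_zero] at hs
        omega
      have hsk : s - Finsupp.single k 1 + Finsupp.single k 1 = s :=
        Finsupp.sub_add_single_one_cancel hk
      have h1 : (s - Finsupp.single k 1).degree = n := by
        have := congrArg Finsupp.degree hsk
        rw [map_add, Finsupp.degree_single, hs] at this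
        omega
      have hpk : k = (k : ℕ).pred.succPNat := by
        apply PNat.eq
        rw [Nat.succPNat_coe, Nat.succ_pred_eq_of_pos k.pos]
      have h2 := ih _ h1 (pderiv k f) (by rw [hpk]; exact hd f hf _)
      rw [coeff_pderiv, hsk] at h2
      exact (mul_eq_zero.1 h2).resolve_right (Nat.cast_add_one_ne_zero _)
  ext s
  rw [key _ s rfl f h, coeff_zero]

open MacVertex in
theorem sum_rows {n : ℕ} (μ : n.Partition) : (rows μ).sum = n := by
  rw [← Multiset.sum_coe, rows, Multiset.sort_eq, μ.parts_sum]

open MacVertex in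
theorem coe_rows {n : ℕ} (μ : n.Partition) : (rows μ : Multiset ℕ) = μ.parts := by
  rw [rows, Multiset.sort_eq]

open MacVertex in
theorem kap_eq_of_parts {n : ℕ} {l : List ℕ} {μ : n.Partition}
    (h : μ.parts = (l : Multiset ℕ).filter (· ≠ 0)) (f : MvPolynomial ℕ+ F) :
    kap l f = kap (rows μ) f := by
  rw [← kap_filter]
  apply kap_perm
  rw [← Multiset.coe_eq_coe, coe_rows, h]
  simp

open MacVertex in
theorem eq_zero_of_kap_rows {n : ℕ} {f : MvPolynomial ℕ+ F} (hf : IsHom f n)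
    (h : ∀ μ : n.Partition, kap (rows μ) f = 0) : f = 0 := by
  refine eq_zero_of_kap fun l => ?_
  by_cases hl : l.sum = n
  · rw [kap_eq_of_parts (μ := Nat.Partition.ofSums n l (by simpa using hl)), h]
    rfl
  · exact kap_eq_zero hf (by exact_mod_cast hl)

theorem sum_filter_ne_zero (s : Multiset ℕ) : (s.filter (· ≠ 0)).sum = s.sum := by
  induction s using Multiset.induction_on with
  | empty => rfl
  | cons a s ih =>
    by_cases ha : a = 0
    · simp [ha] at ih ⊢; exact ih
    · rw [Multiset.filter_cons_of_pos (p := (· ≠ 0)) _ ha, Multiset.sum_cons, Multiset.sum_cons, ih]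

theorem coeff_msymm {n N : ℕ} (μ : n.Partition) (α : Fin N →₀ ℕ) :
    coeff α (msymm (Fin N) F μ) = if μ.parts = α.support.val.map α then 1 else 0 := by
  classical
  have hm : ∀ s : Multiset (Fin N), (s.map X : Multiset (MvPolynomial (Fin N) F)).prod =
      monomial (Multiset.toFinsupp s) 1 := by
    intro s
    induction s using Multiset.induction_on with
    | empty => simp
    | cons a s ih =>
      rw [Multiset.map_cons, Multiset.prod_cons, ih, ← Multiset.singleton_add, map_add,
        Multiset.toFinsupp_singleton, X, monomial_mul, one_mul]
  have hp : ∀ s : Sym (Fin N) n, (Nat.Partition.ofSym s).parts =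
      (Multiset.toFinsupp s.1).support.val.map (Multiset.toFinsupp s.1) := by
    intro s
    simp only [Nat.Partition.ofSym, Multiset.toFinsupp_support]
    rfl
  rw [msymm, coeff_sum]
  simp only [hm, coeff_monomial]
  split_ifs with h
  · have hs : (Finsupp.toMultiset α).card = n := by
      rw [Finsupp.card_toMultiset, Finsupp.sum, ← μ.parts_sum, h]; rfl
    have ht : Nat.Partition.ofSym (Sym.mk (Finsupp.toMultiset α) hs) = μ := by
      ext1
      rw [hp, h]
      simp
    rw [Finset.sum_eq_single ⟨Sym.mk (Finsupp.toMultiset α) hs, ht⟩]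
    · simp
    · intro b _ hb
      rw [if_neg]
      intro h'
      apply hb
      ext1; apply Subtype.ext
      simp [← h']
    · simp
  · refine Finset.sum_eq_zero fun s _ => ?_
    rw [if_neg]
    intro h'
    apply h
    rw [← s.2, hp, h']

open MacVertex in
theorem tv_eq_sum_msymm {n : ℕ} {f : MvPolynomial ℕ+ F} (hf : IsHom f n) (N : ℕ) :
    tv N f = ∑ μ : n.Partition, kap (rows μ) f • msymm (Fin N) F μ := by
  classical
  ext α
  rw [coeff_tv, coeff_sum]
  simp only [coeff_smul, coeff_msymm, smul_eq_mul, mul_ite, mul_one, mul_zero]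
  have hα : α.support.val.map α = ((List.ofFn α : List ℕ) : Multiset ℕ).filter (· ≠ 0) := by
    have h1 : ((List.ofFn α : List ℕ) : Multiset ℕ) = Finset.univ.val.map α := by
      rw [List.ofFn_eq_map]
      rfl
    have h2 : α.support = Finset.univ.filter fun i => α i ≠ 0 := by ext; simp
    rw [h1, h2, Multiset.filter_map]
    rfl
  by_cases hs : (List.ofFn α).sum = n
  · set μ := Nat.Partition.ofSums n (List.ofFn α : Multiset ℕ) (by simpa using hs)
    have hμ : μ.parts = α.support.val.map α := by rw [hα]; rfl
    rw [Finset.sum_eq_single μ]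
    · rw [if_pos hμ, kap_eq_of_parts]
      rw [hμ, hα]
    · intro ν _ hν
      rw [if_neg]
      intro h
      exact hν (Nat.Partition.ext (h.trans hμ.symm))
    · simp
  · rw [kap_eq_zero hf (by exact_mod_cast hs), Finset.sum_eq_zero]
    intro μ _
    rw [if_neg]
    intro h
    apply hs
    have h2 := congrArg Multiset.sum h
    rw [μ.parts_sum] at h2
    rw [h2, ← Multiset.sum_coe, hα]
    rw [sum_filter_ne_zero]

/-- The power sum monomial of a partition. -/
def pmon {n : ℕ} (μ : n.Partition) : ℕ+ →₀ ℕ :=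
  Finsupp.comapDomain PNat.val (Multiset.toFinsupp μ.parts) PNat.coe_injective.injOn

theorem pmon_injective {n : ℕ} : Function.Injective (pmon : n.Partition → ℕ+ →₀ ℕ) := by
  intro μ ν h
  ext k
  rcases Nat.eq_zero_or_pos k with rfl | hk
  · rw [Multiset.count_eq_zero_of_notMem, Multiset.count_eq_zero_of_notMem]
    · exact fun h => (ν.parts_pos h).ne rfl
    · exact fun h => (μ.parts_pos h).ne rfl
  · obtain ⟨k, rfl⟩ : ∃ k' : ℕ+, (k' : ℕ) = k := ⟨⟨k, hk⟩, rfl⟩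
    have := DFunLike.congr_fun h k
    simpa [pmon, Finsupp.comapDomain_apply] using this

theorem weight_pmon {n : ℕ} (μ : n.Partition) :
    Finsupp.weight (fun k : ℕ+ => ((k : ℕ) : ℤ)) (pmon μ) = n := by
  have h : μ.parts = (Finsupp.toMultiset (pmon μ)).map PNat.val := by
    ext k
    rcases Nat.eq_zero_or_pos k with rfl | hk
    · rw [Multiset.count_eq_zero_of_notMem, Multiset.count_eq_zero_of_notMem]
      · intro h
        obtain ⟨a, _, ha⟩ := Multiset.mem_map.1 h
        exact a.ne_zero ha
      · exact fun h => (μ.parts_pos h).ne rfl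
    · obtain ⟨k, rfl⟩ : ∃ k' : ℕ+, (k' : ℕ) = k := ⟨⟨k, hk⟩, rfl⟩
      have := Multiset.count_map_eq_count' PNat.val (Finsupp.toMultiset (pmon μ))
        PNat.coe_injective k
      rw [this, Finsupp.count_toMultiset]
      simp [pmon, Finsupp.comapDomain_apply]
  have h2 := congrArg Multiset.sum h
  rw [μ.parts_sum, Finset.sum_multiset_map_count] at h2
  rw [Finsupp.weight_apply, Finsupp.sum]
  conv_rhs => rw [h2]
  rw [Nat.cast_sum, Finsupp.toFinset_toMultiset]
  exact Finset.sum_congr rfl fun k _ => by rw [Finsupp.count_toMultiset]; simp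

open MacVertex in
/-- Every family of coefficients is realized by a symmetric function. -/
theorem exists_kap_rows {n : ℕ} (c : n.Partition → F) :
    ∃ f : MvPolynomial ℕ+ F, IsHom f n ∧ ∀ μ : n.Partition, kap (rows μ) f = c μ := by
  classical
  let e : (n.Partition → F) →ₗ[F] MvPolynomial ℕ+ F :=
    Fintype.linearCombination F fun ν : n.Partition => monomial (pmon ν) (1 : F)
  have he : ∀ c, e c = ∑ ν, c ν • monomial (pmon ν) (1 : F) :=
    fun c => Fintype.linearCombination_apply _ _ _
  have hom : ∀ c, IsHom (e c) n := by
    intro c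
    rw [he]
    refine IsWeightedHomogeneous.sum _ _ _ fun ν _ => isHom_smul _ ?_
    exact isWeightedHomogeneous_monomial _ _ _ (weight_pmon ν)
  let Φ : (n.Partition → F) →ₗ[F] (n.Partition → F) :=
    (LinearMap.pi fun μ => kap (rows μ)) ∘ₗ e
  -- Power-sum monomials of degree n are indexed by the same partitions as the coefficients, so
  -- injectivity of this endomorphism already gives surjectivity.
  have hΦ : Function.Injective Φ := by
    rw [← LinearMap.ker_eq_bot, LinearMap.ker_eq_bot']
    intro c hc
    have h0 : e c = 0 := eq_zero_of_kap_rows (hom c) fun μ => congrFun hc μ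
    funext μ
    have := congrArg (coeff (pmon μ)) h0
    rw [he, coeff_sum] at this
    simpa [coeff_monomial, pmon_injective.eq_iff] using this
  obtain ⟨c', hc'⟩ := (LinearMap.injective_iff_surjective.1 hΦ) c
  exact ⟨e c', hom c', fun μ => congrFun hc' μ⟩

end Expansion

end MacFock

namespace MacFock
open MvPolynomial

/-! ### Exponents and the dominance order -/

section Lists

theorem sum_le_sum_take {l : List ℕ} (hl : l.Pairwise (· ≥ ·)) {k : ℕ} {s : Multiset ℕ}
    (hs : s ≤ (l : Multiset ℕ)) (hk : s.card ≤ k) : s.sum ≤ (l.take k).sum := by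
  induction l generalizing k s with
  | nil =>
    have : s = 0 := by simpa using hs
    simp [this]
  | cons a l ih =>
    rw [List.pairwise_cons] at hl
    rw [← Multiset.cons_coe] at hs
    cases k with
    | zero =>
      have : s = 0 := by simpa using hk
      simp [this]
    | succ k =>
      rw [List.take_succ_cons, List.sum_cons]
      by_cases ha : a ∈ s
      · obtain ⟨s', rfl⟩ := Multiset.exists_cons_of_mem ha
        rw [Multiset.cons_le_cons_iff] at hs
        rw [Multiset.sum_cons]
        rw [Multiset.card_cons] at hk
        exact Nat.add_le_add_left (ih hl.2 hs (by omega)) a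
      · rw [Multiset.le_cons_of_notMem ha] at hs
        rcases s.empty_or_exists_mem with rfl | ⟨b, hb⟩
        · simp
        · obtain ⟨s', rfl⟩ := Multiset.exists_cons_of_mem hb
          have hb' : b ≤ a := hl.1 b (by simpa using Multiset.mem_of_le hs hb)
          rw [Multiset.sum_cons]
          rw [Multiset.card_cons] at hk
          exact Nat.add_le_add hb'
            (ih hl.2 ((Multiset.le_cons_self s' b).trans hs) (by omega))

/-- The exponent of a monomial in `N` variables given by a list. -/
def expo (N : ℕ) (l : List ℕ) : Fin N →₀ ℕ := Finsupp.equivFunOnFinite.symm fun i => l.getD i 0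

theorem expo_apply (N : ℕ) (l : List ℕ) (i : Fin N) : expo N l i = l.getD i 0 := rfl

theorem ofFn_expo {N : ℕ} {l : List ℕ} (hl : l.length ≤ N) :
    List.ofFn (expo N l) = l ++ List.replicate (N - l.length) 0 := by
  apply List.ext_getElem
  · simp; omega
  · intro i h1 h2
    rw [List.getElem_ofFn, expo_apply, List.getElem_append]
    split_ifs with h
    · simp [h]
    · simp [not_lt.1 h]

theorem pre_eq_sum_take {N : ℕ} (k : ℕ) (α : Fin N →₀ ℕ) :
    pre k α = ((List.ofFn α).take k).sum := by
  rw [List.sum_take_ofFn]; rfl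

theorem pre_expo {N : ℕ} {l : List ℕ} (hl : l.length ≤ N) (k : ℕ) :
    pre k (expo N l) = (l.take k).sum := by
  rw [pre_eq_sum_take, ofFn_expo hl, List.take_append, List.sum_append, List.take_replicate,
    List.sum_replicate]
  simp

end Lists

section Dominance
open MacVertex

theorem rows_pos {n : ℕ} (μ : n.Partition) {m : ℕ} (hm : m ∈ rows μ) : 0 < m := by
  apply μ.parts_pos
  rwa [← coe_rows, Multiset.mem_coe]

theorem rows_pairwise {n : ℕ} (μ : n.Partition) : (rows μ).Pairwise (· ≥ ·) :=
  Multiset.pairwise_sort μ.parts (· ≥ ·)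

theorem length_rows_le {n : ℕ} (μ : n.Partition) : (rows μ).length ≤ n := by
  have h : ∀ l : List ℕ, (∀ m ∈ l, 0 < m) → l.length ≤ l.sum := by
    intro l hl
    induction l with
    | nil => simp
    | cons a l ih =>
      rw [List.length_cons, List.sum_cons]
      have h1 := hl a (by simp)
      have h2 := ih fun m hm => hl m (by simp [hm])
      omega
  have := h (rows μ) fun m hm => rows_pos μ hm
  rwa [sum_rows] at this

theorem rows_injective {n : ℕ} : Function.Injective (rows : n.Partition → List ℕ) := by
  intro μ ν h
  ext1
  rw [← coe_rows, h, coe_rows]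

theorem expo_injOn {N : ℕ} {l l' : List ℕ} (hl : l.length ≤ N) (hl' : l'.length ≤ N)
    (hp : ∀ m ∈ l, 0 < m) (hp' : ∀ m ∈ l', 0 < m) (h : expo N l = expo N l') : l = l' := by
  have h1 : ∀ {l : List ℕ}, l.length ≤ N → (∀ m ∈ l, 0 < m) →
      (List.ofFn (expo N l)).filter (· ≠ 0) = l := by
    intro l hl hp
    rw [ofFn_expo hl, List.filter_append, List.filter_eq_self.2, List.filter_eq_nil_iff.2,
      List.append_nil]
    · intro a ha; simp [List.eq_of_mem_replicate ha]
    · intro a ha; simpa using (hp a ha).ne'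
  rw [← h1 hl hp, h, h1 hl' hp']

theorem DomLE.refl {n : ℕ} (μ : n.Partition) : DomLE μ μ := fun _ => le_rfl

theorem DomLE.trans {n : ℕ} {μ ν ρ : n.Partition} (h : DomLE μ ν) (h' : DomLE ν ρ) : DomLE μ ρ :=
  fun k => (h k).trans (h' k)

/-- A rank function for the dominance order. -/
def domRank {n : ℕ} (μ : n.Partition) : ℕ := ∑ k ∈ Finset.range (n + 1), ((rows μ).take k).sum

theorem domRank_lt {n : ℕ} {μ ν : n.Partition} (h : DomLE μ ν) (hne : μ ≠ ν) :
    domRank μ < domRank ν := by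
  refine lt_of_le_of_ne (Finset.sum_le_sum fun k _ => h k) fun he => hne ?_
  have h1 := (Finset.sum_eq_sum_iff_of_le fun k _ => h k).1 he
  apply rows_injective
  refine expo_injOn (length_rows_le μ) (length_rows_le ν) (fun m => rows_pos μ)
    (fun m => rows_pos ν) (eq_of_pre_eq fun k => ?_)
  rw [pre_expo (length_rows_le μ), pre_expo (length_rows_le ν)]
  rcases Nat.lt_or_ge k (n + 1) with hk | hk
  · exact h1 k (Finset.mem_range.2 hk)
  · rw [List.take_of_length_le ((length_rows_le μ).trans (by omega)),
      List.take_of_length_le ((length_rows_le ν).trans (by omega)), sum_rows, sum_rows]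

variable {F : Type*} [Field F] [CharZero F]

theorem coeff_expo_tv {N : ℕ} {l : List ℕ} (hl : l.length ≤ N) (f : MvPolynomial ℕ+ F) :
    coeff (expo N l) (tv N f) = kap l f := by
  rw [coeff_tv, ofFn_expo hl, ← kap_filter, ← kap_filter l, List.filter_append,
    (List.filter_eq_nil_iff (l := List.replicate _ _)).2
      (fun a ha => by simp [List.eq_of_mem_replicate ha]), List.append_nil]

/-- Sorting an exponent into decreasing order can only increase its partial sums, so a bound on the
sorted exponents bounds every monomial. -/
theorem preBdd_tv {n : ℕ} {f : MvPolynomial ℕ+ F} (hf : IsHom f n) {lam : n.Partition}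
    (h : ∀ μ : n.Partition, kap (rows μ) f ≠ 0 → DomLE μ lam) (N : ℕ) :
    PreBdd (fun k => ((rows lam).take k).sum) (tv N f) := by
  intro α hα k
  rw [coeff_tv] at hα
  have hs : (List.ofFn α).sum = n := by
    by_contra hs
    exact hα (kap_eq_zero hf (by exact_mod_cast hs))
  set μ := Nat.Partition.ofSums n (List.ofFn α : Multiset ℕ) (by simpa using hs)
  have hμ : μ.parts = ((List.ofFn α : List ℕ) : Multiset ℕ).filter (· ≠ 0) := rfl
  rw [kap_eq_of_parts hμ] at hα
  refine le_trans ?_ (h μ hα k)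
  rw [pre_eq_sum_take]
  have h2 : (((List.ofFn α).take k : List ℕ) : Multiset ℕ).filter (· ≠ 0) ≤
      ((rows μ : List ℕ) : Multiset ℕ) := by
    rw [coe_rows, hμ]
    exact Multiset.filter_le_filter _ (List.take_sublist k _).subperm
  have h3 := sum_le_sum_take (k := k) (rows_pairwise μ) h2
    ((Multiset.card_le_card (Multiset.filter_le _ _)).trans (by simp))
  rwa [sum_filter_ne_zero, Multiset.sum_coe] at h3

theorem domLE_of_preBdd {n : ℕ} {f : MvPolynomial ℕ+ F} {lam : n.Partition}
    (h : PreBdd (fun k => ((rows lam).take k).sum) (tv n f)) {μ : n.Partition}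
    (hμ : kap (rows μ) f ≠ 0) : DomLE μ lam := by
  intro k
  rw [← coeff_expo_tv (length_rows_le μ)] at hμ
  have := h _ hμ k
  rwa [pre_expo (length_rows_le μ)] at this

end Dominance

/-! ### Triangular operators -/

/-- The eigenvector is the basis vector at `lam` plus a correction strictly below it. The correction
solves a linear system that is triangular with diagonal entries e μ - e lam ≠ 0. -/
theorem exists_triangular_eigenvector {F ι : Type*} [Field F] [Fintype ι] [DecidableEq ι]
    (r : ι → ι → Prop) (hrefl : ∀ μ, r μ μ) (htrans : ∀ {a b c}, r a b → r b c → r a c)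
    (ρ : ι → ℕ) (hρ : ∀ {μ ν}, r μ ν → μ ≠ ν → ρ μ < ρ ν)
    (T : (ι → F) →ₗ[F] (ι → F)) (hT : ∀ μ ν, T (Pi.single ν 1) μ ≠ 0 → r μ ν)
    (e : ι → F) (he : Function.Injective e) (hTe : ∀ ν, T (Pi.single ν 1) ν = e ν) (lam : ι) :
    ∃ c : ι → F, c lam = 1 ∧ (∀ μ, c μ ≠ 0 → r μ lam) ∧ T c = e lam • c := by
  classical
  have hsum : ∀ c μ, T c μ = ∑ ν, c ν * T (Pi.single ν 1) μ := by
    intro c μ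
    conv_lhs => rw [pi_eq_sum_univ' c, map_sum]
    simp
  have hzero : ∀ c : ι → F, (∀ μ, ¬ (r μ lam ∧ μ ≠ lam) → c μ = 0) →
      ∀ μ, ¬ (r μ lam ∧ μ ≠ lam) → T c μ = 0 := by
    intro c hc μ hμ
    rw [hsum]
    refine Finset.sum_eq_zero fun ν _ => ?_
    by_contra h
    have h1 := hT μ ν (right_ne_zero_of_mul h)
    have h2 : r ν lam ∧ ν ≠ lam := by
      by_contra h'
      exact left_ne_zero_of_mul h (hc ν h')
    refine hμ ⟨htrans h1 h2.1, fun h3 => ?_⟩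
    subst h3
    have h4 := hρ h1 h2.2.symm
    have h5 := hρ h2.1 h2.2
    omega
  -- Outside the indices strictly below `lam` the map S is the identity, so a solution with
  -- right-hand side zero there vanishes there. This keeps the system on the whole index set.
  let S : (ι → F) →ₗ[F] (ι → F) :=
    { toFun := fun c μ => if r μ lam ∧ μ ≠ lam then T c μ - e lam * c μ else c μ
      map_add' := by
        intro c c'; funext μ
        simp only [map_add, Pi.add_apply]
        split_ifs <;> ring
      map_smul' := by
        intro a c; funext μ
        simp only [map_smul, Pi.smul_apply, smul_eq_mul, RingHom.id_apply]
        split_ifs <;> ring }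
  have hS : ∀ c μ, S c μ = if r μ lam ∧ μ ≠ lam then T c μ - e lam * c μ else c μ :=
    fun _ _ => rfl
  have hinj : Function.Injective S := by
    rw [← LinearMap.ker_eq_bot, LinearMap.ker_eq_bot']
    intro c hc
    by_contra hc0
    have hne : (Finset.univ.filter fun μ => c μ ≠ 0).Nonempty := by
      by_contra h
      rw [Finset.not_nonempty_iff_eq_empty, Finset.filter_eq_empty_iff] at h
      exact hc0 (funext fun μ => by simpa using h (Finset.mem_univ μ))
    obtain ⟨μ, hμ, hmax⟩ := Finset.exists_max_image _ ρ hne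
    simp only [Finset.mem_filter, Finset.mem_univ, true_and] at hμ hmax
    have h1 := congrFun hc μ
    rw [hS] at h1
    split_ifs at h1 with h2
    · rw [hsum, Finset.sum_eq_single μ, hTe] at h1
      · have : (e μ - e lam) * c μ = 0 := by
          rw [Pi.zero_apply] at h1; linear_combination h1
        rcases mul_eq_zero.1 this with h3 | h3
        · exact h2.2 (he (sub_eq_zero.1 h3))
        · exact hμ h3
      · intro ν _ hν
        by_contra h
        have h3 := hρ (hT μ ν (right_ne_zero_of_mul h)) hν.symm
        have h4 := hmax ν (left_ne_zero_of_mul h)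
        omega
      · simp
    · exact hμ h1
  obtain ⟨c, hc⟩ := (LinearMap.injective_iff_surjective.1 hinj)
    (fun μ => if r μ lam ∧ μ ≠ lam then -(T (Pi.single lam 1) μ) else 0)
  have hc1 : ∀ μ, ¬ (r μ lam ∧ μ ≠ lam) → c μ = 0 := by
    intro μ hμ
    have := congrFun hc μ
    rwa [hS, if_neg hμ, if_neg hμ] at this
  have hcl : c lam = 0 := hc1 lam (by simp)
  refine ⟨c + Pi.single lam 1, by simp [hcl], ?_, ?_⟩
  · intro μ hμ
    by_cases h : μ = lam
    · rw [h]; exact hrefl lam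
    · by_contra h'
      rw [Pi.add_apply, hc1 μ (by tauto), Pi.single_eq_of_ne h] at hμ
      simp at hμ
  · funext μ
    rw [map_add, Pi.add_apply, Pi.smul_apply, Pi.add_apply, smul_eq_mul]
    by_cases h : r μ lam ∧ μ ≠ lam
    · have := congrFun hc μ
      rw [hS, if_pos h, if_pos h] at this
      rw [Pi.single_eq_of_ne h.2]
      linear_combination this
    · rw [hzero c hc1 μ h, hc1 μ h]
      by_cases hl : μ = lam
      · subst hl
        rw [hTe, Pi.single_eq_same]; ring
      · rw [Pi.single_eq_of_ne hl]
        have : T (Pi.single lam 1) μ = 0 := by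
          by_contra h'
          exact h ⟨hT _ _ h', hl⟩
        rw [this]; ring

end MacFock

namespace MacFock
open MvPolynomial

/-! ### Generic parameters -/

section Generic
variable {F : Type*} [Field F]

/-- The parameters `q` and `t` are generic: the Laurent monomials are linearly independent. -/
def Generic (q t : F) : Prop := LinearIndependent ℤ fun p : ℤ × ℤ => q ^ p.1 * t ^ p.2

/-- The value of an integral Laurent polynomial in `q` and `t`. -/
def laurentVal (q t : F) : (ℤ × ℤ →₀ ℤ) →ₗ[ℤ] F :=
  Finsupp.linearCombination ℤ fun p : ℤ × ℤ => q ^ p.1 * t ^ p.2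

theorem laurentVal_single (q t : F) (p : ℤ × ℤ) (n : ℤ) :
    laurentVal q t (Finsupp.single p n) = n * (q ^ p.1 * t ^ p.2) := by
  rw [laurentVal, Finsupp.linearCombination_single, zsmul_eq_mul]

variable {q t : F} (h : Generic q t)
include h

theorem Generic.injective : Function.Injective (laurentVal q t) := h

theorem Generic.zpow_ne_zero (a b : ℤ) : q ^ a * t ^ b ≠ 0 := LinearIndependent.ne_zero (a, b) h

theorem Generic.q_ne_zero : q ≠ 0 := by
  have := h.zpow_ne_zero 1 0
  simpa using this

theorem Generic.t_ne_zero : t ≠ 0 := by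
  have := h.zpow_ne_zero 0 1
  simpa using this

theorem Generic.zpow_inj {a b c d : ℤ} (he : q ^ a * t ^ b = q ^ c * t ^ d) : a = c ∧ b = d := by
  have : Nontrivial ℤ := inferInstance
  have := (LinearIndependent.injective h) (a₁ := (a, b)) (a₂ := (c, d)) he
  simpa using this

theorem Generic.pow_mul_pow_ne_one {a b : ℕ} (hab : a ≠ 0 ∨ b ≠ 0) : q ^ a * t ^ b ≠ 1 := by
  intro he
  have := h.zpow_inj (a := a) (b := b) (c := 0) (d := 0) (by simpa using he)
  omega

theorem Generic.q_pow_ne_one (k : ℕ+) : q ^ (k : ℕ) ≠ 1 := by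
  have := h.pow_mul_pow_ne_one (a := k) (b := 0) (Or.inl k.ne_zero)
  simpa using this

theorem Generic.t_pow_ne_one (k : ℕ+) : t ^ (k : ℕ) ≠ 1 := by
  have := h.pow_mul_pow_ne_one (a := 0) (b := k) (Or.inr k.ne_zero)
  simpa using this

theorem Generic.q_ne_one : q ≠ 1 := by simpa using h.q_pow_ne_one 1

theorem Generic.t_ne_one : t ≠ 1 := by simpa using h.t_pow_ne_one 1

theorem Generic.one_sub_inv_ne_zero : 1 - t⁻¹ ≠ 0 := by
  rw [sub_ne_zero, ne_comm, Ne, inv_eq_one]; exact h.t_ne_one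

theorem Generic.one_sub_ne_zero : 1 - q ≠ 0 := sub_ne_zero.2 h.q_ne_one.symm

theorem Generic.q_ne_t : q ≠ t := by
  intro he
  have := h.zpow_inj (a := 1) (b := 0) (c := 0) (d := 1) (by simpa using he)
  omega

theorem Generic.inv : Generic q⁻¹ t⁻¹ := by
  have h1 : (fun p : ℤ × ℤ => q⁻¹ ^ p.1 * t⁻¹ ^ p.2) =
      (fun p : ℤ × ℤ => q ^ p.1 * t ^ p.2) ∘ fun p => -p := by
    funext p; simp
  rw [Generic, h1]
  exact LinearIndependent.comp h _ neg_injective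

/-- The power of t⁻¹ records the position i and the power of q the exponent there, so the sum
determines the ordered exponent vector, not merely its rearrangement class. -/
theorem Generic.exponent_eq {N : ℕ} {α β : Fin N →₀ ℕ}
    (he : ∑ i : Fin N, t⁻¹ ^ i.val * q ^ α i = ∑ i : Fin N, t⁻¹ ^ i.val * q ^ β i) : α = β := by
  have hv : ∀ α : Fin N →₀ ℕ, ∑ i : Fin N, t⁻¹ ^ i.val * q ^ α i =
      laurentVal q t (∑ i : Fin N, Finsupp.single ((α i : ℤ), -(i.val : ℤ)) 1) := by
    intro α
    rw [map_sum]
    refine Finset.sum_congr rfl fun i _ => ?_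
    rw [laurentVal_single]
    simp [mul_comm]
  rw [hv, hv] at he
  have h1 := h.injective he
  ext i
  have h2 := DFunLike.congr_fun h1 ((α i : ℤ), -(i.val : ℤ))
  simp only [Finsupp.coe_finsetSum, Finset.sum_apply, Finsupp.single_apply, Prod.mk.injEq,
    neg_inj, Nat.cast_inj, Fin.val_inj] at h2
  rw [Finset.sum_eq_single i (by intro b _ hb; simp [hb]) (by simp),
    Finset.sum_eq_single i (by intro b _ hb; simp [hb]) (by simp), if_pos ⟨rfl, rfl⟩] at h2
  by_contra hne
  rw [if_neg (by rintro ⟨h3, _⟩; exact hne h3.symm)] at h2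
  exact one_ne_zero h2

end Generic

/-! ### Eigenvectors in finitely many variables -/

section Eigen
variable {F : Type*} [Field F] [CharZero F] {N : ℕ}

/-- `g` is an eigenvector of the Macdonald difference operator in `N` variables. -/
def IsEig (q t e : F) (g : MvPolynomial (Fin N) F) : Prop :=
  C e * (discD F N * g) = C (t⁻¹ ^ N) * (discD F N * g) +
    C (1 - t⁻¹) * ∑ i, discDi t⁻¹ i * scaleVar q i g

theorem isEig_tv {q t e : F} {f : MvPolynomial ℕ+ F} (hf : mac q t 0 f = C e * f) :
    IsEig q t e (tv N f) := by
  have h1 : tv N (C e) = C e := by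
    rw [← algebraMap_eq, AlgHom.commutes, algebraMap_eq]
  rw [IsEig, ← discD_mul_tv_mac, hf, map_mul, h1]
  ring

theorem IsEig.sub {q t e : F} {g g' : MvPolynomial (Fin N) F} (h : IsEig q t e g)
    (h' : IsEig q t e g') : IsEig q t e (g - g') := by
  rw [IsEig] at *
  simp only [map_sub (scaleVar q _), mul_sub, Finset.sum_sub_distrib]
  rw [h, h']
  ring

/-- The eigenvalue at the monomial `x^α`. -/
def eigVal (q t : F) (α : Fin N →₀ ℕ) : F :=
  t⁻¹ ^ N + (1 - t⁻¹) * ∑ i : Fin N, t⁻¹ ^ i.val * q ^ α i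

theorem IsEig.exists_exponent {q t e : F} {g : MvPolynomial (Fin N) F} (h : IsEig q t e g)
    (hg : g ≠ 0) : ∃ α, coeff α g ≠ 0 ∧ e = eigVal q t α := by
  classical
  -- An exponent with the largest total of partial sums is maximal for the comparison of partial
  -- sums. Its product with the dominant monomial δ arises in only one way, and g need not be
  -- symmetric.
  obtain ⟨α, hα, hmax⟩ := Finset.exists_max_image g.support
    (fun m => ∑ k ∈ Finset.range (N + 1), pre k m)
    (Finset.nonempty_iff_ne_empty.2 fun h0 => hg (by simpa using h0))
  have hα' : coeff α g ≠ 0 := mem_support_iff.1 hα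
  refine ⟨α, hα', ?_⟩
  obtain ⟨δ, c, hc, h1, h2⟩ := exists_lead_discD (F := F) (N := N)
  have key : ∀ (f g' : MvPolynomial (Fin N) F) (c' : F), Lead f δ c' →
      (∀ m, coeff m g' ≠ 0 → coeff m g ≠ 0) →
      coeff (δ + α) (f * g') = c' * coeff α g' := by
    intro f g' c' hf hg'
    rw [coeff_mul, Finset.sum_eq_single_of_mem (δ, α) (by simp), hf.2]
    rintro ⟨m1, m2⟩ hm hne
    rw [Finset.HasAntidiagonal.mem_antidiagonal] at hm
    simp only at hm ⊢
    by_contra h0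
    apply hne
    have h3 : ∀ k, pre k m1 ≤ pre k δ := hf.1 m1 (left_ne_zero_of_mul h0)
    have h4 : ∀ k, pre k m1 + pre k m2 = pre k δ + pre k α := by
      intro k; rw [← pre_add, ← pre_add, hm]
    have h5 : ∀ k, pre k α ≤ pre k m2 := fun k => by have := h3 k; have := h4 k; omega
    have h6 := hmax m2 (mem_support_iff.2 (hg' _ (right_ne_zero_of_mul h0)))
    have h7 := (Finset.sum_eq_sum_iff_of_le fun k _ => h5 k).1
      (le_antisymm (Finset.sum_le_sum fun k _ => h5 k) h6)
    have h8 : α = m2 := by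
      ext i
      have e1 := h7 (i.val + 1) (Finset.mem_range.2 (by omega))
      have e2 := h7 i.val (Finset.mem_range.2 (by omega))
      rw [pre_succ, pre_succ] at e1
      omega
    subst h8
    rw [add_right_cancel hm]
  have h3 := congrArg (coeff (δ + α)) h
  rw [coeff_C_mul, coeff_add, coeff_C_mul, coeff_C_mul, coeff_sum,
    key _ _ _ h1 (fun _ h => h)] at h3
  have h4 : ∀ i, coeff (δ + α) (discDi t⁻¹ i * scaleVar q i g) =
      t⁻¹ ^ i.val * c * (q ^ α i * coeff α g) := by
    intro i
    rw [key _ _ _ (h2 t⁻¹ i), coeff_scaleVar]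
    intro m hm
    rw [coeff_scaleVar] at hm
    exact right_ne_zero_of_mul hm
  simp only [h4] at h3
  have h5 : (c * coeff α g) ≠ 0 := mul_ne_zero hc hα'
  apply mul_right_cancel₀ h5
  rw [h3, eigVal, add_mul, mul_assoc, Finset.sum_mul]
  congr 2
  exact Finset.sum_congr rfl fun i _ => by ring

/-- A nonzero eigenvector contains a monomial whose exponent is determined by the eigenvalue, hence
x^α itself. Eigenvectors are thus identified by one coefficient, even when they are not known to
come from symmetric functions. -/
theorem IsEig.eq_zero {q t : F} (hqt : Generic q t) {α : Fin N →₀ ℕ}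
    {g : MvPolynomial (Fin N) F} (h : IsEig q t (eigVal q t α) g) (hα : coeff α g = 0) : g = 0 := by
  by_contra hg
  obtain ⟨β, hβ, he⟩ := h.exists_exponent hg
  have h1 := hqt.one_sub_inv_ne_zero
  rw [eigVal, eigVal, add_right_inj] at he
  rw [← hqt.exponent_eq (mul_left_cancel₀ h1 he)] at hβ
  exact hβ hα

end Eigen

/-! ### Macdonald polynomials -/

section Macdonald
open MacVertex
variable {F : Type*} [Field F] [CharZero F]

theorem mem_diagram {n : ℕ} (μ : n.Partition) (s : ℕ × ℕ) :
    s ∈ (diagram μ).cells ↔ s.2 < (rows μ).getD s.1 0 := by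
  rw [YoungDiagram.mem_cells]
  refine (YoungDiagram.mem_ofRowLens (w := rows μ)).trans ?_
  constructor
  · rintro ⟨h, h'⟩
    simpa [h] using h'
  · intro h
    by_cases h' : s.1 < (rows μ).length
    · exact ⟨h', by simpa [h'] using h⟩
    · rw [List.getD_eq_default _ _ (not_lt.1 h')] at h
      omega

/-- The content `q^{a'} t^{-l'}` of a box. -/
def content (q t : F) (s : ℕ × ℕ) : F := q ^ s.2 * t⁻¹ ^ s.1

/-- The eigenvalue of the Macdonald operator. -/
def eig (q t : F) {n : ℕ} (μ : n.Partition) : F :=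
  1 - (1 - t⁻¹) * (1 - q) * ∑ s ∈ (diagram μ).cells, content q t s

theorem sum_diagram {M : Type*} [AddCommMonoid M] {n N : ℕ} (μ : n.Partition)
    (hN : (rows μ).length ≤ N) (g : ℕ × ℕ → M) : ∑ s ∈ (diagram μ).cells, g s =
      ∑ i : Fin N, ∑ j ∈ Finset.range ((rows μ).getD i 0), g (i.val, j) := by
  rw [Finset.sum_finset_product (diagram μ).cells (Finset.range N)
    (fun i => Finset.range ((rows μ).getD i 0)), Finset.sum_range]
  intro p
  rw [mem_diagram, Finset.mem_range, Finset.mem_range]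
  constructor
  · intro h
    refine ⟨?_, h⟩
    by_contra h'
    rw [List.getD_eq_default _ _ (hN.trans (not_lt.1 h'))] at h
    omega
  · exact fun h => h.2

/-- Summing geometric series over the rows cancels the dependence on N and expresses the eigenvalue
through the contents of the boxes. -/
theorem eigVal_expo {q t : F} {n N : ℕ} (μ : n.Partition)
    (hN : (rows μ).length ≤ N) : eigVal q t (expo N (rows μ)) = eig q t μ := by
  rw [eigVal, eig, sum_diagram μ hN]
  have h1 : ∀ i : Fin N, (1 - q) * ∑ j ∈ Finset.range ((rows μ).getD i 0), content q t (i.val, j) =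
      t⁻¹ ^ i.val - t⁻¹ ^ i.val * q ^ (rows μ).getD i 0 := by
    intro i
    simp only [content]
    rw [← Finset.sum_mul]
    linear_combination t⁻¹ ^ i.val * mul_neg_geom_sum q ((rows μ).getD i 0)
  have h2 : (1 - t⁻¹) * ∑ i : Fin N, t⁻¹ ^ i.val = 1 - t⁻¹ ^ N := by
    rw [Fin.sum_univ_eq_sum_range (fun i => t⁻¹ ^ i), mul_neg_geom_sum]
  rw [mul_assoc, Finset.mul_sum (a := 1 - q), Finset.sum_congr rfl fun i _ => h1 i,
    Finset.sum_sub_distrib]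
  simp only [expo_apply]
  linear_combination h2

theorem Generic.eig_injective {q t : F} (h : Generic q t) {n : ℕ} :
    Function.Injective (eig q t : n.Partition → F) := by
  intro μ ν he
  have h1 := h.one_sub_inv_ne_zero
  rw [← eigVal_expo μ (length_rows_le μ),
    ← eigVal_expo ν (length_rows_le ν), eigVal, eigVal, add_right_inj] at he
  exact rows_injective (expo_injOn (length_rows_le μ) (length_rows_le ν) (fun m => rows_pos μ)
    (fun m => rows_pos ν) (h.exponent_eq (mul_left_cancel₀ h1 he)))

theorem kap_rows_mac {q t : F} {n : ℕ} {f : MvPolynomial ℕ+ F} (hf : IsHom f n)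
    {lam : n.Partition} (h : ∀ μ : n.Partition, kap (rows μ) f ≠ 0 → DomLE μ lam) :
    (∀ μ : n.Partition, kap (rows μ) (mac q t 0 f) ≠ 0 → DomLE μ lam) ∧
      kap (rows lam) (mac q t 0 f) = eig q t lam * kap (rows lam) f := by
  have h1 := preBdd_tv hf h n
  refine ⟨fun μ hμ => domLE_of_preBdd h1.tv_mac hμ, ?_⟩
  rw [← coeff_expo_tv (length_rows_le lam), coeff_tv_mac, coeff_expo_tv (length_rows_le lam),
    ← eigVal_expo lam (length_rows_le lam)]
  · rfl
  · simpa only [pre_expo (length_rows_le lam)] using h1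

theorem exists_macdonald {q t : F} (h : Generic q t) {n : ℕ} (lam : n.Partition) :
    ∃ f : MvPolynomial ℕ+ F, IsHom f n ∧ kap (rows lam) f = 1 ∧
      (∀ μ : n.Partition, kap (rows μ) f ≠ 0 → DomLE μ lam) ∧
      mac q t 0 f = C (eig q t lam) * f := by
  classical
  choose m hm hk using fun c : n.Partition → F => exists_kap_rows c
  have hinj : ∀ {f g : MvPolynomial ℕ+ F}, IsHom f n → IsHom g n →
      (∀ μ : n.Partition, kap (rows μ) f = kap (rows μ) g) → f = g := by
    intro f g hf hg hfg
    refine sub_eq_zero.1 (eq_zero_of_kap_rows (n := n) ?_ fun μ => by rw [map_sub, hfg, sub_self])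
    exact (weightedHomogeneousSubmodule F _ _).sub_mem hf hg
  let T : (n.Partition → F) →ₗ[F] (n.Partition → F) :=
    { toFun := fun c μ => kap (rows μ) (mac q t 0 (m c))
      map_add' := by
        intro c c'
        have : m (c + c') = m c + m c' :=
          hinj (hm _) ((hm c).add (hm c')) fun μ => by rw [map_add, hk, hk, hk]; rfl
        funext μ
        simp [this]
      map_smul' := by
        intro a c
        have : m (a • c) = a • m c :=
          hinj (hm _) (isHom_smul a (hm c)) fun μ => by rw [map_smul, hk, hk]; rfl
        funext μ
        simp [this] }
  have hsingle : ∀ ν : n.Partition, ∀ μ : n.Partition,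
      kap (rows μ) (m (Pi.single ν 1)) ≠ 0 → DomLE μ ν := by
    intro ν μ hμ
    rw [hk] at hμ
    by_cases he : μ = ν
    · rw [he]; exact DomLE.refl ν
    · rw [Pi.single_eq_of_ne he] at hμ; exact absurd rfl hμ
  obtain ⟨c, hc1, hc2, hc3⟩ := exists_triangular_eigenvector DomLE DomLE.refl
    (fun h h' => DomLE.trans h h') domRank (fun h h' => domRank_lt h h') T
    (fun μ ν hμ => (kap_rows_mac (hm _) (hsingle ν)).1 μ hμ) (eig q t) h.eig_injective
    (fun ν => by
      have := (kap_rows_mac (q := q) (t := t) (hm _) (hsingle ν)).2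
      rw [hk, Pi.single_eq_same, mul_one] at this
      exact this) lam
  refine ⟨m c, hm c, by rw [hk, hc1], fun μ hμ => hc2 μ (by rwa [hk] at hμ), ?_⟩
  rw [← smul_eq_C_mul]
  refine hinj (by simpa using (hm c).mac (q := q) (t := t) 0) (isHom_smul _ (hm c)) fun μ => ?_
  rw [map_smul, hk]
  exact congrFun hc3 μ

/-- The Macdonald polynomial, as an eigenvector of the Macdonald operator. -/
def macP {q t : F} (h : Generic q t) {n : ℕ} (lam : n.Partition) : MvPolynomial ℕ+ F :=
  (exists_macdonald h lam).choose

variable {q t : F} (h : Generic q t) {n : ℕ} (lam : n.Partition)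

theorem isHom_macP : IsHom (macP h lam) n := (exists_macdonald h lam).choose_spec.1

theorem kap_rows_macP : kap (rows lam) (macP h lam) = 1 :=
  (exists_macdonald h lam).choose_spec.2.1

theorem domLE_of_kap_macP {μ : n.Partition} (hμ : kap (rows μ) (macP h lam) ≠ 0) :
    DomLE μ lam := (exists_macdonald h lam).choose_spec.2.2.1 μ hμ

theorem mac_macP : mac q t 0 (macP h lam) = C (eig q t lam) * macP h lam :=
  (exists_macdonald h lam).choose_spec.2.2.2

theorem eq_zero_of_tv {n N : ℕ} (hN : n ≤ N) {f : MvPolynomial ℕ+ F} (hf : IsHom f n)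
    (h : tv N f = 0) : f = 0 :=
  eq_zero_of_kap_rows hf fun μ => by
    rw [← coeff_expo_tv ((length_rows_le μ).trans hN), h, coeff_zero]

/-- An eigenvector with the same eigenvalue as `P_λ` is a multiple of `P_λ`. -/
theorem eq_smul_macP {f : MvPolynomial ℕ+ F} (hf : IsHom f n)
    (he : mac q t 0 f = C (eig q t lam) * f) : f = C (kap (rows lam) f) * macP h lam := by
  have hh : IsHom (f - C (kap (rows lam) f) * macP h lam) n :=
    (weightedHomogeneousSubmodule F _ _).sub_mem hf ((isHom_macP h lam).C_mul _)
  refine sub_eq_zero.1 (eq_zero_of_tv le_rfl hh ?_)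
  refine IsEig.eq_zero h (α := expo n (rows lam)) ?_ ?_
  · rw [eigVal_expo lam (length_rows_le lam)]
    apply isEig_tv
    rw [map_sub, he, ← smul_eq_C_mul (macP h lam), map_smul, mac_macP, smul_eq_C_mul,
      smul_eq_C_mul]
    ring
  · rw [coeff_expo_tv (length_rows_le lam), map_sub, ← smul_eq_C_mul, map_smul, kap_rows_macP]
    simp

/-- Within one degree this is self-adjointness with distinct eigenvalues; different degrees are
orthogonal by the grading. -/
theorem form_macP {m : ℕ} {lam : n.Partition} {μ : m.Partition}
    (hne : (⟨n, lam⟩ : Ptn) ≠ ⟨m, μ⟩) : form (bM q t) (macP h lam) (macP h μ) = 0 := by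
  by_cases hmn : n = m
  · subst hmn
    have h1 := form_mac_comm (q := q) h.t_ne_zero h.t_pow_ne_one (macP h lam) (macP h μ)
    rw [mac_macP, mac_macP, ← smul_eq_C_mul, ← smul_eq_C_mul, map_smul, map_smul,
      LinearMap.smul_apply, smul_eq_mul, smul_eq_mul] at h1
    have h2 : (eig q t lam - eig q t μ) * form (bM q t) (macP h lam) (macP h μ) = 0 := by
      rw [sub_mul, h1, sub_self]
    refine (mul_eq_zero.1 h2).resolve_left fun h3 => hne ?_
    rw [h.eig_injective (sub_eq_zero.1 h3)]
  · exact form_eq_zero_of_isHom _ (isHom_macP h lam) (isHom_macP h μ) (by exact_mod_cast hmn)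

/-- The Macdonald polynomials form a basis of the homogeneous symmetric functions. -/
theorem exists_eq_sum_macP {f : MvPolynomial ℕ+ F} (hf : IsHom f n) :
    ∃ c : n.Partition → F, f = ∑ μ, C (c μ) * macP h μ := by
  classical
  let Φ : (n.Partition → F) →ₗ[F] (n.Partition → F) :=
    (LinearMap.pi fun μ => kap (rows μ)) ∘ₗ Fintype.linearCombination F fun μ => macP h μ
  have hΦ : ∀ c μ, Φ c μ = ∑ ν, c ν * kap (rows μ) (macP h ν) := by
    intro c μ
    simp [Φ, Fintype.linearCombination_apply]
  have hinj : Function.Injective Φ := by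
    rw [← LinearMap.ker_eq_bot, LinearMap.ker_eq_bot']
    intro c hc
    by_contra hc0
    have hne : (Finset.univ.filter fun μ => c μ ≠ 0).Nonempty := by
      by_contra h
      rw [Finset.not_nonempty_iff_eq_empty, Finset.filter_eq_empty_iff] at h
      exact hc0 (funext fun μ => by simpa using h (Finset.mem_univ μ))
    obtain ⟨μ, hμ, hmax⟩ := Finset.exists_max_image _ domRank hne
    simp only [Finset.mem_filter, Finset.mem_univ, true_and] at hμ hmax
    have h1 := congrFun hc μ
    rw [hΦ, Finset.sum_eq_single μ, kap_rows_macP, mul_one] at h1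
    · exact hμ h1
    · intro ν _ hν
      by_contra h0
      have h3 := domRank_lt (domLE_of_kap_macP h ν (right_ne_zero_of_mul h0)) hν.symm
      have h4 := hmax ν (left_ne_zero_of_mul h0)
      omega
    · simp
  obtain ⟨c, hc⟩ := (LinearMap.injective_iff_surjective.1 hinj) fun μ => kap (rows μ) f
  refine ⟨c, sub_eq_zero.1 (eq_zero_of_kap_rows (n := n) ?_ fun μ => ?_)⟩
  · refine (weightedHomogeneousSubmodule F _ _).sub_mem hf ?_
    exact IsWeightedHomogeneous.sum _ _ _ fun μ _ => (isHom_macP h μ).C_mul _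
  · rw [map_sub, map_sum, ← congrFun hc μ, hΦ, sub_eq_zero]
    exact Finset.sum_congr rfl fun ν _ => by rw [← smul_eq_C_mul, map_smul, smul_eq_mul]

end Macdonald

end MacFock

namespace MacFock
open MvPolynomial MacVertex

/-! ### The basis of Macdonald polynomials -/

section Basis
variable {F : Type*} [Field F] [CharZero F] {q t : F} (h : Generic q t)

include h in
theorem Generic.bM_ne_zero (k : ℕ+) : bM q t k ≠ 0 :=
  mul_ne_zero (by simp) (div_ne_zero (sub_ne_zero.2 (h.q_pow_ne_one k).symm)
    (sub_ne_zero.2 (h.t_pow_ne_one k).symm))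

/-- The norm of a Macdonald polynomial. -/
def macNorm {n : ℕ} (μ : n.Partition) : F := form (bM q t) (macP h μ) (macP h μ)

/-- If the norm vanished, P_μ would be orthogonal to the whole space, against the nondegeneracy of
the form. -/
theorem macNorm_ne_zero {n : ℕ} (μ : n.Partition) : macNorm h μ ≠ 0 := by
  intro h0
  have h1 : ∀ f : MvPolynomial ℕ+ F, IsHom f n → form (bM q t) f (macP h μ) = 0 := by
    intro f hf
    obtain ⟨c, rfl⟩ := exists_eq_sum_macP h hf
    rw [map_sum, LinearMap.sum_apply]
    refine Finset.sum_eq_zero fun ν _ => ?_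
    rw [← smul_eq_C_mul, map_smul, LinearMap.smul_apply]
    by_cases hν : ν = μ
    · rw [hν]; exact (congrArg _ h0).trans (smul_zero _)
    · rw [form_macP h (fun he => hν (by simpa using he)), smul_zero]
  have h2 : macP h μ = 0 := by
    refine eq_of_form_monomial h.bM_ne_zero fun s => ?_
    rw [map_zero]
    have hs : IsHom (monomial s (1 : F)) (Finsupp.weight (fun k : ℕ+ => ((k : ℕ) : ℤ)) s) :=
      isWeightedHomogeneous_monomial _ _ _ rfl
    by_cases hw : Finsupp.weight (fun k : ℕ+ => ((k : ℕ) : ℤ)) s = n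
    · exact h1 _ (hw ▸ hs)
    · exact form_eq_zero_of_isHom _ hs (isHom_macP h μ) hw
  have h3 := kap_rows_macP h μ
  rw [h2, map_zero] at h3
  exact zero_ne_one h3

theorem linearIndependent_macP :
    LinearIndependent F fun μ : Ptn => macP h μ.2 := by
  rw [linearIndependent_iff']
  intro s g hg μ hμ
  have h1 := congrArg (fun f => form (bM q t) f (macP h μ.2)) hg
  simp only [map_sum, map_smul, LinearMap.sum_apply, LinearMap.smul_apply, map_zero,
    LinearMap.zero_apply, smul_eq_mul] at h1
  rw [Finset.sum_eq_single μ (fun ν _ hν => by rw [form_macP h hν, mul_zero])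
    (fun h' => absurd hμ h')] at h1
  exact (mul_eq_zero.1 h1).resolve_right (macNorm_ne_zero h μ.2)

/-- The basis of Macdonald polynomials. -/
def macBasis : Module.Basis Ptn F (MvPolynomial ℕ+ F) :=
  Module.Basis.mk (linearIndependent_macP h) (by
    intro f _
    induction f using MvPolynomial.induction_on' with
    | add f g hf hg => exact add_mem (hf trivial) (hg trivial)
    | monomial s a =>
      obtain ⟨n, hn⟩ := Int.eq_ofNat_of_zero_le (weight_nonneg s)
      have hs : IsHom (monomial s a) n := isWeightedHomogeneous_monomial _ _ _ hn
      obtain ⟨c, hc⟩ := exists_eq_sum_macP h hs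
      rw [hc]
      refine Submodule.sum_mem _ fun ν _ => ?_
      rw [← smul_eq_C_mul]
      exact Submodule.smul_mem _ _ (Submodule.subset_span ⟨⟨n, ν⟩, rfl⟩))

theorem macBasis_apply {n : ℕ} (μ : n.Partition) : macBasis h ⟨n, μ⟩ = macP h μ := by
  rw [macBasis, Module.Basis.mk_apply]

/-- A linear combination of Macdonald polynomials. -/
def comb {n : ℕ} : (n.Partition → F) →ₗ[F] MvPolynomial ℕ+ F :=
  Fintype.linearCombination F fun μ => macP h μ

theorem comb_apply {n : ℕ} (c : n.Partition → F) : comb h c = ∑ μ, c μ • macP h μ :=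
  Fintype.linearCombination_apply _ _ _

theorem comb_injective {n : ℕ} : Function.Injective (comb h : (n.Partition → F) →ₗ[F] _) := by
  have h1 : LinearIndependent F fun μ : n.Partition => macP h μ :=
    (linearIndependent_macP h).comp (fun μ : n.Partition => (⟨n, μ⟩ : Ptn))
      (fun μ ν he => by simpa using he)
  exact h1.fintypeLinearCombination_injective

theorem exists_eq_comb {n : ℕ} {f : MvPolynomial ℕ+ F} (hf : IsHom f n) :
    ∃ c : n.Partition → F, f = comb h c := by
  obtain ⟨c, hc⟩ := exists_eq_sum_macP h hf
  exact ⟨c, by rw [hc, comb_apply]; simp only [smul_eq_C_mul]⟩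

theorem mac_comb {n : ℕ} (c : n.Partition → F) :
    mac q t 0 (comb h c) = comb h fun μ => eig q t μ * c μ := by
  rw [comb_apply, comb_apply, map_sum]
  exact Finset.sum_congr rfl fun μ _ => by
    rw [map_smul, mac_macP, ← smul_eq_C_mul, smul_smul, mul_comm]

theorem rows_zero (μ : Nat.Partition 0) : rows μ = [] := by
  have := length_rows_le μ
  exact List.eq_nil_of_length_eq_zero (by omega)

theorem macP_zero (μ : Nat.Partition 0) : macP h μ = 1 := by
  have h1 := IsHom.eq_C (f := macP h μ) (by simpa using isHom_macP h μ)
  have h2 := kap_rows_macP h μ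
  rw [rows_zero, kap_nil] at h2
  rw [h1, h2, map_one]

theorem card_diagram {n : ℕ} (μ : n.Partition) : (diagram μ).cells.card = n := by
  rw [Finset.card_eq_sum_ones, sum_diagram μ (length_rows_le μ)]
  simp only [Finset.sum_const, smul_eq_mul, mul_one, Finset.card_range]
  have h1 := congrArg List.sum (ofFn_expo (length_rows_le μ))
  rw [List.sum_ofFn, List.sum_append, sum_rows] at h1
  simpa [expo_apply] using h1

/-! ### The Pieri rule for `p_1` -/

include h in
-- Expanding the product gives a Laurent polynomial in independent q and t. Contents of distinct
-- boxes are distinct monomials, so the constant term counts coincidences: |A| - 2|A ∩ B| + |B| = 1.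
theorem Generic.card_add_card {A B : Finset (ℕ × ℕ)}
    (hAB : (∑ s ∈ A, content q t s - ∑ s ∈ B, content q t s) *
      (∑ s ∈ A, content q⁻¹ t⁻¹ s - ∑ s ∈ B, content q⁻¹ t⁻¹ s) = 1) :
    A.card + B.card = 2 * (A ∩ B).card + 1 := by
  classical
  let D : Finset (ℕ × ℕ) → Finset (ℕ × ℕ) → (ℤ × ℤ →₀ ℤ) := fun A B =>
    ∑ s ∈ A, ∑ s' ∈ B, Finsupp.single ((s.2 : ℤ) - s'.2, (s'.1 : ℤ) - s.1) 1
  have hq := h.q_ne_zero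
  have ht := h.t_ne_zero
  have h1 : ∀ A B, laurentVal q t (D A B) =
      (∑ s ∈ A, content q t s) * ∑ s ∈ B, content q⁻¹ t⁻¹ s := by
    intro A B
    rw [Finset.sum_mul_sum, map_sum]
    refine Finset.sum_congr rfl fun s _ => ?_
    rw [map_sum]
    refine Finset.sum_congr rfl fun s' _ => ?_
    rw [laurentVal_single, content, content, zpow_sub₀ hq, zpow_sub₀ ht]
    simp only [zpow_natCast, inv_pow, inv_inv]
    field_simp
    simp
  have h2 : ∀ A B, D A B (0, 0) = (A ∩ B).card := by
    intro A B
    simp only [D, Finsupp.coe_finsetSum, Finset.sum_apply, Finsupp.single_apply, Prod.mk.injEq]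
    have h3 : ∀ s s' : ℕ × ℕ, (((s.2 : ℤ) - s'.2 = 0 ∧ (s'.1 : ℤ) - s.1 = 0) ↔ s = s') := by
      intro s s'
      rw [Prod.ext_iff]
      omega
    simp only [h3, Finset.sum_ite_eq]
    rw [Finset.sum_ite_mem, Finset.sum_const]
    simp
  have h3 : laurentVal q t (D A A - D A B - D B A + D B B) =
      laurentVal q t (Finsupp.single (0, 0) 1) := by
    rw [map_add, map_sub, map_sub, h1, h1, h1, h1, laurentVal_single]
    simp only [Int.cast_one, zpow_zero, mul_one]
    rw [← hAB]
    ring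
  have h4 := DFunLike.congr_fun (h.injective h3) (0, 0)
  simp only [Finsupp.add_apply, Finsupp.sub_apply, h2, Finset.inter_self,
    Finsupp.single_eq_same, Finset.inter_comm B A] at h4
  omega

/-- F_0 commutes with E_0, whose eigenspaces in degree n are lines, so P_μ is an eigenvector of F_0;
the eigenvalue is read off from the dominant coefficient. -/
theorem mac_inv_macP {n : ℕ} (μ : n.Partition) :
    mac q⁻¹ t⁻¹ 0 (macP h μ) = C (eig q⁻¹ t⁻¹ μ) * macP h μ := by
  have hh : IsHom (mac q⁻¹ t⁻¹ 0 (macP h μ)) n := by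
    simpa using (isHom_macP h μ).mac (q := q⁻¹) (t := t⁻¹) 0
  rw [eq_smul_macP h μ hh, (kap_rows_mac (isHom_macP h μ)
    (fun ν hν => domLE_of_kap_macP h μ hν)).2, kap_rows_macP, mul_one]
  rw [mac_comm_zero h.q_ne_zero h.t_ne_zero h.q_ne_t (isHom_macP h μ), mac_macP,
    ← smul_eq_C_mul, map_smul, smul_eq_C_mul]

theorem mac_inv_comb {n : ℕ} (c : n.Partition → F) :
    mac q⁻¹ t⁻¹ 0 (comb h c) = comb h fun μ => eig q⁻¹ t⁻¹ μ * c μ := by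
  rw [comb_apply, comb_apply, map_sum]
  exact Finset.sum_congr rfl fun μ _ => by
    rw [map_smul, mac_inv_macP, ← smul_eq_C_mul, smul_smul, mul_comm]

/-- `p_1 P_μ` is a combination of the `P_λ` with `λ` obtained from `μ` by adding a box. -/
theorem exists_pieri {n : ℕ} (μ : n.Partition) : ∃ ψ : (n + 1).Partition → F,
    X 1 * macP h μ = comb h ψ ∧ ∀ lam, ψ lam ≠ 0 →
      ∃ s, s ∉ (diagram μ).cells ∧ (diagram lam).cells = insert s (diagram μ).cells := by
  classical
  have hq := h.q_ne_zero
  have ht := h.t_ne_zero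
  have hh : IsHom (X 1 * macP h μ) ((n + 1 : ℕ) : ℤ) := by
    have := (isHom_X (F := F) 1).mul (isHom_macP h μ)
    convert this using 1
    push_cast
    ring
  obtain ⟨ψ, hψ⟩ := exists_eq_comb h hh
  refine ⟨ψ, hψ, fun lam hlam => ?_⟩
  have h1 := mac_X_one_mul q⁻¹ t⁻¹ 0 (macP h μ)
  rw [mac_inv_macP, mul_left_comm, hψ, mac_inv_comb, zero_add, ← smul_eq_C_mul, ← smul_eq_C_mul,
    ← map_smul] at h1
  have h2 : (1 - q⁻¹) • mac q⁻¹ t⁻¹ 1 (macP h μ) =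
      comb h (eig q⁻¹ t⁻¹ μ • ψ - fun lam => eig q⁻¹ t⁻¹ lam * ψ lam) := by
    rw [map_sub, h1, sub_sub_cancel]
  have h3 := congrArg ((1 - q⁻¹) • ·) (mac_comm_one hq ht h.q_ne_t (isHom_macP h μ))
  simp only [smul_sub] at h3
  rw [← map_smul (mac q t 0), mac_macP, ← smul_eq_C_mul (macP h μ),
    map_smul (mac q⁻¹ t⁻¹ 1), smul_comm (1 - q⁻¹) (eig q t μ), h2, mac_comb, hψ, ← smul_eq_C_mul, ← map_smul, ← map_smul, ← map_smul, ← map_sub] at h3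
  have h4 := congrFun (comb_injective h h3) lam
  simp only [Pi.sub_apply, Pi.smul_apply, smul_eq_mul] at h4
  -- Up to the factor 1 - q⁻¹, F_1 P_μ is the commutator of F_0 and p_1 applied to P_μ. The
  -- coefficient of P_λ in the relation for [E_0, F_1] then gives this identity after cancelling
  -- ψ_λ.
  have h5 : (eig q t lam - eig q t μ) * (eig q⁻¹ t⁻¹ μ - eig q⁻¹ t⁻¹ lam) =
      (1 - q⁻¹) * ((1 - q) * (1 - t) ^ 2 / t) := by
    apply mul_right_cancel₀ hlam
    linear_combination h4
  have hq1 : 1 - q ≠ 0 := sub_ne_zero.2 h.q_ne_one.symm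
  have ht1 : 1 - t ≠ 0 := sub_ne_zero.2 h.t_ne_one.symm
  have h6 := h.card_add_card (A := (diagram lam).cells) (B := (diagram μ).cells) (by
    simp only [eig, inv_inv] at h5
    have h7 : (1 - q⁻¹) * ((1 - q) * (1 - t) ^ 2 / t) ≠ 0 := by
      refine mul_ne_zero h.inv.one_sub_ne_zero ?_
      exact div_ne_zero (mul_ne_zero hq1 (pow_ne_zero 2 ht1)) ht
    apply mul_left_cancel₀ h7
    rw [mul_one]
    refine Eq.trans ?_ h5
    field_simp
    ring)
  rw [card_diagram, card_diagram] at h6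
  -- The two diagrams have n + 1 and n boxes, so the count forces n common boxes, that is,
  -- inclusion.
  have h7 : (diagram lam).cells ∩ (diagram μ).cells = (diagram μ).cells :=
    Finset.eq_of_subset_of_card_le Finset.inter_subset_right (by rw [card_diagram]; omega)
  have h8 : (diagram μ).cells ⊆ (diagram lam).cells := Finset.inter_eq_right.1 h7
  obtain ⟨s, hs1, hs2⟩ := Finset.exists_eq_insert_iff.2
    ⟨h8, by rw [card_diagram, card_diagram]⟩
  exact ⟨s, hs1, hs2.symm⟩

/-! ### Evaluations -/

variable {L : Type*} [Field L] [CharZero L] [Algebra F L]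

/-- The evaluation of `P_μ` at `p_k ↦ 1 / (1 - t^k)`. -/
def macC {n : ℕ} (μ : n.Partition) : F := evxy t (1 : F) 0 (macP h μ)

theorem content_sub {n : ℕ} {μ : n.Partition} {lam : (n + 1).Partition} {s : ℕ × ℕ}
    (hs : s ∉ (diagram μ).cells) (hl : (diagram lam).cells = insert s (diagram μ).cells) :
    eig q t lam = eig q t μ - (1 - t⁻¹) * (1 - q) * content q t s := by
  rw [eig, eig, hl, Finset.sum_insert hs]
  ring

/-- The first three moments of the contents of the boxes in the Pieri rule. -/
theorem exists_pieri_moments {n : ℕ} (μ : n.Partition) :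
    ∃ (ψ : (n + 1).Partition → F) (d : (n + 1).Partition → F),
      X 1 * macP h μ = comb h ψ ∧
      mac q t 1 (macP h μ) = comb h (fun lam => (1 - t⁻¹) * (d lam * ψ lam)) ∧
      (∀ lam, ψ lam ≠ 0 → ∃ s, s ∉ (diagram μ).cells ∧
        (diagram lam).cells = insert s (diagram μ).cells ∧ d lam = content q t s) ∧
      ∑ lam, ψ lam * macC h lam = macC h μ / (1 - t) ∧
      ∑ lam, ψ lam * d lam * macC h lam = macC h μ / (1 - t) ∧
      (1 - t⁻¹) * ∑ lam, ψ lam * d lam ^ 2 * macC h lam = -(eig q t μ / t * macC h μ) := by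
  classical
  have hq := h.q_ne_zero
  have ht := h.t_ne_zero
  have hq1 : 1 - q ≠ 0 := sub_ne_zero.2 h.q_ne_one.symm
  have ht1 : 1 - t ≠ 0 := sub_ne_zero.2 h.t_ne_one.symm
  have hti := h.one_sub_inv_ne_zero
  obtain ⟨ψ, hψ, hsup⟩ := exists_pieri h μ
  -- The value 0 where ψ vanishes is immaterial, since d only occurs multiplied by ψ.
  let d : (n + 1).Partition → F := fun lam =>
    if hl : ψ lam ≠ 0 then content q t (hsup lam hl).choose else 0
  have hd : ∀ lam, ψ lam ≠ 0 → ∃ s, s ∉ (diagram μ).cells ∧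
      (diagram lam).cells = insert s (diagram μ).cells ∧ d lam = content q t s := by
    intro lam hl
    refine ⟨(hsup lam hl).choose, (hsup lam hl).choose_spec.1, (hsup lam hl).choose_spec.2, ?_⟩
    simp only [d, dif_pos hl]
  have he : ∀ lam, eig q t lam * ψ lam =
      (eig q t μ - (1 - t⁻¹) * (1 - q) * d lam) * ψ lam := by
    intro lam
    by_cases hl : ψ lam = 0
    · rw [hl]; ring
    · obtain ⟨s, h1, h2, h3⟩ := hd lam hl
      rw [h3, content_sub h1 h2]
  -- The commutator of E_0 with p_1 multiplies the coefficient of P_λ by the difference of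
  -- eigenvalues, which is a multiple of the content of the added box.
  have hE : mac q t 1 (macP h μ) = comb h (fun lam => (1 - t⁻¹) * (d lam * ψ lam)) := by
    have h1 := mac_X_one_mul q t 0 (macP h μ)
    rw [mac_macP, mul_left_comm, hψ, mac_comb, zero_add, ← smul_eq_C_mul, ← smul_eq_C_mul,
      ← map_smul] at h1
    have h2 : (1 - q) • mac q t 1 (macP h μ) =
        (1 - q) • comb h (fun lam => (1 - t⁻¹) * (d lam * ψ lam)) := by
      rw [← map_smul (comb h), eq_sub_of_add_eq (add_comm _ _ |>.trans (eq_sub_iff_add_eq.1 h1)),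
        ← map_sub]
      congr 1
      funext lam
      simp only [Pi.sub_apply, Pi.smul_apply, smul_eq_mul]
      rw [he]
      ring
    exact smul_right_injective _ hq1 h2
  have hev : ∀ c : (n + 1).Partition → F, evxy t (1 : F) 0 (comb h c) =
      ∑ lam, c lam * macC h lam := by
    intro c
    rw [comb_apply, map_sum]
    exact Finset.sum_congr rfl fun lam _ => by rw [map_smul, smul_eq_mul, macC]
  have hS0 : ∑ lam, ψ lam * macC h lam = macC h μ / (1 - t) := by
    rw [← hev, ← hψ, evxy_X_one_mul, macC]
    simp
    ring
  have hS1 : ∑ lam, ψ lam * d lam * macC h lam = macC h μ / (1 - t) := by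
    have h1 := congrArg (evxy t (1 : F) 0) hE
    rw [evxy_mac_one ht h.t_pow_ne_one, hev] at h1
    apply mul_left_cancel₀ hti
    rw [Finset.mul_sum]
    have h2 : ∀ lam, (1 - t⁻¹) * (ψ lam * d lam * macC h lam) =
        (1 - t⁻¹) * (d lam * ψ lam) * macC h lam := fun lam => by ring
    simp only [h2]
    rw [← h1, ← macC]
    simp only [Algebra.algebraMap_self, RingHom.id_apply]
    field_simp
    ring
  refine ⟨ψ, d, hψ, hE, hd, hS0, hS1, ?_⟩
  -- Applying E_0 after E_1 brings in the eigenvalue of λ, which is linear in d, and so yields the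
  -- second moment.
  have h1 := evxy_mac_zero_mac_one (q := q) ht h.t_pow_ne_one (macP h μ)
  rw [hE, mac_comb, hev, mac_macP, ← smul_eq_C_mul, map_smul, ← macC, smul_eq_mul] at h1
  have h2 : ∑ lam, eig q t lam * ((1 - t⁻¹) * (d lam * ψ lam)) * macC h lam =
      (1 - t⁻¹) * (eig q t μ * ∑ lam, ψ lam * d lam * macC h lam -
        (1 - t⁻¹) * (1 - q) * ∑ lam, ψ lam * d lam ^ 2 * macC h lam) := by
    rw [Finset.mul_sum, Finset.mul_sum, ← Finset.sum_sub_distrib, Finset.mul_sum]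
    refine Finset.sum_congr rfl fun lam _ => ?_
    linear_combination ((1 - t⁻¹) * d lam * macC h lam) * he lam
  rw [h2, hS1] at h1
  have h3 : (1 - t⁻¹) * (1 - q) ≠ 0 := mul_ne_zero hti hq1
  apply mul_left_cancel₀ h3
  have h4 : (1 - t⁻¹) * (macC h μ / (1 - t)) = -(macC h μ / t) := by
    field_simp
    ring
  linear_combination eig q t μ * h4 - h1

/-- The evaluation of the Macdonald polynomials at `p_k ↦ (x^k - y^k) / (1 - t^k)`. -/
theorem evxy_macP (x y : L) {n : ℕ} (μ : n.Partition) : evxy t x y (macP h μ) =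
    algebraMap F L (macC h μ) *
      ∏ s ∈ (diagram μ).cells, (x - y * algebraMap F L (content q t s)) := by
  classical
  have ht := h.t_ne_zero
  let w : Ptn → L := fun μ => algebraMap F L (macC h μ.2) *
      ∏ s ∈ (diagram μ.2).cells, (x - y * algebraMap F L (content q t s))
  -- The functional φ takes the claimed values on the Macdonald basis; `functional_eq_zero` is
  -- applied to its difference from the true evaluation.
  let φ : MvPolynomial ℕ+ F →ₗ[F] L := (macBasis h).constr F w
  have hφ : ∀ {n : ℕ} (μ : n.Partition), φ (macP h μ) = w ⟨n, μ⟩ := by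
    intro n μ
    rw [← macBasis_apply h μ]
    exact Module.Basis.constr_basis _ _ _ _
  have hcomb : ∀ {n : ℕ} (c : n.Partition → F), φ (comb h c) =
      ∑ lam, algebraMap F L (c lam) * w ⟨n, lam⟩ := by
    intro n c
    rw [comb_apply, map_sum]
    exact Finset.sum_congr rfl fun lam _ => by rw [map_smul, hφ, Algebra.smul_def]
  have hone : φ 1 = 1 := by
    have h1 : (1 : MvPolynomial ℕ+ F) = macP h (Nat.Partition.indiscrete 0) := (macP_zero h _).symm
    rw [h1, hφ]
    have h2 : (diagram (Nat.Partition.indiscrete 0)).cells = ∅ := by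
      rw [← Finset.card_eq_zero, card_diagram]
    simp only [w, macC, macP_zero, map_one, h2, Finset.prod_empty, mul_one]
  -- Adding a box of content d multiplies the claimed value by x - y d. The two recursions for φ
  -- thus reduce to the moments of order 0, 1 and 2, which do not involve x and y.
  have hprod : ∀ {n : ℕ} (μ : n.Partition) (ψ d : (n + 1).Partition → F),
      (∀ lam, ψ lam ≠ 0 → ∃ s, s ∉ (diagram μ).cells ∧
        (diagram lam).cells = insert s (diagram μ).cells ∧ d lam = content q t s) →
      ∀ e : (n + 1).Partition → F, φ (comb h fun lam => e lam * ψ lam) =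
        (∏ s ∈ (diagram μ).cells, (x - y * algebraMap F L (content q t s))) *
        (x * algebraMap F L (∑ lam, e lam * ψ lam * macC h lam) -
          y * algebraMap F L (∑ lam, e lam * ψ lam * d lam * macC h lam)) := by
    intro n μ ψ d hd e
    rw [hcomb, map_sum, map_sum, Finset.mul_sum, Finset.mul_sum, ← Finset.sum_sub_distrib,
      Finset.mul_sum]
    refine Finset.sum_congr rfl fun lam _ => ?_
    by_cases hl : ψ lam = 0
    · simp [hl]
    · obtain ⟨s, h1, h2, h3⟩ := hd lam hl
      simp only [w]
      rw [h2, Finset.prod_insert h1, h3]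
      simp only [map_mul]
      ring
  have key := functional_eq_zero (q := q) (t := t) h.q_ne_one h.t_pow_ne_one
    ((evxy t x y).toLinearMap - φ) ((x - y) / algebraMap F L (1 - t)) (y / algebraMap F L t)
    (-(x / algebraMap F L t)) (by simp [hone]) ?_ ?_ n (macP h μ) (isHom_macP h μ)
  · rw [LinearMap.sub_apply, sub_eq_zero, hφ] at key
    exact key
  · intro n f hf
    obtain ⟨c, rfl⟩ := exists_eq_comb h hf
    have h1 : φ (X 1 * comb h c) = (x - y) / algebraMap F L (1 - t) * φ (comb h c) := by
      rw [comb_apply, Finset.mul_sum, map_sum, map_sum, Finset.mul_sum]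
      refine Finset.sum_congr rfl fun μ _ => ?_
      obtain ⟨ψ, d, hX, hE, hd, hS0, hS1, hS2⟩ := exists_pieri_moments h μ
      have h2 := hprod μ ψ d hd fun _ => 1
      simp only [one_mul, hS0, hS1] at h2
      rw [mul_smul_comm, map_smul, map_smul, hφ, hX, h2, mul_smul_comm]
      congr 1
      simp only [w, map_div₀]
      ring
    simp only [LinearMap.sub_apply, AlgHom.toLinearMap_apply, evxy_X_one_mul, h1, mul_sub]
  · intro n f hf
    obtain ⟨c, rfl⟩ := exists_eq_comb h hf
    have h1 : φ (mac q t 1 (comb h c)) = y / algebraMap F L t * φ (mac q t 0 (comb h c)) -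
        x / algebraMap F L t * φ (comb h c) := by
      rw [comb_apply, map_sum, map_sum, map_sum, map_sum, map_sum, Finset.mul_sum, Finset.mul_sum,
        ← Finset.sum_sub_distrib]
      refine Finset.sum_congr rfl fun μ _ => ?_
      obtain ⟨ψ, d, hX, hE, hd, hS0, hS1, hS2⟩ := exists_pieri_moments h μ
      have h2 := hprod μ ψ d hd fun lam => (1 - t⁻¹) * d lam
      have e1 : ∑ lam, (1 - t⁻¹) * d lam * ψ lam * macC h lam = -(macC h μ / t) := by
        have ht1 : 1 - t ≠ 0 := sub_ne_zero.2 h.t_ne_one.symm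
        have : -(macC h μ / t) = (1 - t⁻¹) * (macC h μ / (1 - t)) := by
          field_simp
          ring
        rw [this, ← hS1, Finset.mul_sum]
        exact Finset.sum_congr rfl fun lam _ => by ring
      have e2 : ∑ lam, (1 - t⁻¹) * d lam * ψ lam * d lam * macC h lam =
          -(eig q t μ / t * macC h μ) := by
        rw [← hS2, Finset.mul_sum]
        exact Finset.sum_congr rfl fun lam _ => by ring
      have e3 : (fun lam => (1 - t⁻¹) * d lam * ψ lam) =
          fun lam => (1 - t⁻¹) * (d lam * ψ lam) := by funext lam; ring
      rw [e1, e2, e3] at h2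
      simp only [map_smul]
      rw [hE, h2, mac_macP, ← smul_eq_C_mul, map_smul, hφ]
      simp only [w, map_neg, map_div₀, map_mul, Algebra.smul_def]
      ring
    simp only [LinearMap.sub_apply, AlgHom.toLinearMap_apply,
      evxy_mac_one ht h.t_pow_ne_one, h1]
    ring

end Basis

end MacFock

namespace MacFock
open MvPolynomial MacVertex

/-! ### Removing the first column -/

section Column
variable {F : Type*} [Field F] [CharZero F] {N : ℕ}

theorem scaleVar_prod_X_mul (q : F) (i : Fin N) (g : MvPolynomial (Fin N) F) :
    scaleVar q i ((∏ j, X j) * g) = C q * ((∏ j, X j) * scaleVar q i g) := by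
  rw [map_mul, map_prod, ← mul_assoc]
  congr 1
  have h1 : ∀ j, scaleVar q i (X j) = (if j = i then C q else 1) * X j := by
    intro j; simp only [scaleVar, aeval_X]; split_ifs <;> simp
  simp only [h1]
  rw [Finset.prod_mul_distrib, Finset.prod_ite_eq' Finset.univ i, if_pos (Finset.mem_univ i)]

/-- Scaling x_i by q multiplies x_1 ⋯ x_N by q for every i, so the q-difference part of the
eigenvalue is multiplied by q, as it is when all exponents grow by one. -/
theorem IsEig.prod_X_mul {q t : F} {α β : Fin N →₀ ℕ} (hβ : ∀ i, β i = α i + 1)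
    {g : MvPolynomial (Fin N) F} (h : IsEig q t (eigVal q t α) g) :
    IsEig q t (eigVal q t β) ((∏ j, X j) * g) := by
  have he : eigVal q t β = t⁻¹ ^ N + q * (eigVal q t α - t⁻¹ ^ N) := by
    rw [eigVal, eigVal]
    simp only [hβ, pow_succ]
    rw [add_sub_cancel_left, Finset.mul_sum, Finset.mul_sum, Finset.mul_sum]
    congr 1
    exact Finset.sum_congr rfl fun i _ => by ring
  rw [IsEig, he] at *
  simp only [scaleVar_prod_X_mul]
  have h1 : ∑ i, discDi t⁻¹ i * (C q * ((∏ j, X j) * scaleVar q i g)) =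
      C q * (∏ j, X j) * ∑ i, discDi t⁻¹ i * scaleVar q i g := by
    rw [Finset.mul_sum]
    exact Finset.sum_congr rfl fun i _ => by ring
  rw [h1]
  simp only [map_add, map_mul, map_sub] at h ⊢
  linear_combination C q * (∏ j, X j) * h

/-- Removing the first column of a partition with `N` rows divides its Macdonald polynomial in `N`
variables by `x_1 ⋯ x_N`. -/
theorem tv_macP_eq_prod_X_mul {q t : F} (h : Generic q t) {n m : ℕ} (μ : n.Partition)
    (ν : m.Partition) (hμ : (rows μ).length ≤ N) (hν : (rows ν).length ≤ N)
    (hμν : ∀ i < N, (rows μ).getD i 0 = (rows ν).getD i 0 + 1) :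
    tv N (macP h μ) = (∏ j, X j) * tv N (macP h ν) := by
  refine sub_eq_zero.1 (IsEig.eq_zero h (α := expo N (rows μ)) (IsEig.sub ?_ ?_) ?_)
  · rw [eigVal_expo μ hμ]; exact isEig_tv (mac_macP h μ)
  · refine IsEig.prod_X_mul (α := expo N (rows ν)) (fun i => hμν i i.2) ?_
    rw [eigVal_expo ν hν]; exact isEig_tv (mac_macP h ν)
  · have h1 : expo N (rows μ) = (∑ j : Fin N, Finsupp.single j 1) + expo N (rows ν) := by
      ext i
      rw [Finsupp.add_apply, expo_apply, expo_apply, hμν i i.2, add_comm]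
      congr 1
      simp [Finsupp.single_apply]
    have h2 : (∏ j : Fin N, X j : MvPolynomial (Fin N) F) =
        monomial (∑ j : Fin N, Finsupp.single j 1) 1 := by
      rw [monomial_sum_one]; rfl
    rw [coeff_sub, coeff_expo_tv hμ, kap_rows_macP, h1, h2, coeff_monomial_mul, coeff_expo_tv hν,
      kap_rows_macP]
    ring

end Column

/-! ### Removing the first row -/

section Row
variable {F : Type*} [Field F] [CharZero F] {N : ℕ}

/-- `p` has degree at most `d`, with coefficient `a` in degree `d`. -/
def Top {R : Type*} [CommRing R] (p : Polynomial R) (d : ℕ) (a : R) : Prop :=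
  p.natDegree ≤ d ∧ p.coeff d = a

theorem Top.mul {R : Type*} [CommRing R] {p p' : Polynomial R} {d d' : ℕ} {a a' : R}
    (h : Top p d a) (h' : Top p' d' a') : Top (p * p') (d + d') (a * a') :=
  ⟨Polynomial.natDegree_mul_le_of_le h.1 h'.1, by
    rw [Polynomial.coeff_mul_add_eq_of_natDegree_le h.1 h'.1, h.2, h'.2]⟩

theorem Top.prod {R ι : Type*} [CommRing R] (s : Finset ι) {p : ι → Polynomial R} {d : ι → ℕ}
    {a : ι → R} (h : ∀ i ∈ s, Top (p i) (d i) (a i)) :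
    Top (∏ i ∈ s, p i) (∑ i ∈ s, d i) (∏ i ∈ s, a i) := by
  classical
  induction s using Finset.induction_on with
  | empty => exact ⟨by simp, by simp⟩
  | insert i s hi ih =>
    rw [Finset.prod_insert hi, Finset.sum_insert hi, Finset.prod_insert hi]
    exact (h i (Finset.mem_insert_self _ _)).mul
      (ih fun j hj => h j (Finset.mem_insert_of_mem hj))

theorem prod_erase_succ {M : Type*} [CommMonoid M] (i : Fin N) (f : Fin (N + 1) → M) :
    ∏ j ∈ Finset.univ.erase i.succ, f j = f 0 * ∏ j ∈ Finset.univ.erase i, f j.succ := by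
  classical
  have : (Finset.univ.erase i.succ : Finset (Fin (N + 1))) =
      insert 0 ((Finset.univ.erase i).map (Fin.succEmb N)) := by
    ext j
    induction j using Fin.cases with
    | zero => simp [Fin.succ_ne_zero i |>.symm]
    | succ j => simp [Fin.succ_inj]
  rw [this, Finset.prod_insert (by simp), Finset.prod_map]
  rfl

theorem prod_erase_zero {M : Type*} [CommMonoid M] (f : Fin (N + 1) → M) :
    ∏ j ∈ Finset.univ.erase 0, f j = ∏ j : Fin N, f j.succ := by
  classical
  have : (Finset.univ.erase 0 : Finset (Fin (N + 1))) = Finset.univ.map (Fin.succEmb N) := by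
    ext j
    induction j using Fin.cases with
    | zero => simp
    | succ j => simp
  rw [this, Finset.prod_map]
  rfl

theorem top_facE_zero (s : F) : Top (finSuccEquiv F N (facE s 0)) N 1 := by
  have h1 : finSuccEquiv F N (facE s 0) =
      ∏ j : Fin N, (Polynomial.X - Polynomial.C (C s * X j)) := by
    rw [facE, prod_erase_zero, map_prod]
    refine Finset.prod_congr rfl fun j _ => ?_
    rw [map_sub, map_mul, finSuccEquiv_X_zero, finSuccEquiv_X_succ, ← algebraMap_eq,
      AlgEquiv.commutes, map_mul]
    rfl
  have h2 := Top.prod Finset.univ (p := fun j : Fin N =>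
    (Polynomial.X - Polynomial.C (C s * X j : MvPolynomial (Fin N) F))) (d := fun _ => 1)
    (a := fun _ => 1) (fun j _ => ⟨Polynomial.natDegree_X_sub_C_le _, by simp⟩)
  rw [h1]
  simpa using h2

theorem top_facE_succ (s : F) (i : Fin N) :
    Top (finSuccEquiv F N (facE s i.succ)) 1 (-(C s * facE s i)) := by
  have h1 : finSuccEquiv F N (facE s i.succ) =
      (Polynomial.C (X i) - Polynomial.C (C s) * Polynomial.X) * Polynomial.C (facE s i) := by
    have hC : finSuccEquiv F N (C s) = Polynomial.C (C s) := by
      rw [← algebraMap_eq, AlgEquiv.commutes]; rfl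
    rw [facE, prod_erase_succ, map_mul, map_prod, facE, map_prod]
    simp only [map_sub, map_mul, finSuccEquiv_X_zero, finSuccEquiv_X_succ, hC]
  rw [h1]
  refine ⟨?_, ?_⟩
  · refine (Polynomial.natDegree_mul_le_of_le (m := 1) (n := 0) ?_ (by simp))
    refine (Polynomial.natDegree_sub_le_of_le (m := 0) (n := 1) (by simp) ?_)
    exact (Polynomial.natDegree_C_mul_le _ _).trans Polynomial.natDegree_X_le
  · rw [Polynomial.coeff_mul_C]
    simp [Polynomial.coeff_C]

theorem top_discD : Top (finSuccEquiv F N (discD F (N + 1))) (N + N) ((-1) ^ N * discD F N) := by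
  rw [discD, Fin.prod_univ_succ, map_mul, map_prod]
  have := (top_facE_zero (F := F) (N := N) 1).mul
    (Top.prod Finset.univ fun k (_ : k ∈ Finset.univ) => top_facE_succ (F := F) (N := N) 1 k)
  simp only [map_one, one_mul, Finset.prod_neg, Finset.sum_const, Finset.card_univ,
    Fintype.card_fin, smul_eq_mul, mul_one] at this
  exact this

theorem top_discDi_zero (s : F) :
    Top (finSuccEquiv F N (discDi s 0)) (N + N) ((-1) ^ N * discD F N) := by
  rw [discDi, prod_erase_zero, map_mul, map_prod]
  have := (top_facE_zero (F := F) (N := N) s).mul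
    (Top.prod Finset.univ fun k (_ : k ∈ Finset.univ) => top_facE_succ (F := F) (N := N) 1 k)
  simp only [map_one, one_mul, Finset.prod_neg, Finset.sum_const, Finset.card_univ,
    Fintype.card_fin, smul_eq_mul, mul_one] at this
  exact this

theorem top_discDi_succ (s : F) (i : Fin N) :
    Top (finSuccEquiv F N (discDi s i.succ)) (N + N) ((-1) ^ N * (C s * discDi s i)) := by
  rw [discDi, prod_erase_succ, map_mul, map_mul, map_prod]
  have := (top_facE_succ s i).mul ((top_facE_zero (F := F) (N := N) 1).mul
    (Top.prod (Finset.univ.erase i) fun k _ => top_facE_succ (F := F) (N := N) 1 k))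
  simp only [map_one, one_mul, Finset.prod_neg, Finset.sum_const, Finset.card_univ,
    Finset.card_erase_of_mem (Finset.mem_univ i), Fintype.card_fin, smul_eq_mul, mul_one] at this
  have hN : N - 1 + 1 = N := Nat.sub_add_cancel (Nat.one_le_of_lt i.2)
  convert this using 1
  · omega
  · rw [discDi]
    have h1 : (-1 : MvPolynomial (Fin N) F) ^ N = -(-1) ^ (N - 1) := by
      rw [← pow_sub_one_mul (Nat.ne_of_gt (Nat.zero_lt_of_lt i.2)) (-1 : MvPolynomial (Fin N) F)]
      ring
    rw [h1]
    ring

theorem coeff_finSuccEquiv_scaleVar_zero (q : F) (G : MvPolynomial (Fin (N + 1)) F) (m : ℕ) :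
    (finSuccEquiv F N (scaleVar q 0 G)).coeff m = C (q ^ m) * (finSuccEquiv F N G).coeff m := by
  ext α
  rw [finSuccEquiv_coeff_coeff, coeff_scaleVar, coeff_C_mul, finSuccEquiv_coeff_coeff,
    Finsupp.cons_zero]

theorem coeff_finSuccEquiv_scaleVar_succ (q : F) (i : Fin N) (G : MvPolynomial (Fin (N + 1)) F)
    (m : ℕ) : (finSuccEquiv F N (scaleVar q i.succ G)).coeff m =
      scaleVar q i ((finSuccEquiv F N G).coeff m) := by
  ext α
  rw [finSuccEquiv_coeff_coeff, coeff_scaleVar, coeff_scaleVar, finSuccEquiv_coeff_coeff,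
    Finsupp.cons_succ]

/-- As x_1 → ∞ the residue factor at x_1 tends to 1, and the factors (x_i - t⁻¹ x_1)/(x_i - x_1)
tend to t⁻¹. The top coefficient in x_1 is therefore an eigenvector in the remaining variables, with
e = (1 - t⁻¹) q^M + t⁻¹ e'. -/
theorem IsEig.coeff_finSuccEquiv {q t e : F} (ht : t ≠ 0) {G : MvPolynomial (Fin (N + 1)) F}
    (h : IsEig q t e G) {M : ℕ} (hM : (finSuccEquiv F N G).natDegree ≤ M) :
    IsEig q t (t * (e - (1 - t⁻¹) * q ^ M)) ((finSuccEquiv F N G).coeff M) := by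
  set g := (finSuccEquiv F N G).coeff M with hg
  have hC : ∀ s : F, finSuccEquiv F N (C s) = Polynomial.C (C s) := by
    intro s; rw [← algebraMap_eq, AlgEquiv.commutes]; rfl
  have hG : Top (finSuccEquiv F N G) M g := ⟨hM, rfl⟩
  have h0 : Top (finSuccEquiv F N (scaleVar q 0 G)) M (C (q ^ M) * g) := by
    refine ⟨?_, coeff_finSuccEquiv_scaleVar_zero q G M⟩
    rw [Polynomial.natDegree_le_iff_coeff_eq_zero] at hM ⊢
    intro m hm
    rw [coeff_finSuccEquiv_scaleVar_zero, hM m hm, mul_zero]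
  have h1 : ∀ i : Fin N, Top (finSuccEquiv F N (scaleVar q i.succ G)) M (scaleVar q i g) := by
    intro i
    refine ⟨?_, coeff_finSuccEquiv_scaleVar_succ q i G M⟩
    rw [Polynomial.natDegree_le_iff_coeff_eq_zero] at hM ⊢
    intro m hm
    rw [coeff_finSuccEquiv_scaleVar_succ, hM m hm, map_zero]
  have h2 := congrArg (fun p => (finSuccEquiv F N p).coeff (N + N + M)) h
  simp only [Fin.sum_univ_succ, map_add, map_mul, map_sum, hC, Polynomial.coeff_add,
    Polynomial.coeff_C_mul, Polynomial.finsetSum_coeff, (top_discD.mul hG).2,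
    ((top_discDi_zero t⁻¹).mul h0).2, ((top_discDi_succ t⁻¹ _).mul (h1 _)).2] at h2
  have h3 : ∑ i, (-1) ^ N * (C t⁻¹ * discDi t⁻¹ i) * scaleVar q i g =
      (-1) ^ N * C t⁻¹ * ∑ i, discDi t⁻¹ i * scaleVar q i g := by
    rw [Finset.mul_sum]
    exact Finset.sum_congr rfl fun i _ => by ring
  rw [h3] at h2
  have h4 : (-1 : MvPolynomial (Fin N) F) ^ N * (-1) ^ N = 1 := by
    rw [← mul_pow]; simp
  have h5 : (C t : MvPolynomial (Fin N) F) * C t⁻¹ = 1 := by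
    rw [← map_mul, mul_inv_cancel₀ ht, map_one]
  rw [IsEig]
  simp only [map_mul, map_sub, map_pow, pow_succ] at h2 ⊢
  set S := ∑ i, discDi t⁻¹ i * scaleVar q i g
  set D := discD F N
  set a := (C t⁻¹ : MvPolynomial (Fin N) F)
  set sg := (-1 : MvPolynomial (Fin N) F) ^ N
  linear_combination (C t * sg) * h2 +
    (-C t * (C e - (C 1 - a) * C q ^ M) * D * g + C t * a * (a ^ N * D * g + (C 1 - a) * S)) * h4 +
    (a ^ N * D * g + (C 1 - a) * S) * h5

/-- Dominance, tested on the first part alone, bounds every exponent occurring in P_ν by its largest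
part. -/
theorem tz_macP_eq_zero {q t : F} (h : Generic q t) {n : ℕ} (ν : n.Partition) {m : ℕ}
    (hm : (rows ν).getD 0 0 < m) : tz (fun _ => 1) m (macP h ν) = 0 := by
  by_cases hmn : m ≤ n
  · have hh : IsHom (tz (fun _ => 1) m (macP h ν)) ((n - m : ℕ) : ℤ) := by
      have := (isHom_macP h ν).tz (d := fun _ => 1) m
      rwa [Nat.cast_sub hmn]
    refine eq_zero_of_kap_rows hh fun ρ => ?_
    rw [← kap_cons]
    by_contra h0
    have hs : (m :: rows ρ).sum = n := by rw [List.sum_cons, sum_rows]; omega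
    set μ := Nat.Partition.ofSums n (m :: rows ρ : List ℕ) (by simpa using hs) with hμd
    have hμ : μ.parts = ((m :: rows ρ : List ℕ) : Multiset ℕ).filter (· ≠ 0) := rfl
    rw [kap_eq_of_parts hμ] at h0
    have h1 := domLE_of_kap_macP h ν h0 1
    have h2 := sum_le_sum_take (k := 1) (s := {m}) (rows_pairwise μ) (by
      rw [coe_rows, hμ, Multiset.singleton_le, Multiset.mem_filter]
      exact ⟨by simp, by omega⟩) (by simp)
    rw [Multiset.sum_singleton] at h2
    have h3 : ((rows ν).take 1).sum = (rows ν).getD 0 0 := by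
      cases rows ν <;> simp
    omega
  · exact ((isHom_macP h ν).tz (d := fun _ => 1) m).eq_zero_of_neg (by omega)

/-- The coefficient of the highest power of `x_1` in `P_ν` is `P_ρ`, where `ρ` is `ν` without its
first row. -/
theorem tz_macP {q t : F} (h : Generic q t) {n m M : ℕ} (ν : n.Partition) (ρ : m.Partition)
    (hνρ : rows ν = M :: rows ρ) : tz (fun _ => 1) M (macP h ν) = macP h ρ := by
  have ht := h.t_ne_zero
  have hn : n = M + m := by rw [← sum_rows ν, hνρ, List.sum_cons, sum_rows]
  have hl : (rows ρ).length ≤ m := length_rows_le ρ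
  have hl' : (rows ν).length ≤ m + 1 := by rw [hνρ]; simpa using hl
  have hh : IsHom (tz (fun _ => 1) M (macP h ν)) m := by
    have := (isHom_macP h ν).tz (d := fun _ => 1) M
    convert this using 1
    omega
  have hcoef : ∀ k, (finSuccEquiv F m (tv (m + 1) (macP h ν))).coeff k =
      tv m (tz (fun _ => 1) k (macP h ν)) := by
    intro k
    rw [finSuccEquiv_tv, Polynomial.coeff_map, tz_natCast]
    rfl
  have hdeg : (finSuccEquiv F m (tv (m + 1) (macP h ν))).natDegree ≤ M := by
    rw [Polynomial.natDegree_le_iff_coeff_eq_zero]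
    intro k hk
    rw [hcoef, tz_macP_eq_zero h ν (by rw [hνρ]; simpa using hk), map_zero]
  have h1 := (isEig_tv (N := m + 1) (mac_macP h ν)).coeff_finSuccEquiv ht hdeg
  rw [hcoef] at h1
  have h2 : t * (eig q t ν - (1 - t⁻¹) * q ^ M) = eigVal q t (expo m (rows ρ)) := by
    rw [← eigVal_expo ν hl', eigVal, eigVal, Fin.sum_univ_succ, hνρ]
    simp only [expo_apply, Fin.val_zero, Fin.val_succ, List.getD_cons_zero, List.getD_cons_succ,
      pow_zero, one_mul]
    have h3 : ∑ i : Fin m, t⁻¹ ^ (i.val + 1) * q ^ (rows ρ).getD i 0 =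
        t⁻¹ * ∑ i : Fin m, t⁻¹ ^ i.val * q ^ (rows ρ).getD i 0 := by
      rw [Finset.mul_sum]
      exact Finset.sum_congr rfl fun i _ => by ring
    rw [h3, pow_succ]
    have h4 : t * t⁻¹ = 1 := mul_inv_cancel₀ ht
    linear_combination (t⁻¹ ^ m + (1 - t⁻¹) *
      ∑ i : Fin m, t⁻¹ ^ i.val * q ^ (rows ρ).getD i 0) * h4
  rw [h2] at h1
  have hsub : IsHom (tz (fun _ => 1) M (macP h ν) - macP h ρ) m :=
    (weightedHomogeneousSubmodule F _ _).sub_mem hh (isHom_macP h ρ)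
  refine sub_eq_zero.1 (eq_zero_of_tv le_rfl hsub ?_)
  rw [map_sub]
  refine IsEig.eq_zero h (α := expo m (rows ρ)) (h1.sub ?_) ?_
  · rw [eigVal_expo ρ hl]; exact isEig_tv (mac_macP h ρ)
  · rw [coeff_sub, coeff_expo_tv hl, coeff_expo_tv hl, kap_rows_macP, ← kap_cons, ← hνρ,
      kap_rows_macP, sub_self]

end Row

end MacFock

namespace MacFock
open MvPolynomial MacVertex

/-! ### Products over Young diagrams -/

section Diagram

theorem exists_rows_eq {n : ℕ} {l : List ℕ} (hs : l.sum = n) (hl : l.Pairwise (· ≥ ·))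
    (hp : ∀ m ∈ l, 0 < m) : ∃ μ : n.Partition, rows μ = l := by
  refine ⟨Nat.Partition.mk l (fun {m} hm => hp m hm) (by simpa using hs), ?_⟩
  rw [rows]
  refine List.Perm.eq_of_pairwise (le := (· ≥ ·)) (fun a b _ _ h h' => le_antisymm h' h)
    (Multiset.pairwise_sort _ _) hl ?_
  rw [← Multiset.coe_eq_coe, Multiset.sort_eq]

theorem getD_rows_pos {n : ℕ} (μ : n.Partition) {i : ℕ} :
    0 < (rows μ).getD i 0 ↔ i < (rows μ).length := by
  constructor
  · intro h
    by_contra h'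
    rw [List.getD_eq_default _ _ (not_lt.1 h')] at h
    exact lt_irrefl _ h
  · intro h
    rw [List.getD_eq_getElem _ _ h]
    exact rows_pos μ (List.getElem_mem h)

theorem rowLen_diagram {n : ℕ} (μ : n.Partition) (i : ℕ) :
    (diagram μ).rowLen i = (rows μ).getD i 0 := by
  have h : ∀ j, j < (diagram μ).rowLen i ↔ j < (rows μ).getD i 0 := by
    intro j
    rw [← YoungDiagram.mem_iff_lt_rowLen, ← YoungDiagram.mem_cells, mem_diagram]
  exact eq_of_forall_lt_iff h

theorem lt_colLen_diagram {n : ℕ} (μ : n.Partition) (i j : ℕ) :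
    i < (diagram μ).colLen j ↔ j < (rows μ).getD i 0 := by
  rw [← YoungDiagram.mem_iff_lt_colLen, ← YoungDiagram.mem_cells, mem_diagram]

theorem colLen_zero_diagram {n : ℕ} (μ : n.Partition) :
    (diagram μ).colLen 0 = (rows μ).length := by
  refine eq_of_forall_lt_iff fun i => ?_
  rw [lt_colLen_diagram, getD_rows_pos]

theorem getD_rows_anti {n : ℕ} (μ : n.Partition) {i j : ℕ} (hij : i ≤ j) :
    (rows μ).getD j 0 ≤ (rows μ).getD i 0 := by
  rw [← rowLen_diagram, ← rowLen_diagram]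
  exact YoungDiagram.rowLen_anti _ i j hij

theorem prod_diagram {M : Type*} [CommMonoid M] {n N : ℕ} (μ : n.Partition)
    (hN : (rows μ).length ≤ N) (g : ℕ × ℕ → M) : ∏ s ∈ (diagram μ).cells, g s =
      ∏ i ∈ Finset.range N, ∏ j ∈ Finset.range ((rows μ).getD i 0), g (i, j) := by
  rw [Finset.prod_finset_product (diagram μ).cells (Finset.range N)
    (fun i => Finset.range ((rows μ).getD i 0))]
  intro p
  rw [mem_diagram, Finset.mem_range, Finset.mem_range]
  constructor
  · intro h
    exact ⟨lt_of_lt_of_le ((getD_rows_pos μ).1 (by omega)) hN, h⟩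
  · exact fun h => h.2

theorem prod_diagram_col {M : Type*} [CommMonoid M] {n N : ℕ} (μ : n.Partition)
    (hN : (rows μ).getD 0 0 ≤ N) (g : ℕ × ℕ → M) : ∏ s ∈ (diagram μ).cells, g s =
      ∏ j ∈ Finset.range N, ∏ i ∈ Finset.range ((diagram μ).colLen j), g (i, j) := by
  rw [Finset.prod_finset_product_right (diagram μ).cells (Finset.range N)
    (fun j => Finset.range ((diagram μ).colLen j))]
  intro p
  rw [mem_diagram, Finset.mem_range, Finset.mem_range, lt_colLen_diagram]
  constructor
  · intro h
    exact ⟨lt_of_lt_of_le (lt_of_lt_of_le h (getD_rows_anti μ (Nat.zero_le _))) hN, h⟩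
  · exact fun h => h.2

/-- The partition `μ` without its first column. -/
theorem exists_remove_column {n : ℕ} (μ : n.Partition) :
    ∃ (m : ℕ) (ν : m.Partition), n = m + (rows μ).length ∧
      ∀ i, (rows ν).getD i 0 = (rows μ).getD i 0 - 1 := by
  set l := ((rows μ).map (· - 1)).filter (0 < ·) with hl
  have h1 : ∀ k : List ℕ, (∀ m ∈ k, 0 < m) →
      ((k.map (· - 1)).filter (0 < ·)).sum + k.length = k.sum := by
    intro k hk
    induction k with
    | nil => rfl
    | cons a k ih =>
      have h2 := hk a (by simp)
      have h3 := ih fun m hm => hk m (by simp [hm])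
      rw [List.map_cons, List.filter_cons, List.length_cons, List.sum_cons]
      split_ifs with h4
      · rw [List.sum_cons]; omega
      · simp at h4; omega
  have h2 : ∀ k : List ℕ, k.Pairwise (· ≥ ·) → ∀ i,
      ((k.map (· - 1)).filter (0 < ·)).getD i 0 = k.getD i 0 - 1 := by
    intro k hk
    induction k with
    | nil => intro i; simp
    | cons a k ih =>
      intro i
      rw [List.pairwise_cons] at hk
      rw [List.map_cons, List.filter_cons]
      split_ifs with h4
      · cases i with
        | zero => simp
        | succ i => rw [List.getD_cons_succ, List.getD_cons_succ, ih hk.2]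
      · simp at h4
        have h5 : ∀ b ∈ k, b - 1 = 0 := fun b hb => by have := hk.1 b hb; omega
        rw [List.filter_eq_nil_iff.2]
        · cases i with
          | zero => simp [h4]
          | succ i =>
            rw [List.getD_cons_succ, ← ih hk.2, List.filter_eq_nil_iff.2 (by
              intro b hb
              obtain ⟨c, hc, rfl⟩ := List.mem_map.1 hb
              simp [h5 c hc])]
            rfl
        · intro b hb
          obtain ⟨c, hc, rfl⟩ := List.mem_map.1 hb
          simp [h5 c hc]
  obtain ⟨ν, hν⟩ := exists_rows_eq (l := l) rfl
    ((List.Pairwise.map (S := (· ≥ ·)) (· - 1)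
      (fun a b (hab : a ≥ b) => Nat.sub_le_sub_right hab 1) (rows_pairwise μ)).filter _)
    (fun m hm => by simpa using (List.mem_filter.1 hm).2)
  refine ⟨_, ν, ?_, fun i => by rw [hν, h2 _ (rows_pairwise μ)]⟩
  rw [h1 _ fun m hm => rows_pos μ hm, sum_rows]

/-- The partition `μ` without its first row. -/
theorem exists_remove_row {n : ℕ} (hn : n ≠ 0) (μ : n.Partition) :
    ∃ (M m : ℕ) (ρ : m.Partition), n = M + m ∧ 0 < M ∧ rows μ = M :: rows ρ := by
  cases hr : rows μ with
  | nil =>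
    have := sum_rows μ
    rw [hr] at this
    exact absurd this.symm hn
  | cons M l =>
    have h1 := rows_pairwise μ
    rw [hr, List.pairwise_cons] at h1
    have h2 : ∀ m ∈ M :: l, 0 < m := fun m hm => rows_pos μ (by rwa [hr])
    obtain ⟨ρ, hρ⟩ := exists_rows_eq (l := l) rfl h1.2 fun m hm => h2 m (by simp [hm])
    refine ⟨M, l.sum, ρ, ?_, h2 M (by simp), by rw [hρ]⟩
    rw [← sum_rows μ, hr, List.sum_cons]

end Diagram

/-! ### The evaluations in product form -/

section Products
variable {F : Type*} [Field F] [CharZero F] {q t : F} (h : Generic q t)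

theorem aeval_tv (ht1 : ∀ k : ℕ+, t ^ (k : ℕ) ≠ 1) (N : ℕ) (f : MvPolynomial ℕ+ F) :
    aeval (fun i : Fin N => t ^ i.val) (tv N f) = evxy t (1 : F) (t ^ N) f := by
  have : (aeval (fun i : Fin N => t ^ i.val)).comp (tv N) = evxy t (1 : F) (t ^ N) := by
    ext k
    have hk : 1 - t ^ (k : ℕ) ≠ 0 := sub_ne_zero.2 (ht1 k).symm
    rw [AlgHom.comp_apply, tv_X, map_sum, evxy, aeval_X, eq_div_iff (by simpa using hk)]
    simp only [map_pow, aeval_X, ← pow_mul]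
    have h1 := mul_neg_geom_sum (t ^ (k : ℕ)) N
    rw [Finset.sum_range] at h1
    simp only [← pow_mul] at h1
    rw [Algebra.algebraMap_self, RingHom.id_apply, mul_comm, one_pow, mul_comm N, ← h1]
    congr 1
    exact Finset.sum_congr rfl fun i _ => by rw [mul_comm]
  rw [← this]; rfl

/-- The value of the Macdonald polynomial at `p_k ↦ 1 / (1 - t^k)`. -/
theorem macC_eq {n : ℕ} (μ : n.Partition) : macC h μ =
    ∏ s ∈ (diagram μ).cells, t ^ s.1 / (1 - q ^ arm μ s * t ^ (leg μ s + 1)) := by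
  have ht := h.t_ne_zero
  induction n using Nat.strong_induction_on with
  | _ n ih =>
    rcases Nat.eq_zero_or_pos n with rfl | hn
    · have h2 : (diagram μ).cells = ∅ := by rw [← Finset.card_eq_zero, card_diagram]
      rw [h2, Finset.prod_empty, macC, macP_zero, map_one]
    · obtain ⟨m, ν, hmn, hν⟩ := exists_remove_column μ
      set N := (rows μ).length with hN
      have hN0 : 0 < N := by
        by_contra h0
        have h1 := sum_rows μ
        rw [List.eq_nil_of_length_eq_zero (l := rows μ) (by omega)] at h1
        simp at h1
        omega
      have hμν : ∀ i < N, (rows μ).getD i 0 = (rows ν).getD i 0 + 1 := by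
        intro i hi
        have := (getD_rows_pos μ).2 hi
        rw [hν]; omega
      have hlν : (rows ν).length ≤ N := by
        by_contra h0
        have h1 := (getD_rows_pos ν (i := N)).2 (by omega)
        rw [hν, List.getD_eq_default _ _ hN.ge] at h1
        omega
      have hcol : ∀ j, (diagram ν).colLen j = (diagram μ).colLen (j + 1) := by
        intro j
        refine eq_of_forall_lt_iff fun i => ?_
        rw [lt_colLen_diagram, lt_colLen_diagram, hν]
        omega
      -- At x_i = t^{i-1}, i = 1, …, N, the specialization is the one with x = 1 and y = t^N. By
      -- `evxy_macP` both sides are known up to their constants, whose ratio comes from the removed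
      -- column.
      have h1 := congrArg (aeval (fun i : Fin N => t ^ i.val))
        (tv_macP_eq_prod_X_mul h μ ν le_rfl hlν hμν)
      rw [map_mul, aeval_tv h.t_pow_ne_one, aeval_tv h.t_pow_ne_one, evxy_macP, evxy_macP,
        map_prod] at h1
      simp only [aeval_X, Algebra.algebraMap_self, RingHom.id_apply] at h1
      rw [Fin.prod_univ_eq_prod_range (fun i => t ^ i), prod_diagram μ le_rfl,
        prod_diagram ν hlν] at h1
      have hcell : ∀ i < N, ∀ j, 1 - t ^ N * content q t (i, j) = 1 - q ^ j * t ^ (N - i) := by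
        intro i hi j
        rw [content, inv_pow, ← Nat.sub_add_cancel hi.le, pow_add, Nat.add_sub_cancel]
        field_simp
      have hne : ∀ i < N, ∀ j, 1 - t ^ N * content q t (i, j) ≠ 0 := by
        intro i hi j
        rw [hcell i hi, sub_ne_zero, ne_comm]
        exact h.pow_mul_pow_ne_one (Or.inr (by omega))
      have hprod : ∏ i ∈ Finset.range N, ∏ j ∈ Finset.range ((rows μ).getD i 0),
          (1 - t ^ N * content q t (i, j)) =
          (∏ i ∈ Finset.range N, ∏ j ∈ Finset.range ((rows ν).getD i 0),
            (1 - t ^ N * content q t (i, j))) *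
          ∏ i ∈ Finset.range N, (1 - q ^ (rows ν).getD i 0 * t ^ (N - i)) := by
        rw [← Finset.prod_mul_distrib]
        refine Finset.prod_congr rfl fun i hi => ?_
        rw [Finset.mem_range] at hi
        rw [hμν i hi, Finset.prod_range_succ, hcell i hi]
      rw [hprod] at h1
      have hne1 : ∏ i ∈ Finset.range N, ∏ j ∈ Finset.range ((rows ν).getD i 0),
            (1 - t ^ N * content q t (i, j)) ≠ 0 :=
        Finset.prod_ne_zero_iff.2 fun i hi => Finset.prod_ne_zero_iff.2 fun j _ =>
          hne i (Finset.mem_range.1 hi) j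
      have hne2 : ∏ i ∈ Finset.range N, (1 - q ^ (rows ν).getD i 0 * t ^ (N - i)) ≠ 0 := by
        refine Finset.prod_ne_zero_iff.2 fun i hi => ?_
        rw [← hcell i (Finset.mem_range.1 hi)]
        exact hne i (Finset.mem_range.1 hi) _
      have h2 : macC h μ * ∏ i ∈ Finset.range N, (1 - q ^ (rows ν).getD i 0 * t ^ (N - i)) =
          (∏ i ∈ Finset.range N, t ^ i) * macC h ν := by
        apply mul_left_cancel₀ hne1
        linear_combination h1
      rw [eq_div_of_mul_eq hne2 h2, ih m (by omega) ν, prod_diagram μ le_rfl, prod_diagram ν hlν,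
        mul_comm, mul_div_assoc, ← Finset.prod_div_distrib, ← Finset.prod_mul_distrib]
      refine Finset.prod_congr rfl fun i hi => ?_
      rw [Finset.mem_range] at hi
      rw [hμν i hi, Finset.prod_range_succ']
      congr 1
      · refine Finset.prod_congr rfl fun j _ => ?_
        simp only [arm, leg, rowLen_diagram, hcol, hμν i hi]
        rw [Nat.add_sub_add_right]
      · simp only [arm, leg, rowLen_diagram, colLen_zero_diagram, hμν i hi]
        rw [zero_add, Nat.add_sub_cancel, ← hN, show N - (i + 1) + 1 = N - i by omega]

theorem coeff_prod_one_sub (a : ℕ → F) (M : ℕ) :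
    PowerSeries.coeff M (∏ j ∈ Finset.range M, (1 - PowerSeries.C (a j) * PowerSeries.X)) =
      ∏ j ∈ Finset.range M, -a j := by
  have key : (∀ n, M < n → PowerSeries.coeff n
      (∏ j ∈ Finset.range M, (1 - PowerSeries.C (a j) * PowerSeries.X)) = 0) ∧
      PowerSeries.coeff M (∏ j ∈ Finset.range M, (1 - PowerSeries.C (a j) * PowerSeries.X)) =
      ∏ j ∈ Finset.range M, -a j := by
    induction M with
    | zero =>
      refine ⟨fun n hn => ?_, by simp⟩
      rw [Finset.range_zero, Finset.prod_empty, PowerSeries.coeff_one, if_neg (by omega)]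
    | succ M ih =>
      have hstep : ∀ n, PowerSeries.coeff (n + 1)
          (∏ j ∈ Finset.range (M + 1), (1 - PowerSeries.C (a j) * PowerSeries.X)) =
          PowerSeries.coeff (n + 1)
            (∏ j ∈ Finset.range M, (1 - PowerSeries.C (a j) * PowerSeries.X)) - a M *
          PowerSeries.coeff n
            (∏ j ∈ Finset.range M, (1 - PowerSeries.C (a j) * PowerSeries.X)) := by
        intro n
        rw [Finset.prod_range_succ, mul_sub, mul_one, map_sub, ← mul_assoc,
          PowerSeries.coeff_succ_mul_X, PowerSeries.coeff_mul_C]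
        ring
      constructor
      · intro n hn
        obtain ⟨n, rfl⟩ := Nat.exists_eq_succ_of_ne_zero (by omega : n ≠ 0)
        rw [Nat.succ_eq_add_one, hstep, ih.1 _ (by omega), ih.1 _ (by omega)]
        ring
      · rw [hstep, ih.1 _ (by omega), ih.2, Finset.prod_range_succ]
        ring
  exact key.2

/-! ### The Cauchy identity and the dual evaluations -/

theorem form_one (b : ℕ+ → F) (g : MvPolynomial ℕ+ F) : form b 1 g = coeff 0 g := by
  have h3 := form_monomial b 0 1 g
  rw [show (monomial (0 : ℕ+ →₀ ℕ)) (1 : F) = 1 from rfl] at h3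
  rw [h3]
  simp [zb]

/-- By adjointness, pairing with exp(∑ c_k p_k) translates g by d and takes the constant
coefficient, which evaluates g at d: the exponential is a reproducing kernel. -/
theorem form_hs {b c d : ℕ+ → F} (hcd : ∀ k, c k * b k = d k) {n : ℕ} {g : MvPolynomial ℕ+ F}
    (hg : IsHom g n) : form b (hs c n) g = aeval d g := by
  have h1 := form_hs_mul hcd n 1 g
  rw [mul_one] at h1
  rw [h1, form_one]
  have h4 : ∀ f : MvPolynomial ℕ+ F, aeval d f =
      Polynomial.eval 1 ((tau d f).map (constantCoeff : MvPolynomial ℕ+ F →+* F)) := by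
    intro f
    induction f using MvPolynomial.induction_on with
    | C a => rw [tau_C]; simp
    | add f g hf hg => rw [map_add, map_add, hf, hg, Polynomial.map_add, Polynomial.eval_add]
    | mul_X f k hf =>
      rw [map_mul, hf, map_mul, Polynomial.map_mul, Polynomial.eval_mul, tau_X]
      congr 1
      simp
  rw [h4, Polynomial.eval_eq_sum_range' (n := n + 1)]
  · rw [Finset.sum_eq_single n]
    · simp [tz_natCast, constantCoeff_eq]
    · intro m hm hmn
      have hm' : m < n := by have := Finset.mem_range.1 hm; omega
      have h5 : coeff 0 (tz d m g) = 0 := by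
        by_contra h6
        have := (hg.tz (d := d) m) h6
        rw [map_zero] at this
        omega
      rw [Polynomial.coeff_map, ← tz_natCast, constantCoeff_eq, h5, zero_mul]
    · simp
  · exact lt_of_le_of_lt Polynomial.natDegree_map_le (natDegree_tau_lt d hg)

/-- The coefficients of the reproducing kernel at `p_k ↦ (x^k - y^k) / (1 - t^k)`. -/
def cK {L : Type*} [Field L] (q x y : L) (k : ℕ+) : L :=
  (x ^ (k : ℕ) - y ^ (k : ℕ)) / (((k : ℕ) : L) * (1 - q ^ (k : ℕ)))

section Extension
variable {L : Type*} [Field L] [CharZero L] [Algebra F L]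

/-- The expansion of the reproducing kernel in Macdonald polynomials. -/
theorem hs_cK_eq_sum (x y : L) (n : ℕ) : hs (cK (algebraMap F L q) x y) n =
    ∑ ν : n.Partition, C (evxy t x y (macP h ν) / algebraMap F L (macNorm h ν)) *
      map (algebraMap F L) (macP h ν) := by
  classical
  have hinj := (algebraMap F L).injective
  have hb : ∀ k, algebraMap F L (bM q t k) ≠ 0 := fun k =>
    (map_ne_zero _).2 (h.bM_ne_zero k)
  let d : ℕ+ → L := fun k => (x ^ (k : ℕ) - y ^ (k : ℕ)) / algebraMap F L (1 - t ^ (k : ℕ))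
  have hcd : ∀ k, cK (algebraMap F L q) x y k * algebraMap F L (bM q t k) = d k := by
    intro k
    have h1 : ((k : ℕ) : L) ≠ 0 := by simp
    have h2 : 1 - algebraMap F L q ^ (k : ℕ) ≠ 0 := by
      rw [← map_pow, ← map_one (algebraMap F L), ← map_sub, map_ne_zero]
      exact sub_ne_zero.2 (h.q_pow_ne_one k).symm
    have h3 : 1 - algebraMap F L t ^ (k : ℕ) ≠ 0 := by
      rw [← map_pow, ← map_one (algebraMap F L), ← map_sub, map_ne_zero]
      exact sub_ne_zero.2 (h.t_pow_ne_one k).symm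
    simp only [cK, bM, d, map_mul, map_div₀, map_sub, map_one, map_pow, map_natCast]
    field_simp
  have hzb : ∀ s, zb (fun k => algebraMap F L (bM q t k)) s = algebraMap F L (zb (bM q t) s) := by
    intro s
    simp only [zb, Finsupp.prod, map_prod, map_mul, map_natCast, map_pow]
  -- The form is nondegenerate, so it suffices to pair with power-sum monomials. The left side
  -- becomes an evaluation by `form_hs`; expanding the monomial in the Macdonald basis yields the
  -- same value on the right.
  refine eq_of_form_monomial hb fun s => ?_
  obtain ⟨m, hm⟩ := Int.eq_ofNat_of_zero_le (weight_nonneg s)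
  have hsL : IsHom (monomial s (1 : L)) m := isWeightedHomogeneous_monomial _ _ _ hm
  have hsF : IsHom (monomial s (1 : F)) m := isWeightedHomogeneous_monomial _ _ _ hm
  have hR : ∀ ν : n.Partition, form (fun k => algebraMap F L (bM q t k)) (monomial s 1)
      (C (evxy t x y (macP h ν) / algebraMap F L (macNorm h ν)) *
        map (algebraMap F L) (macP h ν)) = evxy t x y (macP h ν) / algebraMap F L (macNorm h ν) *
      algebraMap F L (form (bM q t) (monomial s 1) (macP h ν)) := by
    intro ν
    rw [← smul_eq_C_mul, map_smul, form_monomial, form_monomial, coeff_map, hzb, map_mul, map_mul,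
      map_one, smul_eq_mul]
  rw [map_sum, Finset.sum_congr rfl fun ν _ => hR ν]
  by_cases hmn : m = n
  · subst hmn
    rw [form_comm, form_hs hcd hsL]
    obtain ⟨c, hc⟩ := exists_eq_comb h hsF
    have h1 : aeval d (monomial s (1 : L)) = evxy t x y (monomial s 1) := by
      rw [evxy, aeval_monomial, aeval_monomial, map_one, map_one]
    rw [h1, hc, comb_apply, map_sum]
    refine Finset.sum_congr rfl fun ν _ => ?_
    rw [map_sum, LinearMap.sum_apply, Finset.sum_eq_single ν]
    · rw [map_smul, map_smul, LinearMap.smul_apply, Algebra.smul_def, smul_eq_mul, ← macNorm,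
        map_mul]
      have := (map_ne_zero (algebraMap F L)).2 (macNorm_ne_zero h ν)
      field_simp
    · intro b _ hb
      rw [map_smul, LinearMap.smul_apply, form_macP h (fun he => hb (by simpa using he)), smul_zero]
    · simp
  · rw [form_eq_zero_of_isHom _ hsL (isHom_hs _ n) (by exact_mod_cast hmn), Finset.sum_eq_zero]
    intro ν _
    rw [form_eq_zero_of_isHom _ hsF (isHom_macP h ν) (by exact_mod_cast hmn), map_zero, mul_zero]

end Extension

theorem hs_cK_eq_comb (x y : F) (n : ℕ) : hs (cK q x y) n =
    comb h fun ν : n.Partition => evxy t x y (macP h ν) / macNorm h ν := by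
  have := hs_cK_eq_sum (L := F) h x y n
  simp only [Algebra.algebraMap_self, map_id, RingHom.id_apply] at this
  rw [this, comb_apply]
  simp only [smul_eq_C_mul]

include h in
-- Since (1 - q^{-Mk})/(1 - q^k) = -∑_{j<M} q^{-(M-j)k}, the exponential is a product of M linear
-- factors, and its coefficient of degree M is the product of their leading coefficients.
theorem expCoeff_cK (M : ℕ) : expCoeff (cK q 1 (q⁻¹ ^ M)) M =
    ∏ j ∈ Finset.range M, -(q⁻¹ ^ (M - j)) := by
  have hq := h.q_ne_zero
  have h1 : expPS (cK q 1 (q⁻¹ ^ M)) =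
      ∏ j ∈ Finset.range M, (1 - PowerSeries.C (q⁻¹ ^ (M - j)) * PowerSeries.X) := by
    rw [← Finset.prod_congr rfl fun j _ => expPS_neg_geom (K := F) (S := F) (q⁻¹ ^ (M - j)),
      ← expPS_sum]
    congr 1
    funext k
    have hk : ((k : ℕ) : F) ≠ 0 := by simp
    have h2 : 1 - q ^ (k : ℕ) ≠ 0 := sub_ne_zero.2 (h.q_pow_ne_one k).symm
    rw [cK, div_eq_iff (mul_ne_zero hk h2), Finset.sum_mul]
    have h3 : ∀ j ∈ Finset.range M, -(algebraMap F F ((k : ℕ) : F)⁻¹ * (q⁻¹ ^ (M - j)) ^ (k : ℕ)) *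
        (((k : ℕ) : F) * (1 - q ^ (k : ℕ))) =
        -(q⁻¹ ^ M) ^ (k : ℕ) * ((1 - q ^ (k : ℕ)) * (q ^ (k : ℕ)) ^ j) := by
      intro j hj
      have hj' := (Finset.mem_range.1 hj).le
      have h4 : q⁻¹ ^ M = q⁻¹ ^ (M - j) * q⁻¹ ^ j := by rw [← pow_add, Nat.sub_add_cancel hj']
      rw [h4, mul_pow, Algebra.algebraMap_self, RingHom.id_apply, inv_pow q j, ← pow_mul q k j,
        mul_comm (k : ℕ) j, pow_mul q j k, inv_pow (q ^ j)]
      have h5 : (q ^ j) ^ (k : ℕ) ≠ 0 := pow_ne_zero _ (pow_ne_zero _ hq)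
      field_simp
    rw [Finset.sum_congr rfl h3, ← Finset.mul_sum, ← Finset.mul_sum, mul_neg_geom_sum]
    have h6 : (q⁻¹ ^ M) ^ (k : ℕ) * (q ^ (k : ℕ)) ^ M = 1 := by
      rw [← pow_mul, ← pow_mul, mul_comm (k : ℕ) M, ← mul_pow, inv_mul_cancel₀ hq, one_pow]
    linear_combination -h6
  have h2 := congrArg (PowerSeries.coeff M) h1
  rwa [expPS, PowerSeries.coeff_mk, coeff_prod_one_sub] at h2

/-- The coefficient of x^M in one variable is extracted from the Cauchy identity with y = q^{-M},
and P_ρ is compared on both sides. Partitions with first part below M contribute nothing by degree,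
those above M because their evaluation vanishes, and those with first part M lose that row by
`tz_macP`. -/
theorem macC_div_macNorm_row {n m M : ℕ} (ν : n.Partition) (ρ : m.Partition)
    (hνρ : rows ν = M :: rows ρ) :
    evxy t 1 (q⁻¹ ^ M) (macP h ν) / macNorm h ν =
      (∏ j ∈ Finset.range M, -(q⁻¹ ^ (M - j))) *
        (evxy t 1 (q⁻¹ ^ M) (macP h ρ) / macNorm h ρ) := by
  classical
  have hq := h.q_ne_zero
  have hn : n = M + m := by rw [← sum_rows ν, hνρ, List.sum_cons, sum_rows]
  have h1 : tz (fun _ => 1) M (hs (cK q 1 (q⁻¹ ^ M)) n) =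
      C (expCoeff (cK q 1 (q⁻¹ ^ M)) M) * hs (cK q 1 (q⁻¹ ^ M)) m := by
    rw [tz_natCast, tau_hs, Polynomial.finsetSum_coeff, Finset.sum_eq_single M]
    · simp only [mul_one, Polynomial.coeff_C_mul_X_pow, if_true]
      rw [hn, Nat.add_sub_cancel_left]
    · intro b _ hb
      rw [Polynomial.coeff_C_mul_X_pow, if_neg (Ne.symm hb)]
    · intro h0
      exact absurd (Finset.mem_range.2 (by omega)) h0
  rw [hs_cK_eq_comb h, hs_cK_eq_comb h, expCoeff_cK h, comb_apply, map_sum] at h1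
  have h2 := congrArg (fun f => form (bM q t) f (macP h ρ)) h1
  simp only [map_sum, LinearMap.sum_apply, map_smul, LinearMap.smul_apply, ← smul_eq_C_mul,
    smul_eq_mul, comb_apply] at h2
  rw [Finset.sum_eq_single ν, Finset.sum_eq_single ρ, tz_macP h ν ρ hνρ] at h2
  · rw [← mul_assoc] at h2
    exact mul_right_cancel₀ (macNorm_ne_zero h ρ) h2
  · intro b _ hb
    rw [form_macP h (fun he => hb (by simpa using he)), mul_zero]
  · simp
  · intro μ _ hμ
    rcases lt_trichotomy ((rows μ).getD 0 0) M with h3 | h3 | h3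
    · rw [tz_macP_eq_zero h μ h3, map_zero, LinearMap.zero_apply, mul_zero]
    · by_cases hn0 : n = 0
      · subst hn0
        exact absurd (Subsingleton.elim _ _) hμ
      · obtain ⟨M', m', ρ', hn', _, hr⟩ := exists_remove_row hn0 μ
        rw [hr, List.getD_cons_zero] at h3
        subst h3
        obtain rfl : m' = m := by omega
        rw [tz_macP h μ ρ' hr, form_macP h, mul_zero]
        intro he
        obtain rfl : ρ' = ρ := by simpa using he
        exact hμ (rows_injective (hr.trans hνρ.symm))
    -- A first row longer than M contains the box of content q^M, whose factor 1 - q^{-M} q^M is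
    -- zero.
    · rw [evxy_macP, Finset.prod_eq_zero (i := (0, M))]
      · simp
      · rw [mem_diagram]; exact h3
      · simp only [content, Algebra.algebraMap_self, RingHom.id_apply, pow_zero, mul_one]
        rw [← mul_pow, inv_mul_cancel₀ hq, one_pow, sub_self]
  · simp

/-- The value of the dual Macdonald polynomial at `p_k ↦ 1 / (1 - t^k)`. -/
theorem macC_div_macNorm {n : ℕ} (μ : n.Partition) : macC h μ / macNorm h μ =
    ∏ s ∈ (diagram μ).cells, t ^ s.1 / (1 - q ^ (arm μ s + 1) * t ^ leg μ s) := by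
  have ht := h.t_ne_zero
  have hq := h.q_ne_zero
  induction n using Nat.strong_induction_on with
  | _ n ih =>
    by_cases hn : n = 0
    · subst hn
      have h2 : (diagram μ).cells = ∅ := by rw [← Finset.card_eq_zero, card_diagram]
      have h3 : form (bM q t) (1 : MvPolynomial ℕ+ F) 1 = 1 := by rw [form_one, coeff_zero_one]
      rw [h2, Finset.prod_empty, macC, macNorm, macP_zero, map_one, h3, div_one]
    · obtain ⟨M, m, ρ, hmn, hM, hr⟩ := exists_remove_row hn μ
      have h1 := macC_div_macNorm_row h μ ρ hr
      have hg0 : (rows μ).getD 0 0 = M := by rw [hr, List.getD_cons_zero]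
      have hgs : ∀ i, (rows μ).getD (i + 1) 0 = (rows ρ).getD i 0 := by
        intro i; rw [hr, List.getD_cons_succ]
      have hgρ : (rows ρ).getD 0 0 ≤ M := by
        rw [← hgs, ← hg0]; exact getD_rows_anti μ (Nat.zero_le _)
      have hcol : ∀ j < M, (diagram μ).colLen j = (diagram ρ).colLen j + 1 := by
        intro j hj
        refine eq_of_forall_lt_iff fun i => ?_
        rw [lt_colLen_diagram]
        cases i with
        | zero => rw [hg0]; simp [hj]
        | succ i => rw [hgs, ← lt_colLen_diagram]; omega
      have hcell : ∀ i, ∀ j < M, 1 - q⁻¹ ^ M * content q t (i, j) =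
          -(q⁻¹ ^ (M - j)) * ((1 - q ^ (M - j) * t ^ i) / t ^ i) := by
        intro i j hj
        have h4 : q⁻¹ ^ M = q⁻¹ ^ (M - j) * q⁻¹ ^ j := by rw [← pow_add, Nat.sub_add_cancel hj.le]
        rw [content, h4]
        simp only [inv_pow]
        field_simp
        ring
      have hne : ∀ i, ∀ j < M, 1 - q ^ (M - j) * t ^ i ≠ 0 := by
        intro i j hj
        rw [sub_ne_zero, ne_comm]
        exact h.pow_mul_pow_ne_one (Or.inl (by omega))
      rw [evxy_macP, evxy_macP] at h1
      simp only [Algebra.algebraMap_self, RingHom.id_apply] at h1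
      rw [prod_diagram_col μ hg0.le, prod_diagram_col ρ hgρ] at h1
      have hprod : ∏ j ∈ Finset.range M, ∏ i ∈ Finset.range ((diagram μ).colLen j),
          (1 - q⁻¹ ^ M * content q t (i, j)) =
          (∏ j ∈ Finset.range M, ∏ i ∈ Finset.range ((diagram ρ).colLen j),
            (1 - q⁻¹ ^ M * content q t (i, j))) *
          ((∏ j ∈ Finset.range M, -(q⁻¹ ^ (M - j))) *
            ∏ j ∈ Finset.range M, ((1 - q ^ (M - j) * t ^ (diagram ρ).colLen j) /
              t ^ (diagram ρ).colLen j)) := by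
        rw [← Finset.prod_mul_distrib, ← Finset.prod_mul_distrib]
        refine Finset.prod_congr rfl fun j hj => ?_
        rw [Finset.mem_range] at hj
        rw [hcol j hj, Finset.prod_range_succ, hcell _ j hj]
      rw [hprod] at h1
      have hne0 : ∏ j ∈ Finset.range M, -(q⁻¹ ^ (M - j)) ≠ 0 :=
        Finset.prod_ne_zero_iff.2 fun j _ => neg_ne_zero.2 (pow_ne_zero _ (inv_ne_zero hq))
      have hne1 : ∏ j ∈ Finset.range M, ∏ i ∈ Finset.range ((diagram ρ).colLen j),
            (1 - q⁻¹ ^ M * content q t (i, j)) ≠ 0 := by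
        refine Finset.prod_ne_zero_iff.2 fun j hj => Finset.prod_ne_zero_iff.2 fun i _ => ?_
        rw [Finset.mem_range] at hj
        rw [hcell i j hj]
        exact mul_ne_zero (neg_ne_zero.2 (pow_ne_zero _ (inv_ne_zero hq)))
          (div_ne_zero (hne i j hj) (pow_ne_zero _ ht))
      have hne2 : ∏ j ∈ Finset.range M, ((1 - q ^ (M - j) * t ^ (diagram ρ).colLen j) /
          t ^ (diagram ρ).colLen j) ≠ 0 := by
        refine Finset.prod_ne_zero_iff.2 fun j hj => ?_
        exact div_ne_zero (hne _ j (Finset.mem_range.1 hj)) (pow_ne_zero _ ht)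
      have h2 : macC h μ / macNorm h μ * ∏ j ∈ Finset.range M,
          ((1 - q ^ (M - j) * t ^ (diagram ρ).colLen j) / t ^ (diagram ρ).colLen j) =
          macC h ρ / macNorm h ρ := by
        apply mul_left_cancel₀ hne0
        apply mul_left_cancel₀ hne1
        simp only [mul_div_right_comm] at h1 ⊢
        linear_combination h1
      have hlen : (rows μ).length ≤ (rows ρ).length + 1 := by rw [hr]; simp
      have hsplit : ∀ g : ℕ × ℕ → F, ∏ s ∈ (diagram μ).cells, g s =
          (∏ s ∈ (diagram ρ).cells, g (s.1 + 1, s.2)) * ∏ j ∈ Finset.range M, g (0, j) := by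
        intro g
        rw [prod_diagram μ hlen, Finset.prod_range_succ', hg0, prod_diagram ρ le_rfl]
        simp only [hgs]
      have htp : ∏ s ∈ (diagram ρ).cells, t = ∏ j ∈ Finset.range M, t ^ (diagram ρ).colLen j := by
        rw [prod_diagram_col ρ hgρ]
        simp
      rw [eq_div_of_mul_eq hne2 h2, ih m (by omega) ρ, hsplit, div_eq_mul_inv,
        ← Finset.prod_inv_distrib]
      have e1 : ∏ j ∈ Finset.range M, ((1 - q ^ (M - j) * t ^ (diagram ρ).colLen j) /
          t ^ (diagram ρ).colLen j)⁻¹ = (∏ s ∈ (diagram ρ).cells, t) *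
          ∏ j ∈ Finset.range M, (t ^ (0, j).1 /
            (1 - q ^ (arm μ (0, j) + 1) * t ^ leg μ (0, j))) := by
        rw [htp, ← Finset.prod_mul_distrib]
        refine Finset.prod_congr rfl fun j hj => ?_
        rw [Finset.mem_range] at hj
        simp only [arm, leg, rowLen_diagram, hg0, hcol j hj, pow_zero, inv_div, zero_add,
          Nat.add_sub_cancel]
        rw [show M - (j + 1) + 1 = M - j by omega]
        ring
      rw [e1, ← mul_assoc, ← Finset.prod_mul_distrib]
      congr 1
      refine Finset.prod_congr rfl fun s hs => ?_
      rw [mem_diagram] at hs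
      have hs2 : s.2 < M := lt_of_lt_of_le hs ((getD_rows_anti ρ (Nat.zero_le _)).trans hgρ)
      simp only [arm, leg, rowLen_diagram, hgs, hcol _ hs2, Nat.add_sub_add_right, pow_succ]
      ring

end Products

end MacFock

namespace MacFock
open MvPolynomial MacVertex

/-! ### The Macdonald polynomials over `ℂ(q,t)` -/

section Fqt

theorem generic_q_t : Generic MacVertex.q MacVertex.t := by
  classical
  have hinj := IsFractionRing.injective (MvPolynomial (Fin 2) ℂ) Fqt
  have hq : MacVertex.q ≠ 0 := fun h0 => X_ne_zero (R := ℂ) (0 : Fin 2)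
    (hinj (by rw [map_zero]; exact h0))
  have ht : MacVertex.t ≠ 0 := fun h0 => X_ne_zero (R := ℂ) (1 : Fin 2)
    (hinj (by rw [map_zero]; exact h0))
  rw [Generic, linearIndependent_iff']
  intro s g hg p hp
  -- Multiplication by q^K t^K clears the negative exponents of the finite relation, reducing it to
  -- independence of monomials in the polynomial ring.
  set K : ℕ := ∑ p ∈ s, (p.1.natAbs + p.2.natAbs)
  have hK : ∀ p ∈ s, 0 ≤ p.1 + K ∧ 0 ≤ p.2 + K := by
    intro p hp
    have : p.1.natAbs + p.2.natAbs ≤ K := Finset.single_le_sum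
      (f := fun p : ℤ × ℤ => p.1.natAbs + p.2.natAbs) (fun _ _ => Nat.zero_le _) hp
    omega
  let e : ℤ × ℤ → Fin 2 →₀ ℕ := fun p =>
    Finsupp.single 0 (p.1 + K).toNat + Finsupp.single 1 (p.2 + K).toNat
  have he : ∀ p ∈ s, MacVertex.q ^ K * MacVertex.t ^ K *
      (MacVertex.q ^ p.1 * MacVertex.t ^ p.2) =
      algebraMap (MvPolynomial (Fin 2) ℂ) Fqt (monomial (e p) 1) := by
    intro p hp
    obtain ⟨h1, h2⟩ := hK p hp
    have h3 : (monomial (e p) 1 : MvPolynomial (Fin 2) ℂ) =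
        X 0 ^ (p.1 + K).toNat * X 1 ^ (p.2 + K).toNat := by
      rw [X_pow_eq_monomial, X_pow_eq_monomial, monomial_mul, one_mul]
    rw [h3, map_mul, map_pow, map_pow]
    change _ = MacVertex.q ^ (p.1 + K).toNat * MacVertex.t ^ (p.2 + K).toNat
    rw [← zpow_natCast MacVertex.q (p.1 + K).toNat, ← zpow_natCast MacVertex.t (p.2 + K).toNat,
      Int.toNat_of_nonneg h1, Int.toNat_of_nonneg h2, zpow_add₀ hq, zpow_add₀ ht, zpow_natCast,
      zpow_natCast]
    ring
  have h1 : ∑ p ∈ s, (g p : MvPolynomial (Fin 2) ℂ) * monomial (e p) 1 = 0 := by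
    apply hinj
    rw [map_zero, map_sum]
    have h2 := congrArg (MacVertex.q ^ K * MacVertex.t ^ K * ·) hg
    simp only [mul_zero, Finset.mul_sum] at h2
    rw [← h2]
    refine Finset.sum_congr rfl fun p hp => ?_
    rw [map_mul, ← he p hp, map_intCast, zsmul_eq_mul]
    ring
  have h2 := congrArg (coeff (e p)) h1
  rw [coeff_sum, coeff_zero, Finset.sum_eq_single p] at h2
  · have h3 : (g p : MvPolynomial (Fin 2) ℂ) = C (g p : ℂ) := by simp
    rw [h3, coeff_C_mul, coeff_monomial, if_pos rfl, mul_one] at h2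
    exact_mod_cast h2
  · intro p' hp' hne
    have h3 : (g p' : MvPolynomial (Fin 2) ℂ) = C (g p' : ℂ) := by simp
    rw [h3, coeff_C_mul, coeff_monomial, if_neg, mul_zero]
    intro hee
    apply hne
    have e0 := DFunLike.congr_fun hee 0
    have e1 := DFunLike.congr_fun hee 1
    simp [e] at e0 e1
    have := hK p hp
    have := hK p' hp'
    ext <;> omega
  · exact fun h0 => absurd hp h0

theorem scalarQT_eq_form (f g : Lam) :
    scalarQT f g = form (bM MacVertex.q MacVertex.t) f g := by
  rw [form_eq_sum]; rfl

theorem toVars_eq_tv (N : ℕ) (f : Lam) : toVars N f = tv N f := rfl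

theorem isMacdonaldFamily_macP : IsMacdonaldFamily fun μ => macP generic_q_t μ.2 where
  triangular n lam := ⟨fun μ => kap (rows μ) (macP generic_q_t lam), kap_rows_macP _ lam,
    fun _ hμ => domLE_of_kap_macP _ lam hμ,
    fun N => by rw [toVars_eq_tv]; exact tv_eq_sum_msymm (isHom_macP _ lam) N⟩
  orthogonal lam μ hne := by rw [scalarQT_eq_form]; exact form_macP _ hne

theorem IsMacdonaldFamily.isHom {P : Ptn → Lam} (hP : IsMacdonaldFamily P) {n : ℕ}
    (lam : n.Partition) : IsHom (P ⟨n, lam⟩) n ∧ kap (rows lam) (P ⟨n, lam⟩) = 1 ∧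
      ∀ μ : n.Partition, kap (rows μ) (P ⟨n, lam⟩) ≠ 0 → DomLE μ lam := by
  obtain ⟨c, hc1, hc2, hc3⟩ := hP.triangular n lam
  -- The triangularity condition speaks only of finitely many variables. A homogeneous f with the
  -- same monomial coefficients is compared with P_λ in all numbers of variables at once.
  obtain ⟨f, hf, hk⟩ := exists_kap_rows c
  have h1 : P ⟨n, lam⟩ = f := by
    refine sub_eq_zero.1 (eq_zero_of_kap fun l => ?_)
    have h2 := hc3 l.length
    simp only [toVars_eq_tv, ← hk] at h2
    rw [← tv_eq_sum_msymm hf] at h2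
    have h3 := coeff_tv l.length (Finsupp.equivFunOnFinite.symm fun i => l.get i) (P ⟨n, lam⟩ - f)
    rw [map_sub, h2, sub_self, coeff_zero, Finsupp.coe_equivFunOnFinite_symm, List.ofFn_get] at h3
    exact h3.symm
  rw [h1]
  exact ⟨hf, by rw [hk, hc1], fun μ hμ => hc2 μ (by rwa [hk] at hμ)⟩

/-- By induction on `domRank`, the difference from `macP` is a combination whose top term lies
strictly below λ. There the two families agree already, and orthogonality to both kills that term.
-/
theorem IsMacdonaldFamily.eq_macP {P : Ptn → Lam} (hP : IsMacdonaldFamily P) {n : ℕ}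
    (lam : n.Partition) : P ⟨n, lam⟩ = macP generic_q_t lam := by
  classical
  set h := generic_q_t
  have key : ∀ (k : ℕ) (lam : n.Partition), domRank lam = k → P ⟨n, lam⟩ = macP h lam := by
    intro k
    induction k using Nat.strong_induction_on with
    | _ k ih =>
      intro lam hk
      obtain ⟨hh, hl, hd⟩ := IsMacdonaldFamily.isHom hP lam
      have hsub : IsHom (P ⟨n, lam⟩ - macP h lam) n :=
        (weightedHomogeneousSubmodule Fqt _ _).sub_mem hh (isHom_macP h lam)
      obtain ⟨b, hb⟩ := exists_eq_comb h hsub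
      rw [← sub_eq_zero, hb]
      suffices hb0 : b = 0 by rw [hb0, map_zero]
      by_contra hb0
      have hne : (Finset.univ.filter fun μ => b μ ≠ 0).Nonempty := by
        by_contra h'
        rw [Finset.not_nonempty_iff_eq_empty, Finset.filter_eq_empty_iff] at h'
        exact hb0 (funext fun μ => by simpa using h' (Finset.mem_univ μ))
      obtain ⟨μ, hμ, hmax⟩ := Finset.exists_max_image _ domRank hne
      simp only [Finset.mem_filter, Finset.mem_univ, true_and] at hμ hmax
      have h1 : kap (rows μ) (comb h b) = b μ := by
        rw [comb_apply, map_sum, Finset.sum_eq_single μ, map_smul, kap_rows_macP, smul_eq_mul,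
          mul_one]
        · intro ν _ hν
          by_contra h0
          rw [map_smul, smul_eq_mul] at h0
          have h3 := domRank_lt (domLE_of_kap_macP h ν (right_ne_zero_of_mul h0)) hν.symm
          have h4 := hmax ν (left_ne_zero_of_mul h0)
          omega
        · simp
      have hμl : μ ≠ lam := by
        rintro rfl
        rw [← hb, map_sub, hl, kap_rows_macP, sub_self] at h1
        exact hμ h1.symm
      have hdom : DomLE μ lam := by
        by_contra h0
        rw [← hb, map_sub] at h1
        have e1 : kap (rows μ) (P ⟨n, lam⟩) = 0 := by
          by_contra h2; exact h0 (hd μ h2)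
        have e2 : kap (rows μ) (macP h lam) = 0 := by
          by_contra h2; exact h0 (domLE_of_kap_macP h lam h2)
        rw [e1, e2, sub_self] at h1
        exact hμ h1.symm
      have hlt := domRank_lt hdom hμl
      have hPμ := ih (domRank μ) (by omega) μ rfl
      have h2 : form (bM MacVertex.q MacVertex.t) (comb h b) (macP h μ) = b μ * macNorm h μ := by
        rw [comb_apply, map_sum, LinearMap.sum_apply, Finset.sum_eq_single μ]
        · rw [map_smul, LinearMap.smul_apply, smul_eq_mul, macNorm]
        · intro ν _ hν
          rw [map_smul, LinearMap.smul_apply, form_macP h (fun he => hν (by simpa using he)),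
            smul_zero]
        · simp
      have h3 := hP.orthogonal ⟨n, lam⟩ ⟨n, μ⟩ (fun he => hμl (by simpa using he.symm))
      rw [scalarQT_eq_form, hPμ] at h3
      rw [← hb, map_sub, LinearMap.sub_apply, h3,
        form_macP h (fun he => hμl (by simpa using he.symm)), sub_self] at h2
      exact mul_ne_zero hμ (macNorm_ne_zero h μ) h2.symm
  exact key _ lam rfl

theorem macdonaldP_eq {n : ℕ} (μ : n.Partition) : macdonaldP ⟨n, μ⟩ = macP generic_q_t μ :=
  IsMacdonaldFamily.eq_macP (Classical.epsilon_spec ⟨_, isMacdonaldFamily_macP⟩) μ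

end Fqt

/-! ### The weights of the bracket -/

section Weights
variable {L : Type*} [Field L] [CharZero L] [Algebra Fqt L]

/-- Reversing each row exchanges arms and co-arms. -/
theorem prod_pow_arm {M : Type*} [CommMonoid M] (x : M) {n : ℕ} (μ : n.Partition) :
    ∏ s ∈ (diagram μ).cells, x ^ arm μ s = ∏ s ∈ (diagram μ).cells, x ^ s.2 := by
  rw [prod_diagram μ le_rfl, prod_diagram μ le_rfl]
  refine Finset.prod_congr rfl fun i _ => ?_
  rw [← Finset.prod_range_reflect]
  refine Finset.prod_congr rfl fun j hj => ?_
  rw [Finset.mem_range] at hj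
  simp only [arm, rowLen_diagram]
  congr 1
  omega

theorem prod_pow_leg {M : Type*} [CommMonoid M] (x : M) {n : ℕ} (μ : n.Partition) :
    ∏ s ∈ (diagram μ).cells, x ^ leg μ s = ∏ s ∈ (diagram μ).cells, x ^ s.1 := by
  rw [prod_diagram_col μ le_rfl, prod_diagram_col μ le_rfl]
  refine Finset.prod_congr rfl fun j _ => ?_
  rw [← Finset.prod_range_reflect]
  refine Finset.prod_congr rfl fun i hi => ?_
  rw [Finset.mem_range] at hi
  simp only [leg]
  congr 1
  omega

theorem evxy_div_macNorm (v : L) {n : ℕ} (μ : n.Partition) :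
    evxy MacVertex.t (-v) (-1) (macP generic_q_t μ) /
      algebraMap Fqt L (macNorm generic_q_t μ) = vWeight v μ := by
  have hG := generic_q_t
  have ht : algebraMap Fqt L MacVertex.t ≠ 0 := (map_ne_zero _).2 hG.t_ne_zero
  rw [evxy_macP, mul_div_right_comm, ← map_div₀, macC_div_macNorm, map_prod, vWeight,
    ← Finset.prod_mul_distrib]
  refine Finset.prod_congr rfl fun s _ => ?_
  simp only [content, coarm, coleg, map_div₀, map_mul, map_sub, map_pow, map_one, map_inv₀]
  rw [mul_comm (algebraMap Fqt L MacVertex.q ^ (arm μ s + 1))]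
  have h1 : algebraMap Fqt L MacVertex.t ^ s.1 * (-v - -1 * (algebraMap Fqt L MacVertex.q ^ s.2 *
      (algebraMap Fqt L MacVertex.t)⁻¹ ^ s.1)) =
      algebraMap Fqt L MacVertex.q ^ s.2 - v * algebraMap Fqt L MacVertex.t ^ s.1 := by
    rw [inv_pow]
    field_simp
    ring
  rw [← h1]
  ring

/-- Box by box the two sides differ by powers of q and t with exponents arm minus co-arm and leg
minus co-leg; these cancel only in the product over the whole diagram. -/
theorem evxy_macP_eq_uWeight {u : L} (hu : u ≠ 0) {n : ℕ} (μ : n.Partition) :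
    evxy MacVertex.t (-algebraMap Fqt L MacVertex.t) (-(algebraMap Fqt L MacVertex.t * u))
      (macP generic_q_t μ) = (-u) ^ n * uWeight u μ := by
  have hG := generic_q_t
  have ht : algebraMap Fqt L MacVertex.t ≠ 0 := (map_ne_zero _).2 hG.t_ne_zero
  have hq : algebraMap Fqt L MacVertex.q ≠ 0 := (map_ne_zero _).2 hG.q_ne_zero
  rw [evxy_macP, macC_eq, map_prod, uWeight, ← Finset.prod_mul_distrib]
  have hn : (-u) ^ n = ∏ s ∈ (diagram μ).cells, (-u) := by
    rw [Finset.prod_const, card_diagram]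
  rw [hn, ← Finset.prod_mul_distrib]
  simp only [content, coarm, coleg, map_div₀, map_mul, map_sub, map_pow, map_one, map_inv₀]
  set Q := algebraMap Fqt L MacVertex.q
  set T := algebraMap Fqt L MacVertex.t
  have hne : ∀ s, 1 - Q ^ arm μ s * T ^ (leg μ s + 1) ≠ 0 := by
    intro s
    simp only [Q, T]
    rw [← map_pow, ← map_pow, ← map_mul, ← map_one (algebraMap Fqt L), ← map_sub, map_ne_zero,
      sub_ne_zero, ne_comm]
    exact hG.pow_mul_pow_ne_one (Or.inr (by omega))
  have h1 : ∀ s : ℕ × ℕ, -u * (((T ^ s.1)⁻¹ - u⁻¹ * (Q ^ s.2)⁻¹) /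
      (1 - (Q ^ arm μ s)⁻¹ * (T ^ (leg μ s + 1))⁻¹)) =
      (T ^ s.1 / (1 - Q ^ arm μ s * T ^ (leg μ s + 1)) * (-T - -(T * u) * (Q ^ s.2 * T⁻¹ ^ s.1))) *
        (Q ^ arm μ s * (Q ^ s.2)⁻¹ * (T ^ leg μ s * (T ^ s.1)⁻¹)) := by
    intro s
    have h2 : 1 - (Q ^ arm μ s)⁻¹ * (T ^ (leg μ s + 1))⁻¹ =
        -((1 - Q ^ arm μ s * T ^ (leg μ s + 1)) / (Q ^ arm μ s * T ^ (leg μ s + 1))) := by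
      field_simp
      ring
    have h3 := hne s
    rw [h2, inv_pow]
    set D := 1 - Q ^ arm μ s * T ^ (leg μ s + 1)
    rw [pow_succ]
    field_simp
    ring
  rw [Finset.prod_congr rfl fun s _ => h1 s, Finset.prod_mul_distrib (s := (diagram μ).cells)
    (g := fun s => Q ^ arm μ s * (Q ^ s.2)⁻¹ * (T ^ leg μ s * (T ^ s.1)⁻¹))]
  have h4 : ∏ s ∈ (diagram μ).cells, (Q ^ arm μ s * (Q ^ s.2)⁻¹ * (T ^ leg μ s * (T ^ s.1)⁻¹)) = 1 := by
    rw [Finset.prod_mul_distrib, Finset.prod_mul_distrib, Finset.prod_mul_distrib, prod_pow_arm,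
      prod_pow_leg, ← Finset.prod_mul_distrib, ← Finset.prod_mul_distrib]
    rw [Finset.prod_eq_one, Finset.prod_eq_one, one_mul]
    · intro s _; exact mul_inv_cancel₀ (pow_ne_zero _ ht)
    · intro s _; exact mul_inv_cancel₀ (pow_ne_zero _ hq)
  rw [h4, mul_one]

/-- The generating function of the weighted values of the Macdonald polynomials. -/
theorem sum_vWeight_smul {S : Type*} [CommRing S] [Algebra Fqt S] [Algebra L S]
    [IsScalarTower Fqt L S] [Algebra ℚ S] (v : L) (Θ : Lam →ₐ[Fqt] S) (n : ℕ) :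
    ∑ μ : n.Partition, vWeight v μ • Θ (macP generic_q_t μ) =
      expCoeff (fun k => cK (algebraMap Fqt L MacVertex.q) (-v) (-1) k • Θ (X k)) n := by
  let Θ' : MvPolynomial ℕ+ L →ₐ[L] S := aeval fun k => Θ (X k)
  have hΘ : ∀ f : Lam, Θ' (map (algebraMap Fqt L) f) = Θ f := by
    intro f
    induction f using MvPolynomial.induction_on with
    | C a =>
      rw [map_C, ← algebraMap_eq, ← algebraMap_eq, AlgHom.commutes, AlgHom.commutes,
        ← IsScalarTower.algebraMap_apply]
    | add f g hf hg => rw [map_add, map_add, map_add, hf, hg]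
    | mul_X f k hf => rw [map_mul, map_mul, map_mul, hf, map_X, aeval_X]
  have h1 := congrArg Θ' (hs_cK_eq_sum generic_q_t (-v) (-1) n)
  rw [hs, map_expCoeff Θ', map_sum] at h1
  simp only [← smul_eq_C_mul, map_smul, hΘ, evxy_div_macNorm] at h1
  rw [← h1]
  congr 1
  funext k
  rw [aeval_X]

end Weights

end MacFock

namespace MacFock
open MvPolynomial MacVertex

/-! ### Exponentials of multivariate power series -/

theorem iterCT_eq {R : Type*} : ∀ (r : ℕ) (G : Laurent r R), iterCT r G = G 0
  | 0, G => congrArg G (Subsingleton.elim _ _)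
  | r + 1, G => by
    rw [iterCT, iterCT_eq r]
    congr 1
    funext i
    refine Fin.lastCases ?_ (fun j => ?_) i <;> simp

section Exponential
variable {r : ℕ} {R : Type*} [CommRing R] [Algebra ℚ R]

theorem coeff_expS {G : MvPowerSeries (Fin r) R} (hG : MvPowerSeries.constantCoeff G = 0)
    {m : Fin r →₀ ℕ} {M : ℕ} (hM : m.degree < M) :
    MvPowerSeries.coeff m (expS G) =
      MvPowerSeries.coeff m (∑ d ∈ Finset.range M, algebraMap ℚ R (1 / d.factorial) • G ^ d) := by
  have hs : PowerSeries.HasSubst G := PowerSeries.HasSubst.of_constantCoeff_zero hG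
  rw [expS, PowerSeries.coeff_subst hs, finsum_eq_sum_of_support_subset (s := Finset.range M)]
  · rw [map_sum]
    refine Finset.sum_congr rfl fun d _ => ?_
    rw [PowerSeries.coeff_exp, MvPowerSeries.coeff_smul]
    simp [Algebra.smul_def]
  · intro d hd
    rw [Finset.coe_range, Set.mem_Iio]
    by_contra h
    refine hd ?_
    have h1 : MvPowerSeries.coeff m (G ^ d) = 0 :=
      MvPowerSeries.coeff_eq_zero_of_constantCoeff_nilpotent (m := 1) (by rw [hG, pow_one])
        (by omega)
    change _ • MvPowerSeries.coeff m (G ^ d) = 0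
    rw [h1, smul_zero]

theorem pderiv_sum_exp (G : MvPowerSeries (Fin r) R) (α : Fin r) (M : ℕ) :
    MvPowerSeries.pderiv R α
        (∑ d ∈ Finset.range (M + 1), algebraMap ℚ R (1 / d.factorial) • G ^ d) =
      MvPowerSeries.pderiv R α G *
        ∑ d ∈ Finset.range M, algebraMap ℚ R (1 / d.factorial) • G ^ d := by
  rw [Finset.sum_range_succ', map_add, map_sum, Finset.mul_sum, pow_zero, Derivation.map_smul,
    MvPowerSeries.pderiv_one, smul_zero, add_zero]
  refine Finset.sum_congr rfl fun d _ => ?_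
  rw [Derivation.map_smul, Derivation.leibniz_pow, Nat.add_sub_cancel, smul_eq_mul,
    ← Nat.cast_smul_eq_nsmul R, smul_smul, mul_smul_comm, mul_comm (G ^ d)]
  congr 1
  rw [← map_natCast (algebraMap ℚ R), ← map_mul, Nat.factorial_succ]
  congr 1
  have h1 : ((d + 1 : ℕ) : ℚ) ≠ 0 := by positivity
  have h2 : ((d.factorial : ℕ) : ℚ) ≠ 0 := by positivity
  push_cast at h1 ⊢
  field_simp

theorem pderiv_expS {G : MvPowerSeries (Fin r) R} (hG : MvPowerSeries.constantCoeff G = 0)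
    (α : Fin r) :
    MvPowerSeries.pderiv R α (expS G) = MvPowerSeries.pderiv R α G * expS G := by
  ext n
  have hn : (n + Finsupp.single α 1).degree < n.degree + 1 + 1 := by
    rw [map_add, Finsupp.degree_single]; omega
  rw [MvPowerSeries.coeff_pderiv, coeff_expS hG hn, ← MvPowerSeries.coeff_pderiv, pderiv_sum_exp,
    MvPowerSeries.coeff_mul, MvPowerSeries.coeff_mul]
  refine Finset.sum_congr rfl fun p hp => ?_
  rw [coeff_expS hG (M := n.degree + 1)]
  rw [← Finset.HasAntidiagonal.mem_antidiagonal.1 hp, map_add]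
  omega

theorem coeff_powerSums_zero (c : ℕ+ → R) :
    MvPowerSeries.constantCoeff (powerSums r c) = 0 := by
  change powerSums r c 0 = 0
  simp [powerSums]

theorem coeff_powerSums_add_single (c : ℕ+ → R) (x : Fin r →₀ ℕ) (α : Fin r) :
    MvPowerSeries.coeff (x + Finsupp.single α 1) (powerSums r c) =
      if x = Finsupp.single α (x α) then c (x α).succPNat else 0 := by
  change powerSums r c _ = _
  rw [powerSums, Finset.sum_eq_single α]
  · split_ifs with h1 h2 h2
    · congr 1
      apply PNat.eq
      simp
    · refine absurd ?_ h2
      ext i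
      have := DFunLike.congr_fun h1.2 i
      by_cases hi : α = i
      · subst hi; simp
      · simpa [Finsupp.single_apply, hi] using this
    · refine absurd ⟨by simp, ?_⟩ h1
      conv_lhs => rw [h2]
      simp [Finsupp.single_add]
    · rfl
  · intro β _ hβ
    rw [dif_neg]
    rintro ⟨_, h⟩
    have := DFunLike.congr_fun h α
    simp [hβ] at this
  · simp

/-- Differentiating in z_α multiplies the exponential by a series in z_α alone. The resulting
recursion in the exponent of z_α is that of `expCoeff`, so the coefficients factor over the
variables. -/
theorem coeff_expS_powerSums (c : ℕ+ → R) (a : Fin r →₀ ℕ) :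
    MvPowerSeries.coeff a (expS (powerSums r c)) = ∏ α, expCoeff c (a α) := by
  classical
  induction hD : a.degree using Nat.strong_induction_on generalizing a with
  | _ D ih =>
  by_cases h0 : a = 0
  · subst h0
    rw [coeff_expS (coeff_powerSums_zero c) (M := 1) (by simp)]
    simp [expCoeff_zero]
  · obtain ⟨α, hα⟩ : ∃ α, a α ≠ 0 := by
      by_contra! h
      exact h0 (Finsupp.ext h)
    obtain ⟨n, rfl⟩ : ∃ n, a = n + Finsupp.single α 1 := by
      refine ⟨a - Finsupp.single α 1, ?_⟩
      rw [tsub_add_cancel_of_le]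
      simpa [Nat.one_le_iff_ne_zero] using hα
    rw [map_add, Finsupp.degree_single] at hD
    apply natCast_succ_mul_cancel (n := n α)
    have h1 := congrArg (MvPowerSeries.coeff n) (pderiv_expS (coeff_powerSums_zero c) α)
    rw [MvPowerSeries.coeff_pderiv, mul_comm, MvPowerSeries.coeff_mul] at h1
    rw [h1]
    have hsub : ∀ j ∈ Finset.range (n α + 1), Finsupp.single α j ≤ n := by
      intro j hj
      simpa using Nat.lt_succ_iff.1 (Finset.mem_range.1 hj)
    rw [← Finset.sum_subset (s₁ := (Finset.range (n α + 1)).image fun j =>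
      (Finsupp.single α j, n - Finsupp.single α j)), Finset.sum_image]
    · rw [← Finset.mul_prod_erase _ _ (Finset.mem_univ α), ← mul_assoc]
      have h2 : (n + Finsupp.single α 1 : Fin r →₀ ℕ) α = n α + 1 := by simp
      rw [h2, expCoeff_succ, Finset.sum_mul]
      refine Finset.sum_congr rfl fun j hj => ?_
      have hle := Finset.mem_range.1 hj
      rw [MvPowerSeries.coeff_pderiv, coeff_powerSums_add_single, if_pos (by simp),
        ih (n - Finsupp.single α j).degree ?_ _ rfl,
        ← Finset.mul_prod_erase _ _ (Finset.mem_univ α)]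
      · rw [Finset.prod_congr rfl (g := fun β =>
          expCoeff c ((n + Finsupp.single α 1 : Fin r →₀ ℕ) β))]
        · simp
          ring
        · intro β hβ
          have : α ≠ β := (Finset.ne_of_mem_erase hβ).symm
          simp [this]
      · have := congrArg Finsupp.degree (tsub_add_cancel_of_le (hsub j hj))
        rw [map_add] at this
        omega
    · intro j _ j' _ h
      simpa using congrArg (fun p => p.1 α) h
    · intro p hp
      obtain ⟨j, hj, rfl⟩ := Finset.mem_image.1 hp
      exact Finset.HasAntidiagonal.mem_antidiagonal.2 (add_tsub_cancel_of_le (hsub j hj))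
    · intro p hp hp'
      rw [MvPowerSeries.coeff_pderiv, coeff_powerSums_add_single, if_neg, zero_mul, zero_mul]
      intro h
      apply hp'
      have hn := Finset.HasAntidiagonal.mem_antidiagonal.1 hp
      refine Finset.mem_image.2 ⟨p.1 α, ?_, ?_⟩
      · rw [Finset.mem_range, ← hn]
        simp
      · ext1
        · exact h.symm
        · dsimp only
          rw [← h, ← hn, add_tsub_cancel_left]

end Exponential

end MacFock

namespace MacFock
open MvPolynomial MacVertex

/-! ### The annihilation part of the vertex operator -/

section Annihilation
variable (r : ℕ)

/-- The translation `p_n ↦ p_n - (1 - q^n) ∑_α w_α^n`. -/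
def translate : Lam →ₐ[Fqt] MvPolynomial (Fin r) Lam :=
  aeval fun n : ℕ+ => C (X n) + C (C (dM MacVertex.q n)) * ∑ α : Fin r, X α ^ (n : ℕ)

/-- The series `∑_{k < M} D^k / k!` for the derivation `D` of the annihilation part. -/
def annSum (M : ℕ) (g : MvPolynomial (Fin r ⊕ ℕ+) Fqt) : MvPolynomial (Fin r ⊕ ℕ+) Fqt :=
  ∑ k ∈ Finset.range M, (k.factorial : Fqt)⁻¹ • (annihilationD r)^[k] g

theorem iterate_annihilationD_add (k : ℕ) (f g : MvPolynomial (Fin r ⊕ ℕ+) Fqt) :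
    (annihilationD r)^[k] (f + g) = (annihilationD r)^[k] f + (annihilationD r)^[k] g :=
  iterate_map_add (annihilationD r) k f g

theorem annihilationD_X_inr (n : ℕ+) : annihilationD r (X (Sum.inr n)) =
    C (dM MacVertex.q n) * ∑ α : Fin r, X (Sum.inl α) ^ (n : ℕ) := by
  have h : ((n : ℕ) : Fqt) ≠ 0 := Nat.cast_ne_zero.2 n.ne_zero
  rw [annihilationD, mkDerivation_X, Sum.elim_inr, div_mul_cancel₀ _ h, dM, map_neg]
  exact (neg_mul (C (1 - MacVertex.q ^ (n : ℕ))) _).symm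

theorem annihilationD_annihilationD_X_inr (n : ℕ+) :
    annihilationD r (annihilationD r (X (Sum.inr n))) = 0 := by
  rw [annihilationD_X_inr, Derivation.leibniz, derivation_C, smul_zero, add_zero, map_sum,
    Finset.sum_eq_zero, smul_zero]
  intro α _
  rw [Derivation.leibniz_pow, annihilationD, mkDerivation_X]
  simp

theorem iterate_annihilationD_X_mul (n : ℕ+) (g : MvPolynomial (Fin r ⊕ ℕ+) Fqt) (k : ℕ) :
    (annihilationD r)^[k + 1] (g * X (Sum.inr n)) =
      (annihilationD r)^[k + 1] g * X (Sum.inr n) +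
        ((k : Fqt) + 1) • ((annihilationD r)^[k] g * annihilationD r (X (Sum.inr n))) := by
  induction k with
  | zero =>
    simp [Derivation.leibniz, mul_comm, add_comm]
  | succ k ih =>
    rw [Function.iterate_succ_apply', ih, map_add, Derivation.map_smul, Derivation.leibniz,
      Derivation.leibniz, annihilationD_annihilationD_X_inr,
      ← Function.iterate_succ_apply' (annihilationD r) (k + 1),
      ← Function.iterate_succ_apply' (annihilationD r) k]
    simp only [smul_eq_mul, mul_zero, zero_add]
    push_cast
    rw [add_smul, add_smul, add_smul, one_smul,
      mul_comm (annihilationD r (X (Sum.inr n))), mul_comm (X (Sum.inr n))]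
    generalize (annihilationD r)^[k + 1] g = x
    generalize annihilationD r (X (Sum.inr n)) = y
    rw [one_smul, Nat.succ_eq_add_one, add_comm (x * y), add_assoc, add_comm (x * y)]

/-- The derivation D kills each w_α and D² p_n = 0, so exp(D) sends g p_n to exp(D) g times p_n + D
p_n; thus it is the translation. -/
theorem exists_annSum (f : Lam) : ∃ M : ℕ,
    (∀ k, M ≤ k → (annihilationD r)^[k] (rename Sum.inr f) = 0) ∧
      sumAlgEquiv Fqt (Fin r) ℕ+ (annSum r M (rename Sum.inr f)) = translate r f := by
  -- All long truncations are treated together, because the product step needs the truncations at k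
  -- and at k + 1.
  suffices h : ∃ M : ℕ, ∀ k, M ≤ k → (annihilationD r)^[k] (rename Sum.inr f) = 0 ∧
      sumAlgEquiv Fqt (Fin r) ℕ+ (annSum r k (rename Sum.inr f)) = translate r f by
    obtain ⟨M, hM⟩ := h
    exact ⟨M, fun k hk => (hM k hk).1, (hM M le_rfl).2⟩
  induction f using MvPolynomial.induction_on with
  | C a =>
    have h1 : ∀ k, (annihilationD r)^[k + 1] (rename Sum.inr (C a : Lam)) = 0 := by
      intro k
      rw [Function.iterate_succ_apply, rename_C, derivation_C]
      exact iterate_map_zero (annihilationD r) k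
    refine ⟨1, fun k hk => ?_⟩
    obtain ⟨k, rfl⟩ := Nat.exists_eq_add_of_le' hk
    refine ⟨h1 k, ?_⟩
    rw [annSum, Finset.sum_range_succ', Finset.sum_eq_zero (fun i _ => by rw [h1, smul_zero])]
    simp [translate]
  | add f g hf hg =>
    obtain ⟨M, hM⟩ := hf
    obtain ⟨M', hM'⟩ := hg
    refine ⟨max M M', fun k hk => ?_⟩
    obtain ⟨h1, h2⟩ := hM k (le_trans (le_max_left _ _) hk)
    obtain ⟨h3, h4⟩ := hM' k (le_trans (le_max_right _ _) hk)
    constructor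
    · rw [map_add, iterate_annihilationD_add, h1, h3, add_zero]
    · rw [map_add (translate r), ← h2, ← h4, ← map_add]
      congr 1
      simp only [annSum, map_add, iterate_annihilationD_add, smul_add, Finset.sum_add_distrib]
  | mul_X f n hf =>
    obtain ⟨M, hM⟩ := hf
    refine ⟨M + 1, fun k hk => ?_⟩
    obtain ⟨k, rfl⟩ : ∃ j, k = j + 1 := ⟨k - 1, by omega⟩
    rw [map_mul, rename_X]
    constructor
    · rw [iterate_annihilationD_X_mul, (hM _ (by omega)).1, (hM _ (by omega)).1, zero_mul, zero_mul,
        smul_zero, add_zero]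
    · have h1 : annSum r (k + 1) (rename Sum.inr f * X (Sum.inr n)) =
          annSum r (k + 1) (rename Sum.inr f) * X (Sum.inr n) +
            annSum r k (rename Sum.inr f) * annihilationD r (X (Sum.inr n)) := by
        rw [annSum, Finset.sum_range_succ', annSum, Finset.sum_range_succ', annSum]
        simp only [iterate_annihilationD_X_mul]
        rw [add_mul, Finset.sum_mul, Finset.sum_mul, add_right_comm, ← Finset.sum_add_distrib]
        congr 1
        · refine Finset.sum_congr rfl fun j _ => ?_
          rw [smul_add, smul_smul, smul_mul_assoc, smul_mul_assoc]
          congr 2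
          have h2 : ((j : Fqt) + 1) ≠ 0 := Nat.cast_add_one_ne_zero j
          have h3 : ((j.factorial : ℕ) : Fqt) ≠ 0 := Nat.cast_ne_zero.2 j.factorial_ne_zero
          rw [Nat.factorial_succ]
          push_cast
          field_simp
        · simp
      rw [h1, map_add, map_mul, map_mul, (hM _ (by omega)).2, (hM _ (by omega)).2, map_mul,
        ← mul_add, annihilationD_X_inr]
      congr 1
      simp [translate]

theorem annihilate_eq (f : Lam) : annihilate r f = translate r f := by
  obtain ⟨M, h1, h2⟩ := exists_annSum r f
  rw [← h2, annihilate, annSum, finsum_eq_sum_of_support_subset]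
  intro k hk
  rw [Finset.coe_range, Set.mem_Iio]
  by_contra h
  exact hk (by dsimp only; rw [h1 k (by omega), smul_zero])

end Annihilation

end MacFock

namespace MacFock
open MvPolynomial MacVertex

/-! ### Constant terms as finite sums -/

section ConstantTerm
variable {r : ℕ}

/-- The exponents of a monomial, as integers. -/
def toZ (a : Fin r →₀ ℕ) : Fin r → ℤ := fun i => a i

theorem toZ_injective : Function.Injective (toZ (r := r)) := fun a b h => by
  ext i
  exact Int.natCast_inj.1 (congrFun h i)

theorem exists_toZ {e : Fin r → ℤ} (he : ∀ i, 0 ≤ e i) : ∃ a, toZ a = e :=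
  ⟨Finsupp.equivFunOnFinite.symm fun i => (e i).toNat, by
    funext i
    simp [toZ, he i]⟩

theorem ofPos_toZ {R : Type*} [Semiring R] (G : MvPowerSeries (Fin r) R) (a : Fin r →₀ ℕ) :
    ofPos G (toZ a) = MvPowerSeries.coeff a G := by
  rw [ofPos, if_pos (fun i => by simp [toZ])]
  congr 1
  congr 1
  ext i
  simp [toZ]

theorem ofPos_of_forall_ne {R : Type*} [Semiring R] (G : MvPowerSeries (Fin r) R) {e : Fin r → ℤ}
    (he : ∀ a, toZ a ≠ e) : ofPos G e = 0 := by
  rw [ofPos, if_neg]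
  intro h
  obtain ⟨a, ha⟩ := exists_toZ h
  exact he a ha

/-- Both the realization of `A` and the claimed formula are constant terms of a kernel times a
creation series in z and a series in z⁻¹. The finite sets bound the exponents that matter, so the
formal sums may be reordered; in the constant term the kernel exponent is b - a. -/
theorem coeff_iterCT_mulL {σ L : Type*} [Field L] [Algebra Fqt L] (K : Laurent r Fqt)
    (W : MvPowerSeries (Fin r) (MvPowerSeries σ L)) (H : Laurent r (MvPowerSeries σ L))
    (hH : ∀ e, (∀ b, -toZ b ≠ e) → H e = 0) (m : σ →₀ ℕ) (SA SB : Finset (Fin r →₀ ℕ))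
    (hA : ∀ a b, MvPowerSeries.coeff m (MvPowerSeries.coeff a W * H (-toZ b)) ≠ 0 → a ∈ SA)
    (hB : ∀ a b, K (toZ b - toZ a) ≠ 0 →
      MvPowerSeries.coeff m (MvPowerSeries.coeff a W * H (-toZ b)) ≠ 0 → b ∈ SB) :
    MvPowerSeries.coeff m (iterCT r (mulL (scal σ L K) (mulL (ofPos W) H))) =
      ∑ a ∈ SA, ∑ b ∈ SB, algebraMap Fqt L (K (toZ b - toZ a)) *
        MvPowerSeries.coeff m (MvPowerSeries.coeff a W * H (-toZ b)) := by
  classical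
  have inner : ∀ e, MvPowerSeries.coeff m (mulL (ofPos W) H e) =
      ∑ a ∈ SA, MvPowerSeries.coeff m (MvPowerSeries.coeff a W * H (e - toZ a)) := by
    intro e
    change ∑ᶠ d, MvPowerSeries.coeff m (ofPos W d * H (e - d)) = _
    rw [finsum_eq_sum_of_support_subset (s := SA.image toZ),
      Finset.sum_image toZ_injective.injOn]
    · simp only [ofPos_toZ]
    · intro d hd
      rw [Function.mem_support] at hd
      obtain ⟨a, rfl⟩ : ∃ a, toZ a = d := by
        by_contra! h
        exact hd (by rw [ofPos_of_forall_ne W h, zero_mul, map_zero])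
      obtain ⟨b, hb⟩ : ∃ b, -toZ b = e - toZ a := by
        by_contra! h
        exact hd (by rw [hH _ h, mul_zero, map_zero])
      rw [ofPos_toZ, ← hb] at hd
      exact Finset.mem_coe.2 (Finset.mem_image_of_mem _ (hA a b hd))
  have supp : ∀ a, (Function.support fun d => algebraMap Fqt L (K d) *
      MvPowerSeries.coeff m (MvPowerSeries.coeff a W * H (-d - toZ a))) ⊆
        SB.image fun b => toZ b - toZ a := by
    intro a d hd
    rw [Function.mem_support] at hd
    obtain ⟨b, hb⟩ : ∃ b, -toZ b = -d - toZ a := by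
      by_contra! h
      exact hd (by rw [hH _ h, mul_zero, map_zero, mul_zero])
    have hd' : d = toZ b - toZ a := by rw [← neg_neg (toZ b), hb]; abel
    rw [← hb] at hd
    subst hd'
    refine Finset.mem_coe.2 (Finset.mem_image_of_mem _ (hB a b ?_ (right_ne_zero_of_mul hd)))
    exact fun h => hd (by rw [h, map_zero, zero_mul])
  rw [iterCT_eq]
  change ∑ᶠ d, MvPowerSeries.coeff m (MvPowerSeries.C (algebraMap Fqt L (K d)) *
    mulL (ofPos W) H (0 - d)) = _
  simp only [MvPowerSeries.coeff_C_mul, inner, Finset.mul_sum, zero_sub]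
  rw [finsum_sum_comm _ _ fun a _ => (Finset.finite_toSet _).subset (supp a)]
  refine Finset.sum_congr rfl fun a _ => ?_
  rw [finsum_eq_sum_of_support_subset _ (supp a), Finset.sum_image]
  · refine Finset.sum_congr rfl fun b _ => ?_
    rw [show -(toZ b - toZ a) - toZ a = -toZ b by abel]
  · intro b _ b' _ h
    exact toZ_injective (sub_left_injective h)

end ConstantTerm

/-! ### The grading of the vertex operator -/

section VertexGrading
variable {r : ℕ}

theorem isHom_coeff_mul {g h : MvPolynomial (Fin r) Lam} {n n' : ℤ}
    (hg : ∀ b, IsHom (coeff b g) (n - b.degree)) (hh : ∀ b, IsHom (coeff b h) (n' - b.degree))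
    (b : Fin r →₀ ℕ) : IsHom (coeff b (g * h)) (n + n' - b.degree) := by
  classical
  rw [coeff_mul]
  refine IsWeightedHomogeneous.sum _ _ _ fun p hp => ?_
  have h1 := (hg p.1).mul (hh p.2)
  have h2 := congrArg Finsupp.degree (Finset.HasAntidiagonal.mem_antidiagonal.1 hp)
  rw [map_add] at h2
  rwa [show n - (p.1.degree : ℤ) + (n' - p.2.degree) = n + n' - b.degree by
    rw [← h2]; push_cast; ring] at h1

theorem isHom_coeff_C {f : Lam} {n : ℤ} (h : IsHom f n) (b : Fin r →₀ ℕ) :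
    IsHom (coeff b (C f : MvPolynomial (Fin r) Lam)) (n - b.degree) := by
  classical
  rw [coeff_C]
  split_ifs with hb
  · subst hb; simpa using h
  · exact isWeightedHomogeneous_zero _ _ _

theorem isHom_coeff_translate_X (j : ℕ+) (b : Fin r →₀ ℕ) :
    IsHom (coeff b (translate r (X j))) ((j : ℕ) - b.degree) := by
  classical
  rw [translate, aeval_X, coeff_add, coeff_C_mul, coeff_sum, Finset.mul_sum]
  refine (isHom_coeff_C (isHom_X j) b).add (IsWeightedHomogeneous.sum _ _ _ fun α _ => ?_)
  rw [coeff_X_pow]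
  split_ifs with hb
  · rw [← hb, Finsupp.degree_single, mul_one, sub_self]
    exact isHom_C _
  · rw [mul_zero]
    exact isWeightedHomogeneous_zero _ _ _

theorem isHom_coeff_translate {f : Lam} {n : ℤ} (h : IsHom f n) (b : Fin r →₀ ℕ) :
    IsHom (coeff b (translate r f)) (n - b.degree) := by
  have key : ∀ (s : ℕ+ →₀ ℕ) (a : Fqt), ∃ n : ℤ, IsHom (monomial s a) n ∧
      ∀ b, IsHom (coeff b (translate r (monomial s a))) (n - b.degree) := by
    intro s a
    refine MvPolynomial.induction_on_monomial (motive := fun f => ∃ n : ℤ, IsHom f n ∧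
      ∀ b, IsHom (coeff b (translate r f)) (n - b.degree)) ?_ ?_ s a
    · intro a
      refine ⟨0, isHom_C a, fun b => ?_⟩
      have h1 : translate r (C a) = C (C a) := by
        rw [← MvPolynomial.algebraMap_eq, AlgHom.commutes]; rfl
      rw [h1]
      exact isHom_coeff_C (isHom_C a) b
    · rintro f j ⟨n, h1, h2⟩
      refine ⟨n + (j : ℕ), h1.mul (isHom_X j), fun b => ?_⟩
      rw [map_mul]
      exact isHom_coeff_mul h2 (isHom_coeff_translate_X j) b
  rw [f.as_sum, map_sum, coeff_sum]
  refine IsWeightedHomogeneous.sum _ _ _ fun s hs => ?_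
  obtain ⟨n', h1, h2⟩ := key s (coeff s f)
  have hne : monomial s (coeff s f) ≠ 0 := by
    simpa [monomial_eq_zero] using hs
  have h3 : IsHom (monomial s (coeff s f)) n :=
    isWeightedHomogeneous_monomial _ _ _ (h (mem_support_iff.1 hs))
  rw [h3.inj_right hne h1]
  exact h2 b

/-- The coefficients of the creation part of the vertex operator. -/
def creationCoeff (a : Fin r →₀ ℕ) : Lam := ∏ α, hs (cM MacVertex.t) (a α)

theorem isHom_creationCoeff (a : Fin r →₀ ℕ) : IsHom (creationCoeff a) a.degree := by
  have h := IsWeightedHomogeneous.prod (w := fun k : ℕ+ => ((k : ℕ) : ℤ)) Finset.univ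
    (fun α => hs (cM MacVertex.t) (a α)) (fun α => ((a α : ℕ) : ℤ)) fun α _ => isHom_hs _ _
  rw [Finsupp.degree_eq_sum, Nat.cast_sum]
  exact h

theorem coeff_creation (a : Fin r →₀ ℕ) :
    MvPowerSeries.coeff a (creation r) = (creationCoeff a : MvPowerSeries ℕ+ Fqt) := by
  rw [creation, coeff_expS_powerSums, creationCoeff, ← coeToMvPowerSeries.ringHom_apply, map_prod]
  refine Finset.prod_congr rfl fun α _ => ?_
  rw [hs, map_expCoeff (coeToMvPowerSeries.ringHom (σ := ℕ+) (R := Fqt))]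
  congr 1
  funext k
  rw [coeToMvPowerSeries.ringHom_apply, C_mul_X_eq_monomial, coe_monomial, cM]

/-- The part of the vertex operator with kernel `K` which has degree `i` in the `z_α` and degree
`j` in the `z_α⁻¹`. -/
def vertexPart (K : Laurent r Fqt) (f : Lam) (i j : ℕ) : Lam :=
  ∑ a ∈ Finset.finsuppAntidiag Finset.univ i, ∑ b ∈ Finset.finsuppAntidiag Finset.univ j,
    K (toZ b - toZ a) • (creationCoeff a * coeff b (translate r f))

theorem mem_finsuppAntidiag_univ {a : Fin r →₀ ℕ} {i : ℕ} :
    a ∈ Finset.finsuppAntidiag Finset.univ i ↔ a.degree = i := by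
  rw [Finset.mem_finsuppAntidiag, Finsupp.degree_eq_sum]
  simp

theorem isHom_vertexPart (K : Laurent r Fqt) {f : Lam} {n : ℤ} (hf : IsHom f n) (i j : ℕ) :
    IsHom (vertexPart K f i j) (i + n - j) := by
  refine IsWeightedHomogeneous.sum _ _ _ fun a ha => IsWeightedHomogeneous.sum _ _ _ fun b hb =>
    isHom_smul _ ?_
  have := (isHom_creationCoeff a).mul (isHom_coeff_translate hf b)
  rw [mem_finsuppAntidiag_univ] at ha hb
  rwa [ha, hb, ← add_sub_assoc] at this

/-- The monomials of degree less than `N`. -/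
def degLT (r N : ℕ) : Finset (Fin r →₀ ℕ) :=
  (Finset.range N).biUnion fun i => Finset.finsuppAntidiag Finset.univ i

theorem mem_degLT {N : ℕ} {a : Fin r →₀ ℕ} : a ∈ degLT r N ↔ a.degree < N := by
  rw [degLT, Finset.mem_biUnion]
  simp only [mem_finsuppAntidiag_univ, Finset.mem_range]
  exact ⟨fun ⟨i, h1, h2⟩ => h2 ▸ h1, fun h => ⟨_, h, rfl⟩⟩

theorem sum_degLT {M : Type*} [AddCommMonoid M] (N : ℕ) (g : (Fin r →₀ ℕ) → M) :
    ∑ a ∈ degLT r N, g a =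
      ∑ i ∈ Finset.range N, ∑ a ∈ Finset.finsuppAntidiag Finset.univ i, g a := by
  rw [degLT, Finset.sum_biUnion]
  intro i _ j _ hij
  rw [Function.onFun, Finset.disjoint_left]
  intro a ha hb
  rw [mem_finsuppAntidiag_univ] at ha hb
  exact hij (ha.symm.trans hb)

theorem coeff_iterCT_vertexAct (K : Laurent r Fqt) {f : Lam} {n : ℕ} (hf : IsHom f n)
    (m : ℕ+ →₀ ℕ) {w : ℕ} (hw : Finsupp.weight (fun k : ℕ+ => ((k : ℕ) : ℤ)) m = w) :
    MvPowerSeries.coeff m (iterCT r (mulL (scal ℕ+ Fqt K) (vertexAct r f))) =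
      ∑ i ∈ Finset.range (w + 1), ∑ j ∈ Finset.range (n + 1), coeff m (vertexPart K f i j) := by
  have hY : ∀ b, ((ofNeg (annihilate r f : MvPowerSeries (Fin r) Lam) (-toZ b) : Lam) :
      MvPowerSeries ℕ+ Fqt) = (coeff b (translate r f) : Lam) := by
    intro b
    rw [ofNeg, neg_neg, ofPos_toZ, annihilate_eq, coeff_coe]
  have hG : ∀ a b, MvPowerSeries.coeff m (MvPowerSeries.coeff a (creation r) *
      ((ofNeg (annihilate r f : MvPowerSeries (Fin r) Lam) (-toZ b) : Lam) :
        MvPowerSeries ℕ+ Fqt)) = coeff m (creationCoeff a * coeff b (translate r f)) := by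
    intro a b
    rw [hY, coeff_creation, ← coe_mul, coeff_coe]
  have hdeg : ∀ a b : Fin r →₀ ℕ, coeff m (creationCoeff a * coeff b (translate r f)) ≠ 0 →
      a.degree < w + 1 ∧ b.degree < n + 1 := by
    intro a b h
    have h1 := (isHom_creationCoeff a).mul (isHom_coeff_translate hf b) h
    have h2 : (0 : ℤ) ≤ n - b.degree := by
      by_contra h2
      rw [(isHom_coeff_translate hf b).eq_zero_of_neg (by omega), mul_zero, coeff_zero] at h
      exact h rfl
    omega
  rw [vertexAct, coeff_iterCT_mulL K (creation r) _ _ m (degLT r (w + 1)) (degLT r (n + 1))]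
  · simp only [hG]
    rw [sum_degLT]
    refine Finset.sum_congr rfl fun i _ => ?_
    simp only [sum_degLT]
    rw [Finset.sum_comm]
    refine Finset.sum_congr rfl fun j _ => ?_
    rw [vertexPart, coeff_sum]
    refine Finset.sum_congr rfl fun a _ => ?_
    rw [coeff_sum]
    refine Finset.sum_congr rfl fun b _ => ?_
    rw [coeff_smul]
    rfl
  · intro a b h
    rw [hG] at h
    exact mem_degLT.2 (hdeg a b h).1
  · intro a b _ h
    rw [hG] at h
    exact mem_degLT.2 (hdeg a b h).2
  · intro e he
    rw [ofNeg, ofPos_of_forall_ne, coe_zero]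
    intro b hb
    exact he b (by rw [hb, neg_neg])

/-- The part of bidegree (i, j) sends degree n to degree i + n - j, while A P_μ lies in degree n. As
the kernel need not be homogeneous, the vanishing for w ≠ n carries information used in
`constPart_eq_zero`. -/
theorem sum_vertexPart {A : Lam →ₗ[Fqt] Lam} {a : Ptn → Fqt} {K : Laurent r Fqt}
    (hA : IsVertexRealizable A a r K) {n : ℕ} (μ : n.Partition) (w : ℕ) :
    ∑ i ∈ Finset.range (w + 1), ∑ j ∈ Finset.range (n + 1),
      (if i + n = w + j then vertexPart K (macP generic_q_t μ) i j else 0) =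
        if w = n then a ⟨n, μ⟩ • macP generic_q_t μ else 0 := by
  have hf := isHom_macP generic_q_t μ
  have hA' : A (macP generic_q_t μ) = a ⟨n, μ⟩ • macP generic_q_t μ := by
    rw [← macdonaldP_eq]; exact hA.eigen ⟨n, μ⟩
  ext m
  obtain ⟨w', hw'⟩ := Int.eq_ofNat_of_zero_le (weight_nonneg m)
  have hz : ∀ i j, i + n ≠ w' + j → coeff m (vertexPart K (macP generic_q_t μ) i j) = 0 := by
    intro i j hne
    by_contra h
    have := isHom_vertexPart K hf i j h
    omega
  have hsum := coeff_iterCT_vertexAct K hf m hw'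
  rw [← hA.realize, coeff_coe, hA'] at hsum
  by_cases hww : w' = w
  · subst hww
    have hR : coeff m (if w' = n then a ⟨n, μ⟩ • macP generic_q_t μ else 0) =
        coeff m (a ⟨n, μ⟩ • macP generic_q_t μ) := by
      split_ifs with h
      · rfl
      · rw [coeff_zero]
        by_contra hc
        have := isHom_smul (a ⟨n, μ⟩) hf (Ne.symm hc)
        omega
    rw [hR, hsum, coeff_sum]
    refine Finset.sum_congr rfl fun i _ => ?_
    rw [coeff_sum]
    refine Finset.sum_congr rfl fun j _ => ?_
    split_ifs with h
    · rfl
    · rw [hz i j h, coeff_zero]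
  · have hL : coeff m (if w = n then a ⟨n, μ⟩ • macP generic_q_t μ else 0) = 0 := by
      split_ifs with h
      · by_contra hc
        have := isHom_smul (a ⟨n, μ⟩) hf hc
        omega
      · exact coeff_zero _
    rw [hL, coeff_sum]
    refine Finset.sum_eq_zero fun i _ => ?_
    rw [coeff_sum]
    refine Finset.sum_eq_zero fun j _ => ?_
    split_ifs with h
    · exact hz i j (by omega)
    · exact coeff_zero _

end VertexGrading

end MacFock

namespace MacFock
open MvPolynomial MacVertex

/-! ### The bracket of a vertex realizable operator -/

theorem coeff_expCoeff_add_powerSum {r : ℕ} {L : Type*} [Field L] [CharZero L] (x y : ℕ+ → L)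
    (n : ℕ) (b : Fin r →₀ ℕ) :
    coeff b (expCoeff (fun k : ℕ+ => C (x k) + C (y k) * ∑ α : Fin r, X α ^ (k : ℕ)) n) =
      if b.degree ≤ n then expCoeff x (n - b.degree) * ∏ α, expCoeff y (b α) else 0 := by
  classical
  have h1 : ∀ j, expCoeff (fun k : ℕ+ => C (y k) * ∑ α : Fin r, X α ^ (k : ℕ)) j =
      ∑ l ∈ Finset.finsuppAntidiag Finset.univ j, monomial l (∏ α, expCoeff y (l α)) := by
    intro j
    have h2 := congrArg (PowerSeries.coeff j) (expPS_sum Finset.univ fun (α : Fin r) (k : ℕ+) =>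
      (X α ^ (k : ℕ) * C (y k) : MvPolynomial (Fin r) L))
    rw [PowerSeries.coeff_prod, expPS, PowerSeries.coeff_mk] at h2
    simp only [Finset.mul_sum]
    rw [show (fun k : ℕ+ => ∑ α : Fin r, (C (y k) * X α ^ (k : ℕ) : MvPolynomial (Fin r) L)) =
      fun k : ℕ+ => ∑ α : Fin r, (X α ^ (k : ℕ) * C (y k) : MvPolynomial (Fin r) L) from
      funext fun k => Finset.sum_congr rfl fun α _ => mul_comm _ _, h2]
    refine Finset.sum_congr rfl fun l _ => ?_
    rw [monomial_eq, Finsupp.prod_fintype _ _ (fun _ => pow_zero _), map_prod,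
      ← Finset.prod_mul_distrib]
    refine Finset.prod_congr rfl fun α _ => ?_
    rw [expPS, PowerSeries.coeff_mk, expCoeff_scale, map_expCoeff (C : L →+* _), mul_comm]
  have h3 : ∀ j, coeff b (expCoeff (fun k : ℕ+ => C (y k) * ∑ α : Fin r, X α ^ (k : ℕ)) j) =
      if b.degree = j then ∏ α, expCoeff y (b α) else 0 := by
    intro j
    rw [h1, coeff_sum]
    simp only [coeff_monomial, Finset.sum_ite_eq', mem_finsuppAntidiag_univ]
  rw [expCoeff_add, coeff_sum]
  simp only [← map_expCoeff (C : L →+* MvPolynomial (Fin r) L) x, coeff_C_mul, h3]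
  split_ifs with hb
  · rw [Finset.sum_eq_single (n - b.degree, b.degree)]
    · simp
    · intro p hp hne
      rw [if_neg, mul_zero]
      intro h
      have := Finset.HasAntidiagonal.mem_antidiagonal.1 hp
      exact hne (Prod.ext (by dsimp only; omega) h.symm)
    · intro h
      exact absurd (Finset.HasAntidiagonal.mem_antidiagonal.2 (by dsimp only; omega)) h
  · refine Finset.sum_eq_zero fun p hp => ?_
    have := Finset.HasAntidiagonal.mem_antidiagonal.1 hp
    rw [if_neg (by omega), mul_zero]

section Bracket
variable {L : Type*} [Field L] [CharZero L] [Algebra Fqt L] {r : ℕ}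

/-- The coefficients in the exponent of `uExp`. -/
def uCoeff (u : L) (n : ℕ+) : L := (-1) ^ (n : ℕ) / ((n : ℕ) : L) * (u ^ (n : ℕ) - 1)

/-- The coefficients in the exponent of `vExp`. -/
def vCoeff (v : L) (n : ℕ+) : L := (-1) ^ (n : ℕ) / ((n : ℕ) : L) * (1 - v ^ (n : ℕ))

/-- The evaluation `p_n ↦ (-t)^n (1 - u^n) / (1 - t^n)`. -/
def evU (u : L) : Lam →ₐ[Fqt] L :=
  evxy MacVertex.t (-algebraMap Fqt L MacVertex.t) (-(algebraMap Fqt L MacVertex.t * u))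

theorem evU_C_mul_X (u : L) (k : ℕ+) : evU u (C (cM MacVertex.t k) * X k) = uCoeff u k := by
  have ht : algebraMap Fqt L MacVertex.t ≠ 0 := (map_ne_zero _).2 generic_q_t.t_ne_zero
  have e1 : algebraMap Fqt L (1 - MacVertex.t ^ (k : ℕ)) ≠ 0 := by
    rw [Ne, FaithfulSMul.algebraMap_eq_zero_iff, sub_eq_zero]
    exact (generic_q_t.t_pow_ne_one k).symm
  have e2 : ((k : ℕ) : L) ≠ 0 := by simp
  have e4 : evU u (X k) = ((-algebraMap Fqt L MacVertex.t) ^ (k : ℕ) -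
      (-(algebraMap Fqt L MacVertex.t * u)) ^ (k : ℕ)) /
        algebraMap Fqt L (1 - MacVertex.t ^ (k : ℕ)) := by simp [evU, evxy]
  rw [map_mul, e4, ← MvPolynomial.algebraMap_eq, AlgHom.commutes, cM, uCoeff,
    neg_pow (algebraMap Fqt L MacVertex.t), neg_pow (algebraMap Fqt L MacVertex.t * u), mul_pow]
  simp only [map_sub, map_one, map_pow, map_div₀, map_inv₀, map_natCast] at e1 ⊢
  field_simp
  ring

theorem evU_creationCoeff (u : L) (a : Fin r →₀ ℕ) :
    evU u (creationCoeff a) = ∏ α, expCoeff (uCoeff u) (a α) := by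
  rw [creationCoeff, map_prod]
  refine Finset.prod_congr rfl fun α _ => ?_
  rw [hs, map_expCoeff (evU u)]
  simp only [evU_C_mul_X]

/-- The coefficients of the bracket of the identity. -/
def bracketOne (u v : L) : ℕ → L :=
  expCoeff fun k => cK (algebraMap Fqt L MacVertex.q) (-v) (-1) k • evU u (X k)

theorem coeff_bracket {u : L} (hu : u ≠ 0) (v : L) (a : Ptn → Fqt) (n : ℕ) :
    PowerSeries.coeff n (bracket u v a) = ∑ μ : n.Partition,
      vWeight v μ * evU u (a ⟨n, μ⟩ • macP generic_q_t μ) := by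
  rw [bracket, PowerSeries.coeff_mk]
  refine Finset.sum_congr rfl fun μ _ => ?_
  rw [map_smul (evU u), evU, evxy_macP_eq_uWeight hu, Algebra.smul_def]
  ring

theorem coeff_bracket_one {u : L} (hu : u ≠ 0) (v : L) (n : ℕ) :
    PowerSeries.coeff n (bracket u v fun _ => 1) = bracketOne u v n := by
  rw [coeff_bracket hu, bracketOne, ← sum_vWeight_smul]
  simp only [one_smul, smul_eq_mul]

theorem cK_mul_dM (v : L) (k : ℕ+) :
    cK (algebraMap Fqt L MacVertex.q) (-v) (-1) k * algebraMap Fqt L (dM MacVertex.q k) =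
      vCoeff v k := by
  have e1 : algebraMap Fqt L (1 - MacVertex.q ^ (k : ℕ)) ≠ 0 := by
    rw [Ne, FaithfulSMul.algebraMap_eq_zero_iff, sub_eq_zero]
    exact (generic_q_t.q_pow_ne_one k).symm
  have e2 : ((k : ℕ) : L) ≠ 0 := by simp
  rw [cK, dM, vCoeff, neg_pow v]
  simp only [map_sub, map_one, map_pow, map_neg] at e1 ⊢
  field_simp
  ring

/-- The Cauchy identity is applied with values in polynomials in the w_α, sending p_k to its
translate evaluated by `evU`. The exponent splits into the one for `bracketOne` and the v-exponent
times ∑ w_α^k, by `cK_mul_dM`. -/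
theorem sum_vWeight_mul_coeff_translate (u v : L) (n : ℕ) (b : Fin r →₀ ℕ) :
    ∑ μ : n.Partition, vWeight v μ * evU u (coeff b (translate r (macP generic_q_t μ))) =
      if b.degree ≤ n then bracketOne u v (n - b.degree) * ∏ α, expCoeff (vCoeff v) (b α)
      else 0 := by
  rw [bracketOne, ← coeff_expCoeff_add_powerSum]
  have h := congrArg (coeff b) (sum_vWeight_smul v
    ((mapAlgHom (σ := Fin r) (evU u)).comp (translate r)) n)
  rw [coeff_sum] at h
  convert h using 2 with μ
  · rw [coeff_smul, smul_eq_mul, AlgHom.comp_apply, mapAlgHom_apply, coeff_map]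
    rfl
  · congr 1
    funext k
    rw [AlgHom.comp_apply, translate, aeval_X, map_add, map_mul, map_sum, mapAlgHom_apply,
      mapAlgHom_apply]
    have h1 : evU u (C (dM MacVertex.q k)) = algebraMap Fqt L (dM MacVertex.q k) := by
      rw [← MvPolynomial.algebraMap_eq, AlgHom.commutes]
    have h2 : ∀ α : Fin r, mapAlgHom (evU u) (X α ^ (k : ℕ)) = X α ^ (k : ℕ) := by
      intro α
      rw [map_pow, mapAlgHom_apply, map_X]
    simp only [h2, map_C, RingHom.coe_coe, h1]
    rw [smul_eq_C_mul, mul_add, ← mul_assoc, ← C_mul, ← C_mul, cK_mul_dM, smul_eq_mul]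

/-- The degree `(i, j)` part of the constant term formula. -/
def constPart (K : Laurent r Fqt) (u v : L) (i j : ℕ) : L :=
  ∑ a ∈ Finset.finsuppAntidiag Finset.univ i, ∑ b ∈ Finset.finsuppAntidiag Finset.univ j,
    algebraMap Fqt L (K (toZ b - toZ a)) *
      ((∏ α, expCoeff (uCoeff u) (a α)) * ∏ α, expCoeff (vCoeff v) (b α))

theorem sum_vWeight_mul_vertexPart (K : Laurent r Fqt) (u v : L) {n j : ℕ} (hj : j ≤ n) (i : ℕ) :
    ∑ μ : n.Partition, vWeight v μ * evU u (vertexPart K (macP generic_q_t μ) i j) =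
      bracketOne u v (n - j) * constPart K u v i j := by
  simp only [vertexPart, map_sum, Finset.mul_sum, constPart]
  rw [Finset.sum_comm]
  refine Finset.sum_congr rfl fun a _ => ?_
  rw [Finset.sum_comm]
  refine Finset.sum_congr rfl fun b hb => ?_
  rw [mem_finsuppAntidiag_univ] at hb
  have h := sum_vWeight_mul_coeff_translate u v n b
  rw [hb, if_pos hj] at h
  calc _ = algebraMap Fqt L (K (toZ b - toZ a)) * (∏ α, expCoeff (uCoeff u) (a α)) *
        ∑ μ : n.Partition, vWeight v μ * evU u (coeff b (translate r (macP generic_q_t μ))) := by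
        rw [Finset.mul_sum]
        refine Finset.sum_congr rfl fun μ _ => ?_
        rw [map_smul (evU u), map_mul, evU_creationCoeff, Algebra.smul_def]
        ring
    _ = _ := by rw [h]; ring

theorem sum_constPart {A : Lam →ₗ[Fqt] Lam} {a : Ptn → Fqt} {K : Laurent r Fqt}
    (hA : IsVertexRealizable A a r K) {u : L} (hu : u ≠ 0) (v : L) (n w : ℕ) :
    ∑ i ∈ Finset.range (w + 1), ∑ j ∈ Finset.range (n + 1),
      (if i + n = w + j then bracketOne u v (n - j) * constPart K u v i j else 0) =
        if w = n then PowerSeries.coeff n (bracket u v a) else 0 := by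
  have h : ∑ μ : n.Partition, vWeight v μ * evU u (∑ i ∈ Finset.range (w + 1),
      ∑ j ∈ Finset.range (n + 1),
        (if i + n = w + j then vertexPart K (macP generic_q_t μ) i j else 0)) =
      if w = n then PowerSeries.coeff n (bracket u v a) else 0 := by
    simp only [sum_vertexPart hA]
    split_ifs
    · rw [coeff_bracket hu]
    · simp
  rw [← h]
  simp only [map_sum, Finset.mul_sum]
  rw [Finset.sum_comm (s := (Finset.univ : Finset n.Partition))]
  refine Finset.sum_congr rfl fun i _ => ?_
  rw [Finset.sum_comm (s := (Finset.univ : Finset n.Partition))]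
  refine Finset.sum_congr rfl fun j hj => ?_
  split_ifs
  · rw [sum_vWeight_mul_vertexPart K u v (by have := Finset.mem_range.1 hj; omega)]
  · simp

theorem bracketOne_zero (u v : L) : bracketOne u v 0 = 1 := expCoeff_zero _

/-- In the relation for input degree j and output degree i, only bidegrees with difference i - j
occur. Those with smaller second entry vanish by induction, and the remaining one appears with
factor `bracketOne u v 0`, which is 1. -/
theorem constPart_eq_zero {A : Lam →ₗ[Fqt] Lam} {a : Ptn → Fqt} {K : Laurent r Fqt}
    (hA : IsVertexRealizable A a r K) {u : L} (hu : u ≠ 0) (v : L) {i j : ℕ} (hij : i ≠ j) :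
    constPart K u v i j = 0 := by
  induction j using Nat.strong_induction_on generalizing i with
  | _ j ih =>
    have h := sum_constPart hA hu v j i
    rw [if_neg hij, Finset.sum_eq_single i, Finset.sum_eq_single j, if_pos rfl, Nat.sub_self,
      bracketOne_zero, one_mul] at h
    · exact h
    · intro j' _ hj'
      exact if_neg (by omega)
    · intro h
      exact absurd (Finset.self_mem_range_succ _) h
    · intro i' hi' hne
      refine Finset.sum_eq_zero fun j' hj' => ?_
      rw [Finset.mem_range] at hi' hj'
      split_ifs with he
      · rw [ih j' (by omega) (by omega), mul_zero]
      · rfl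
    · intro h
      exact absurd (Finset.self_mem_range_succ _) h

theorem coeff_bracket_eq_sum {A : Lam →ₗ[Fqt] Lam} {a : Ptn → Fqt} {K : Laurent r Fqt}
    (hA : IsVertexRealizable A a r K) {u : L} (hu : u ≠ 0) (v : L) (n : ℕ) :
    PowerSeries.coeff n (bracket u v a) =
      ∑ j ∈ Finset.range (n + 1), constPart K u v j j * bracketOne u v (n - j) := by
  have h := sum_constPart hA hu v n n
  rw [if_pos rfl] at h
  rw [← h]
  refine Finset.sum_congr rfl fun i hi => ?_
  rw [Finset.sum_eq_single i]
  · rw [if_pos (by omega), mul_comm]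
  · intro j _ hj
    exact if_neg (by omega)
  · exact fun h => absurd hi h

theorem coeff_uExp (u : L) (a : Fin r →₀ ℕ) : MvPowerSeries.coeff a (uExp r u) =
    PowerSeries.monomial a.degree (∏ α, expCoeff (uCoeff u) (a α)) := by
  rw [uExp, coeff_expS_powerSums, Finsupp.degree_eq_sum, ← PowerSeries.prod_monomial]
  refine Finset.prod_congr rfl fun α _ => ?_
  have h : ∀ (n : ℕ) (x : L), PowerSeries.monomial n x = PowerSeries.X ^ n * PowerSeries.C x := by
    intro n x
    rw [PowerSeries.monomial_eq_C_mul_X_pow, mul_comm]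
  simp only [h]
  rw [expCoeff_scale, map_expCoeff (PowerSeries.C : L →+* PowerSeries L)]
  rfl

theorem coeff_vExp (v : L) (b : Fin r →₀ ℕ) : MvPowerSeries.coeff b (vExp r v) =
    PowerSeries.C (∏ α, expCoeff (vCoeff v) (b α)) := by
  rw [vExp, coeff_expS_powerSums, map_prod]
  refine Finset.prod_congr rfl fun α _ => ?_
  rw [map_expCoeff (PowerSeries.C : L →+* PowerSeries L)]
  rfl

theorem coeff_iterCT_uExp_vExp {A : Lam →ₗ[Fqt] Lam} {a : Ptn → Fqt} {K : Laurent r Fqt}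
    (hA : IsVertexRealizable A a r K) {u : L} (hu : u ≠ 0) (v : L) (n : ℕ) :
    PowerSeries.coeff n (iterCT r (mulL (scal Unit L K)
      (mulL (ofPos (uExp r u)) (ofNeg (vExp r v))))) = constPart K u v n n := by
  classical
  have hG : ∀ a b : Fin r →₀ ℕ, MvPowerSeries.coeff (Finsupp.single () n)
      (MvPowerSeries.coeff a (uExp r u) * ofNeg (vExp r v) (-toZ b)) =
      if a.degree = n then
        (∏ α, expCoeff (uCoeff u) (a α)) * ∏ α, expCoeff (vCoeff v) (b α) else 0 := by
    intro a b
    rw [ofNeg, neg_neg, ofPos_toZ, coeff_uExp, coeff_vExp]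
    change PowerSeries.coeff n _ = _
    rw [PowerSeries.coeff_mul_C, PowerSeries.coeff_monomial]
    simp only [eq_comm (a := n), ite_mul, zero_mul]
  -- Here b has no bound of its own, since Q does not mark the z_α⁻¹. For a of degree n all entries
  -- of b - a are at least -n, so the finiteness condition on the kernel leaves finitely many
  -- differences.
  obtain ⟨J, hJ, hnJ⟩ : ∃ J : ℕ, (∀ a b : Fin r →₀ ℕ, a.degree = n → K (toZ b - toZ a) ≠ 0 →
      b.degree < J) ∧ n < J := by
    refine ⟨n + 1 + ∑ d ∈ (hA.laurent n).toFinset, ∑ i, (d i).natAbs, fun a b ha hK => ?_, by omega⟩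
    have hmem : toZ b - toZ a ∈ (hA.laurent n).toFinset := by
      rw [Set.Finite.mem_toFinset]
      refine ⟨hK, fun i => ?_⟩
      have : a i ≤ n := ha ▸ Finsupp.le_degree i a
      simp only [Pi.sub_apply, toZ]
      omega
    have h1 := Finset.single_le_sum (f := fun d : Fin r → ℤ => ∑ i, (d i).natAbs)
      (fun _ _ => Nat.zero_le _) hmem
    have h2 : b.degree ≤ a.degree + ∑ i, ((toZ b - toZ a) i).natAbs := by
      rw [Finsupp.degree_eq_sum, Finsupp.degree_eq_sum, ← Finset.sum_add_distrib]
      refine Finset.sum_le_sum fun i _ => ?_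
      simp only [Pi.sub_apply, toZ]
      omega
    omega
  rw [PowerSeries.coeff, coeff_iterCT_mulL K (uExp r u) _ _ _
    (Finset.finsuppAntidiag Finset.univ n) (degLT r J)]
  · simp only [hG, sum_degLT]
    rw [Finset.sum_comm, Finset.sum_eq_single n]
    · refine Finset.sum_congr rfl fun a ha => Finset.sum_congr rfl fun b _ => ?_
      rw [if_pos (mem_finsuppAntidiag_univ.1 ha)]
    · intro j _ hj
      -- The parts off the diagonal, which would obstruct the comparison of powers of Q, drop out.
      rw [← constPart_eq_zero hA hu v (Ne.symm hj)]
      refine Finset.sum_congr rfl fun a ha => Finset.sum_congr rfl fun b _ => ?_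
      rw [if_pos (mem_finsuppAntidiag_univ.1 ha)]
    · exact fun h => absurd (Finset.mem_range.2 hnJ) h
  · intro a b h
    rw [hG] at h
    exact mem_finsuppAntidiag_univ.2 (of_not_not fun h' => h (if_neg h'))
  · intro a b hK h
    rw [hG] at h
    exact mem_degLT.2 (hJ a b (of_not_not fun h' => h (if_neg h')) hK)
  · intro e he
    rw [ofNeg, ofPos_of_forall_ne]
    intro b hb
    exact he b (by rw [hb, neg_neg])

end Bracket

end MacFock

open MacFock

theorem mainTheorem7 {L : Type*} [Field L] [CharZero L] [Algebra MacVertex.Fqt L] (u v : L)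
    (hu : u ≠ 0) (r : ℕ) (A : MacVertex.Lam →ₗ[MacVertex.Fqt] MacVertex.Lam)
    (a : MacVertex.Ptn → MacVertex.Fqt) (K : MacVertex.Laurent r MacVertex.Fqt)
    (hA : MacVertex.IsVertexRealizable A a r K) :
    MacVertex.normBracket u v a =
      MacVertex.iterCT r
        (MacVertex.mulL (MacVertex.scal Unit L K)
          (MacVertex.mulL (MacVertex.ofPos (MacVertex.uExp r u))
            (MacVertex.ofNeg (MacVertex.vExp r v)))) := by
  have h0 : PowerSeries.constantCoeff (MacVertex.bracket u v fun _ => 1) ≠ 0 := by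
    rw [← PowerSeries.coeff_zero_eq_constantCoeff_apply, coeff_bracket_one hu, bracketOne_zero]
    exact one_ne_zero
  rw [MacVertex.normBracket, eq_comm, PowerSeries.eq_mul_inv_iff_mul_eq h0]
  ext n
  rw [PowerSeries.coeff_mul, Finset.Nat.sum_antidiagonal_eq_sum_range_succ_mk,
    coeff_bracket_eq_sum hA hu]
  refine Finset.sum_congr rfl fun j _ => ?_
  rw [coeff_bracket_one hu, coeff_iterCT_uExp_vExp hA hu]

end
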